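/- Let $G$ be a (Hausdorff) locally compact group with left Haar measure $dx$ and modular function $m$ (normalized by $\mu(Ax)=m(x)\mu(A)$), let $\mathbb T$ be the circle group with normalized Haar measure $d\tau$, and let $c\colon G\times G\to\mathbb T$ be a continuous $2$-cocycle, i.e. $c$ is continuous, $c(x,y)c(xy,z)=c(x,yz)c(y,z)$ and $c(x,e)=c(e,x)=1$. For $n\in\mathbb Z$ the pointwise power $c^n$ is again a continuous $2$-cocycle. The Mackey group $G_c$ is $G\times\mathbb T$ with the product topology, the group law $(x,\sigma)(y,\tau)=(xy,\sigma\tau\overline{c(x,y)})$ and the product measure as Haar measure. Put $$(f\natural_c g)(x)=\int_G f(y)g(y^{-1}x)c(y,y^{-1}x)\,dy,\qquad f^{*_c}(x)=m(x^{-1})\overline{c(x,x^{-1})f(x^{-1})},$$ $$(F*H)(z)=\int_{G_c}F(w)H(w^{-1}z)\,dw,\qquad F^*(x,\tau)=m(x^{-1})\overline{F((x,\tau)^{-1})},$$ and, for a function $F$ on $G_c$ and $k\in\mathbb Z$, let $F_k(x)=\int_{\mathbb T}F(x,\tau)\overline{\tau}^{\,k}\,d\tau$. Let $L^1(G,c)$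 be $L^1(G)$ with the product $\natural_c$ and the involution $^{*_c}$, and let $L^1(G_c)$ carry $*$ and $^*$. (i) Let $1\le p<\infty$, $F\in L^1(G_c)$ and $H\in L^p(G_c)$. Then $F*H\in L^p(G_c)$ and, for every $n$, $F_n\in L^1(G)$ and $H_n, F_n\natural_{c^n}H_n\in L^p(G)$ (the integrals that define the two convolutions converge absolutely almost everywhere), and $$(F*H)(x,\tau)=\sum_{n\in\mathbb Z}(F_n\natural_{c^n}H_n)(x)\,\tau^n$$ as a Fourier series in the $\mathbb T$-variable, that is: $(F*H)_n=F_n\natural_{c^n}H_n$ almost everywhere on $G$ for every $n\in\mathbb Z$; the Cesàro means of the symmetric partial sums $\sum_{|n|\le N}$ of the series converge to $F*H$ in $L^p(G_c)$ and, for almost every $x\in G$, in $L^p(\mathbb T)$ as functions of $\tau$; and if $1<p<\infty$, the symmetric partial sums themselves converge to $F*H$ in these two senses. (ii) For every $F\in L^1(G_c)$ one has $F^*\in L^1(G_c)$ and $(F^*)_n(x)=(F_n)^{*_{c^n}}(x)$ for all $n\in\mathbb Z$ and $x\in G$. (iii) $L^1(G_c)$ and $L^1(G,c^n)$, $n\in\mathbb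 Z$, are Banach $*$-algebras, and for every $n\in\mathbb Z$ the set $L^1(G_c)_n=\{F\in L^1(G_c): F_k=0 \text{ a.e. for all } k\ne n\}$ is a closed linear subspace of $L^1(G_c)$ that is closed under $*$ and $^*$. The map $f\mapsto\big((x,\tau)\mapsto f(x)\tau^n\big)$ is an isometric $*$-isomorphism of $L^1(G,c^n)$ onto $L^1(G_c)_n$, with inverse $F\mapsto F_n$; in particular $L^1(G_c)_n\cong L^1(G,c^n)$ as Banach $*$-algebras. -/

import Mathlib

open MeasureTheory Filter Topology
open scoped ENNReal NNReal

noncomputable section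

/-! ### Continuous 2-cocycles and the Mackey group -/

/-- A (normalized) continuous 2-cocycle on `G` with values in the circle group. -/
structure ContinuousTwoCocycle (G : Type*) [Group G] [TopologicalSpace G] where
  toFun : G → G → Circle
  continuous_toFun : Continuous (fun q : G × G => toFun q.1 q.2)
  cocycle : ∀ x y z : G, toFun x y * toFun (x * y) z = toFun x (y * z) * toFun y z
  map_one_right : ∀ x : G, toFun x 1 = 1
  map_one_left : ∀ x : G, toFun 1 x = 1

namespace ContinuousTwoCocycle

variable {G : Type*} [Group G] [TopologicalSpace G]

instance : CoeFun (ContinuousTwoCocycle G) (fun _ => G → G → Circle) := ⟨toFun⟩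

/-- The pointwise power `cⁿ`, `n ∈ ℤ`, of a cocycle. -/
instance : Pow (ContinuousTwoCocycle G) ℤ where
  pow c n :=
    { toFun := fun x y => c x y ^ n
      continuous_toFun := c.continuous_toFun.zpow n
      cocycle := fun x y z => by rw [← mul_zpow, ← mul_zpow, c.cocycle]
      map_one_right := fun x => by rw [c.map_one_right, one_zpow]
      map_one_left := fun x => by rw [c.map_one_left, one_zpow] }

theorem zpow_apply (c : ContinuousTwoCocycle G) (n : ℤ) (x y : G) : (c ^ n) x y = c x y ^ n := rfl

theorem map_inv_self (c : ContinuousTwoCocycle G) (x : G) : c x x⁻¹ = c x⁻¹ x := by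
  have h := c.cocycle x x⁻¹ x
  rwa [mul_inv_cancel, inv_mul_cancel, c.map_one_left, c.map_one_right, mul_one, one_mul] at h

end ContinuousTwoCocycle

/-- The Mackey group `G_c`: the space `G × 𝕋` with the product topology and the group law
`(x, σ) (y, τ) = (x y, σ τ conj (c (x, y)))`. -/
def MackeyGroup {G : Type*} [Group G] [TopologicalSpace G] (_c : ContinuousTwoCocycle G) :
    Type _ :=
  G × Circle

instance : MeasurableSpace Circle := borel Circle

instance : BorelSpace Circle := ⟨rfl⟩

namespace MackeyGroup

variable {G : Type*} [Group G] [TopologicalSpace G] {c : ContinuousTwoCocycle G}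

/-- The element `(x, τ)` of the Mackey group. -/
def mk (c : ContinuousTwoCocycle G) (x : G) (τ : Circle) : MackeyGroup c := ((x, τ) : G × Circle)

/-- The `G`-component. -/
def base (z : MackeyGroup c) : G := Prod.fst z

/-- The circle component. -/
def phase (z : MackeyGroup c) : Circle := Prod.snd z

@[ext]
theorem ext {z w : MackeyGroup c} (h₁ : z.base = w.base) (h₂ : z.phase = w.phase) : z = w :=
  Prod.ext h₁ h₂

instance : Mul (MackeyGroup c) :=
  ⟨fun z w => mk c (z.base * w.base) (z.phase * w.phase * (c z.base w.base)⁻¹)⟩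

instance : One (MackeyGroup c) := ⟨mk c 1 1⟩

instance : Inv (MackeyGroup c) :=
  ⟨fun z => mk c z.base⁻¹ (z.phase⁻¹ * c z.base⁻¹ z.base)⟩

instance : Group (MackeyGroup c) :=
  Group.ofLeftAxioms
    (by
      intro z w v
      apply MackeyGroup.ext
      · exact mul_assoc z.base w.base v.base
      · change (z.phase * w.phase * (c z.base w.base)⁻¹) * v.phase
            * (c (z.base * w.base) v.base)⁻¹
          = z.phase * (w.phase * v.phase * (c w.base v.base)⁻¹)
            * (c z.base (w.base * v.base))⁻¹
        have h := congrArg (fun t => t⁻¹) (c.cocycle z.base w.base v.base)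
        simp only [mul_inv] at h
        calc _ = z.phase * w.phase * v.phase *
              ((c z.base w.base)⁻¹ * (c (z.base * w.base) v.base)⁻¹) := by ac_rfl
          _ = _ := by rw [h]; ac_rfl)
    (by
      intro z
      apply MackeyGroup.ext
      · exact one_mul z.base
      · change 1 * z.phase * (c 1 z.base)⁻¹ = z.phase
        simp [c.map_one_left])
    (by
      intro z
      apply MackeyGroup.ext
      · exact inv_mul_cancel z.base
      · change z.phase⁻¹ * c z.base⁻¹ z.base * z.phase * (c z.base⁻¹ z.base)⁻¹ = 1
        simp [mul_comm])

instance : TopologicalSpace (MackeyGroup c) := inferInstanceAs (TopologicalSpace (G × Circle))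

instance [MeasurableSpace G] : MeasurableSpace (MackeyGroup c) :=
  inferInstanceAs (MeasurableSpace (G × Circle))

end MackeyGroup

/-- The normalized Haar measure on the circle group, of total mass one. -/
def haarT : Measure Circle := Measure.haarMeasure ⊤

instance : IsProbabilityMeasure haarT := ⟨Measure.haarMeasure_self⟩

/-- The Haar measure of the Mackey group: the product of the Haar measure `μ` of `G` and the
normalized Haar measure of the circle. -/
def mackeyMeasure {G : Type*} [Group G] [TopologicalSpace G] [MeasurableSpace G]
    (c : ContinuousTwoCocycle G) (μ : Measure G) : Measure (MackeyGroup c) :=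
  (μ.prod haarT : Measure (G × Circle))

/-- The product measure is invariant under left translations of the Mackey group. -/
theorem measurePreserving_mackey_mul_left {G : Type*} [Group G] [TopologicalSpace G]
    [IsTopologicalGroup G] [MeasurableSpace G] [BorelSpace G] (c : ContinuousTwoCocycle G)
    (μ : Measure G) [μ.IsMulLeftInvariant] (w : MackeyGroup c) :
    MeasurePreserving (fun z => w * z) (mackeyMeasure c μ) (mackeyMeasure c μ) := by
  have hc : Continuous (fun x : G => c w.base x) :=
    c.continuous_toFun.comp (continuous_const.prodMk continuous_id)
  have hcont : Continuous (fun z : G × Circle =>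
      ((w.base * z.1, w.phase * z.2 * (c w.base z.1)⁻¹) : G × Circle)) := by
    have := hc.comp (continuous_fst (X := G) (Y := Circle))
    fun_prop
  have hm : Measurable (fun z : G × Circle =>
      ((w.base * z.1, w.phase * z.2 * (c w.base z.1)⁻¹) : G × Circle)) := hcont.measurable
  refine ⟨hm, ?_⟩
  change Measure.map (fun z : G × Circle =>
      ((w.base * z.1, w.phase * z.2 * (c w.base z.1)⁻¹) : G × Circle)) (μ.prod haarT)
    = μ.prod haarT
  ext s hs
  rw [Measure.map_apply hm hs, Measure.prod_apply (hm hs), Measure.prod_apply hs,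
    
    ← lintegral_mul_left_eq_self (fun x => haarT (Prod.mk x ⁻¹' s)) w.base]
  refine lintegral_congr fun x => ?_
  have hT : haarT.IsMulLeftInvariant := inferInstanceAs (Measure.haarMeasure ⊤).IsMulLeftInvariant
  rw [← measure_preimage_mul haarT (w.phase * (c w.base x)⁻¹) (Prod.mk (w.base * x) ⁻¹' s)]
  congr 1
  ext τ
  simp only [Set.mem_preimage]
  rw [mul_right_comm]

/-! ### The modular function -/

/-- The modular function `m` of `G`, normalized by `μ (A x) = m(x) μ(A)` for left Haar measures
`μ`. Mathlib's `modularCharacterFun x` is the factor of `A ↦ μ (A x⁻¹)`, whence the inverse. -/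
def modularFn {G : Type*} [Group G] [TopologicalSpace G] [IsTopologicalGroup G]
    [LocallyCompactSpace G] (x : G) : ℝ :=
  (Measure.modularCharacterFun x⁻¹ : ℝ≥0)

theorem measure_mul_right_eq_modularFn {G : Type*} [Group G] [TopologicalSpace G]
    [IsTopologicalGroup G] [LocallyCompactSpace G] [MeasurableSpace G] [BorelSpace G]
    (μ : Measure G) [μ.IsHaarMeasure] [μ.Regular] (x : G) (A : Set G) :
    μ ((fun y => y * x) '' A) = ENNReal.ofReal (modularFn x) * μ A := by
  have h : μ.map (fun y => y * x⁻¹) = Measure.modularCharacterFun x⁻¹ • μ := by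
    rw [Measure.modularCharacterFun_eq_haarScalarFactor μ]
    have : (μ.map (fun y => y * x⁻¹)).Regular := Measure.Regular.map (Homeomorph.mulRight x⁻¹)
    exact Measure.isMulLeftInvariant_eq_smul_of_regular _ μ
  have h2 : (fun y => y * x) '' A = (fun y => y * x⁻¹) ⁻¹' A := by
    simp
  have h3 : μ.map (fun y => y * x⁻¹) A = μ ((fun y => y * x⁻¹) ⁻¹' A) :=
    (MeasurableEquiv.mulRight x⁻¹).map_apply A
  rw [h2, ← h3, h, modularFn, ENNReal.ofReal_coe_nnreal]
  rfl

/-! ### Convolutions, involutions and Fourier coefficients -/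

section Operations

variable {G : Type*} [Group G] [TopologicalSpace G]

/-- The integrand of the twisted convolution at `x`. -/
def twistedIntegrand (c : ContinuousTwoCocycle G) (f g : G → ℂ) (x y : G) : ℂ :=
  f y * g (y⁻¹ * x) * (c y (y⁻¹ * x) : ℂ)

/-- The twisted convolution `f ♮_c g`. -/
def twistedConv [MeasurableSpace G] (c : ContinuousTwoCocycle G) (μ : Measure G)
    (f g : G → ℂ) (x : G) : ℂ :=
  ∫ y, twistedIntegrand c f g x y ∂μ

/-- The twisted involution `f^{*_c}(x) = m(x⁻¹) conj (c (x, x⁻¹) f(x⁻¹))`. -/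
def twistedInvol [IsTopologicalGroup G] [LocallyCompactSpace G] (c : ContinuousTwoCocycle G)
    (f : G → ℂ) (x : G) : ℂ :=
  (modularFn x⁻¹ : ℂ) * starRingEnd ℂ ((c x x⁻¹ : ℂ) * f x⁻¹)

/-- The convolution `F * H` on the Mackey group. -/
def mackeyConv [MeasurableSpace G] (c : ContinuousTwoCocycle G) (μ : Measure G)
    (F H : MackeyGroup c → ℂ) (z : MackeyGroup c) : ℂ :=
  ∫ w, F w * H (w⁻¹ * z) ∂(mackeyMeasure c μ)

/-- The involution `F^*(z) = m(x⁻¹) conj (F (z⁻¹))`, `z = (x, τ)`, on the Mackey group, whose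
modular function is that of `G`. -/
def mackeyInvol [IsTopologicalGroup G] [LocallyCompactSpace G] {c : ContinuousTwoCocycle G}
    (F : MackeyGroup c → ℂ) (z : MackeyGroup c) : ℂ :=
  (modularFn z.base⁻¹ : ℂ) * starRingEnd ℂ (F z⁻¹)

/-- The Fourier coefficient `F_k(x) = ∫_𝕋 F(x, τ) conj(τ)^k dτ`. -/
def fourierCoeffT {c : ContinuousTwoCocycle G} (F : MackeyGroup c → ℂ) (k : ℤ) (x : G) : ℂ :=
  ∫ τ : Circle, F (MackeyGroup.mk c x τ) * (starRingEnd ℂ (τ : ℂ)) ^ k ∂haarT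

/-- The symmetric partial sum `∑_{|n| ≤ N} a_n(x) τⁿ`. -/
def trigPartialSum (c : ContinuousTwoCocycle G) (a : ℤ → G → ℂ) (N : ℕ) (z : MackeyGroup c) : ℂ :=
  ∑ n ∈ Finset.Icc (-(N : ℤ)) (N : ℤ), a n z.base * (z.phase : ℂ) ^ n

/-- The Cesàro mean of the first `N + 1` symmetric partial sums. -/
def trigCesaroMean (c : ContinuousTwoCocycle G) (a : ℤ → G → ℂ) (N : ℕ) (z : MackeyGroup c) : ℂ :=
  ((N : ℂ) + 1)⁻¹ * ∑ k ∈ Finset.range (N + 1), trigPartialSum c a k z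

/-- The functions `S N` converge to `K` in `L^p(G_c)`, and for almost every `x ∈ G` the functions
`S N (x, ·)` converge to `K(x, ·)` in `L^p(𝕋)`. -/
def ConvergesInLp [MeasurableSpace G] {c : ContinuousTwoCocycle G} (μ : Measure G) (p : ℝ≥0∞)
    (S : ℕ → MackeyGroup c → ℂ) (K : MackeyGroup c → ℂ) : Prop :=
  Tendsto (fun N => eLpNorm (fun z => S N z - K z) p (mackeyMeasure c μ)) atTop (𝓝 0) ∧
  ∀ᵐ x ∂μ, Tendsto (fun N => eLpNorm
    (fun τ => S N (MackeyGroup.mk c x τ) - K (MackeyGroup.mk c x τ)) p haarT) atTop (𝓝 0)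

end Operations

/-! ### The Banach `*`-algebras -/

/-- The class in `L¹` of an integrable function (and `0` for other functions). -/
def toL1 {X : Type*} [MeasurableSpace X] (ν : Measure X) (f : X → ℂ) : Lp ℂ 1 ν :=
  open Classical in if h : MemLp f 1 ν then h.toLp f else 0

/-- The axioms of a (not necessarily unital) complex Banach `*`-algebra, with isometric
involution. -/
structure IsBanachStarAlgebra (A : Type*) [NormedAddCommGroup A] [NormedSpace ℂ A] [Mul A]
    [Star A] : Prop where
  complete : CompleteSpace A
  mul_assoc : ∀ a b d : A, a * b * d = a * (b * d)
  add_mul : ∀ a b d : A, (a + b) * d = a * d + b * d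
  mul_add : ∀ a b d : A, a * (b + d) = a * b + a * d
  smul_mul : ∀ (r : ℂ) (a b : A), (r • a) * b = r • (a * b)
  mul_smul : ∀ (r : ℂ) (a b : A), a * (r • b) = r • (a * b)
  norm_mul_le : ∀ a b : A, ‖a * b‖ ≤ ‖a‖ * ‖b‖
  star_star : ∀ a : A, star (star a) = a
  star_mul : ∀ a b : A, star (a * b) = star b * star a
  star_add : ∀ a b : A, star (a + b) = star a + star b
  star_smul : ∀ (r : ℂ) (a : A), star (r • a) = starRingEnd ℂ r • star a
  norm_star : ∀ a : A, ‖star a‖ = ‖a‖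

section Algebras

variable {G : Type*} [Group G] [TopologicalSpace G] [MeasurableSpace G]

/-- `L¹(G, c)`: the Banach space `L¹(G)`, with twisted convolution and twisted involution. -/
def TwistedL1 (_c : ContinuousTwoCocycle G) (μ : Measure G) : Type _ := ↥(Lp ℂ 1 μ)

/-- `L¹(G_c)`, with the convolution and the involution of the Mackey group. -/
def MackeyL1 (c : ContinuousTwoCocycle G) (μ : Measure G) : Type _ :=
  ↥(Lp ℂ 1 (mackeyMeasure c μ))

variable {c : ContinuousTwoCocycle G} {μ : Measure G}

instance : NormedAddCommGroup (TwistedL1 c μ) := inferInstanceAs (NormedAddCommGroup (Lp ℂ 1 μ))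

instance : NormedSpace ℂ (TwistedL1 c μ) := inferInstanceAs (NormedSpace ℂ (Lp ℂ 1 μ))

instance : NormedAddCommGroup (MackeyL1 c μ) :=
  inferInstanceAs (NormedAddCommGroup (Lp ℂ 1 (mackeyMeasure c μ)))

instance : NormedSpace ℂ (MackeyL1 c μ) :=
  inferInstanceAs (NormedSpace ℂ (Lp ℂ 1 (mackeyMeasure c μ)))

/-- A representative of an element of `L¹(G, c)`. -/
def TwistedL1.rep (f : TwistedL1 c μ) : G → ℂ := ((show Lp ℂ 1 μ from f) : G → ℂ)

/-- A representative of an element of `L¹(G_c)`. -/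
def MackeyL1.rep (F : MackeyL1 c μ) : MackeyGroup c → ℂ :=
  ((show Lp ℂ 1 (mackeyMeasure c μ) from F) : MackeyGroup c → ℂ)

instance : Mul (TwistedL1 c μ) := ⟨fun f g => toL1 μ (twistedConv c μ f.rep g.rep)⟩

instance : Mul (MackeyL1 c μ) :=
  ⟨fun F H => toL1 (mackeyMeasure c μ) (mackeyConv c μ F.rep H.rep)⟩

instance [IsTopologicalGroup G] [LocallyCompactSpace G] : Star (TwistedL1 c μ) :=
  ⟨fun f => toL1 μ (twistedInvol c f.rep)⟩

instance [IsTopologicalGroup G] [LocallyCompactSpace G] : Star (MackeyL1 c μ) :=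
  ⟨fun F => toL1 (mackeyMeasure c μ) (mackeyInvol F.rep)⟩

theorem MackeyL1.fibre_integrable (F : MackeyL1 c μ) (k : ℤ) :
    ∀ᵐ x ∂μ, Integrable (fun τ : Circle =>
      F.rep (MackeyGroup.mk c x τ) * (starRingEnd ℂ (τ : ℂ)) ^ k) haarT := by
  have h : Integrable (F.rep : G × Circle → ℂ) (μ.prod haarT) :=
    memLp_one_iff_integrable.1 (Lp.memLp (show Lp ℂ 1 (mackeyMeasure c μ) from F))
  have h' := ((integrable_prod_iff h.aestronglyMeasurable).1 h).1
  filter_upwards [h'] with x hx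
  refine hx.mul_bdd (c := 1) ?_ ?_
  · refine Continuous.aestronglyMeasurable ?_
    refine Continuous.zpow₀ (Complex.continuous_conj.comp continuous_subtype_val) k ?_
    intro τ
    exact Or.inl (by simpa using Circle.coe_ne_zero τ)
  · refine Eventually.of_forall fun τ => ?_
    simp [norm_zpow, Circle.norm_coe]

theorem MackeyL1.fourierCoeffT_add (F H : MackeyL1 c μ) (k : ℤ) :
    fourierCoeffT (F + H).rep k =ᵐ[μ] fourierCoeffT F.rep k + fourierCoeffT H.rep k := by
  have h : ∀ᵐ z ∂(μ.prod haarT : Measure (G × Circle)), (F + H).rep z = F.rep z + H.rep z :=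
    Lp.coeFn_add (show Lp ℂ 1 (mackeyMeasure c μ) from F) (show Lp ℂ 1 (mackeyMeasure c μ) from H)
  filter_upwards [Measure.ae_ae_of_ae_prod h, F.fibre_integrable k, H.fibre_integrable k]
    with x hx hF hH
  simp only [fourierCoeffT, Pi.add_apply]
  rw [← integral_add hF hH]
  refine integral_congr_ae ?_
  filter_upwards [hx] with τ hτ
  rw [← add_mul]
  exact congrArg (· * _) hτ

theorem MackeyL1.fourierCoeffT_smul (r : ℂ) (F : MackeyL1 c μ) (k : ℤ) :
    fourierCoeffT (r • F).rep k =ᵐ[μ] r • fourierCoeffT F.rep k := by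
  have h : ∀ᵐ z ∂(μ.prod haarT : Measure (G × Circle)), (r • F).rep z = r * F.rep z :=
    Lp.coeFn_smul r (show Lp ℂ 1 (mackeyMeasure c μ) from F)
  filter_upwards [Measure.ae_ae_of_ae_prod h] with x hx
  simp only [fourierCoeffT, Pi.smul_apply, smul_eq_mul]
  rw [← integral_const_mul]
  refine integral_congr_ae ?_
  filter_upwards [hx] with τ hτ
  rw [← mul_assoc]
  exact congrArg (· * _) hτ

/-- The graded subspace `L¹(G_c)_n` of all `F` with `F_k = 0` (almost everywhere) for `k ≠ n`. -/
def gradedSubspace (c : ContinuousTwoCocycle G) (μ : Measure G) (n : ℤ) :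
    Submodule ℂ (MackeyL1 c μ) where
  carrier := {F | ∀ k : ℤ, k ≠ n → fourierCoeffT F.rep k =ᵐ[μ] 0}
  zero_mem' := by
    intro k _
    have h := MackeyL1.fourierCoeffT_smul (0 : ℂ) (0 : MackeyL1 c μ) k
    rwa [zero_smul, zero_smul] at h
  add_mem' := by
    intro F H hF hH k hk
    filter_upwards [MackeyL1.fourierCoeffT_add F H k, hF k hk, hH k hk] with x h1 h2 h3
    simp [h1, h2, h3]
  smul_mem' := by
    intro r F hF k hk
    filter_upwards [MackeyL1.fourierCoeffT_smul r F k, hF k hk] with x h1 h2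
    simp [h1, h2]

end Algebras

end

/-! The circle sits in $G_c$ as a central subgroup, and $P_nF(z)=\int_{\mathbb T}F(\rho
z)\bar\rho^{\,n}\,d\rho$ is the function $(x,\tau)\mapsto F_n(x)\tau^n$ (`projT_apply`). A central
translation of $F*H$ can be moved onto either factor, so $P_n(F*H)=P_nF*H=F*P_nH$, and since $P_n$
is idempotent, $P_n(F*H)=P_nF*P_nH$ (`projL_convL`). If both factors are homogeneous of degree $n$,
the phase of $w$ cancels in $F(w)H(w^{-1}z)$ and the phase of $w^{-1}z$ contributes
$c(y,y^{-1}x)^n$. Hence the convolution of $f(x)\tau^n$ and $g(x)\tau^n$ is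
$(f\natural_{c^n}g)(x)\tau^n$ (`groupConv_embT`). Together these give $(F*H)_n=F_n\natural_{c^n}H_n$
(`fourierCoeffT_groupConv`). They also make every statement on twisted convolution a case of
ordinary convolution on $G_c$; in particular $L^1(G,c^n)$ inherits the Banach $*$-algebra axioms
from $L^1(G_c)$.

Convergence is a fibrewise matter: Fejér's theorem (`tendsto_circleCesaro`) and M. Riesz's theorem
(`tendsto_circlePartial`) hold on almost every fibre, with uniform operator bounds, and dominated
convergence over $G$ gives convergence in $L^p(G_c)$ (`convergesInLp_of_fibre`). Fejér's theorem
also shows that the coefficients determine the function, so $L^1(G_c)_n$ is exactly the range of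
$P_n$ (`rep_ae_eq_projT`).

The technical obstacle is that $\mu$ need not be σ-finite, so Tonelli's theorem is not available on
$G\times G$. Fubini is used only for continuous functions with compact support. General functions
are reached through absolutely convergent series of such functions (`groupConv_bound`) or through
density and continuity. What is needed of the measure is collected in `IsConvMeasure`; its
verification rests on the identity $\int m(x^{-1})f(x^{-1})\,dx=\int f$ (`invModularMeasure_eq`) and
on density of compactly supported functions. On $G\times\mathbb T$ the fibres are integrated first
against a finite measure, which needs no hypothesis on $\mu$. -/

noncomputable section

/-! ### Convolution on a locally compact group

The group is not assumed to be second countable nor σ-compact, so that multiplication need not be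
measurable for the product σ-algebra. Everything is deduced from the case of continuous functions
with compact support. -/

section Convolution

variable {Γ : Type*} [Group Γ] [TopologicalSpace Γ] [IsTopologicalGroup Γ]

/-- The support lies in the image of supp $f$ × supp $h$ under $(a,b)\mapsto(ab,a)$. The closure is
taken because the group is not assumed to be Hausdorff here. -/
theorem hasCompactSupport_uncurry_mul_inv_mul {𝕜 : Type*} [RCLike 𝕜] {f h : Γ → 𝕜}
    (hf : HasCompactSupport f) (hh : HasCompactSupport h) :
    HasCompactSupport (Function.uncurry fun z w : Γ => f w * h (w⁻¹ * z)) := by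
  have hK : IsCompact (tsupport f ×ˢ tsupport h) := hf.prod hh
  have hK' : IsCompact ((fun q : Γ × Γ => (q.1 * q.2, q.1)) '' (tsupport f ×ˢ tsupport h)) :=
    hK.image (by fun_prop)
  refine HasCompactSupport.intro' hK'.closure isClosed_closure ?_
  rintro ⟨z, w⟩ hzw
  by_contra hne
  refine hzw (subset_closure ⟨(w, w⁻¹ * z), ⟨?_, ?_⟩, by simp⟩)
  · exact subset_tsupport _ (left_ne_zero_of_mul hne)
  · exact subset_tsupport _ (right_ne_zero_of_mul hne)

theorem continuous_uncurry_mul_inv_mul {𝕜 : Type*} [RCLike 𝕜] {f h : Γ → 𝕜}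
    (hf : Continuous f) (hh : Continuous h) :
    Continuous (Function.uncurry fun z w : Γ => f w * h (w⁻¹ * z)) :=
  (hf.comp continuous_snd).mul (hh.comp (by fun_prop))

variable [MeasurableSpace Γ] [BorelSpace Γ] {ν : Measure Γ}

/-- The convolution of two functions on a group. -/
def groupConv (ν : Measure Γ) (F H : Γ → ℂ) (z : Γ) : ℂ :=
  ∫ w, F w * H (w⁻¹ * z) ∂ν

/-- Continuous functions with compact support are dense in `L^p`. -/
def CcDense (ν : Measure Γ) (p : ℝ≥0∞) : Prop :=
  ∀ f : Γ → ℂ, MemLp f p ν → ∀ ε : ℝ≥0∞, ε ≠ 0 →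
    ∃ g : Γ → ℂ, Continuous g ∧ HasCompactSupport g ∧ eLpNorm (f - g) p ν ≤ ε

theorem continuous_integral_mul_inv_mul [IsFiniteMeasureOnCompacts ν] {𝕜 : Type*} [RCLike 𝕜]
    {f h : Γ → 𝕜} (hf : Continuous f) (hfs : HasCompactSupport f) (hh : Continuous h) :
    Continuous fun z => ∫ w, f w * h (w⁻¹ * z) ∂ν := by
  rw [← continuousOn_univ]
  refine continuousOn_integral_of_compact_support (k := tsupport f) hfs ?_ ?_
  · exact (continuous_uncurry_mul_inv_mul hf hh).continuousOn
  · intro z w _ hw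
    simp [image_eq_zero_of_notMem_tsupport hw]

theorem hasCompactSupport_integral_mul_inv_mul {𝕜 : Type*} [RCLike 𝕜]
    {f h : Γ → 𝕜} (hfs : HasCompactSupport f) (hhs : HasCompactSupport h) :
    HasCompactSupport fun z => ∫ w, f w * h (w⁻¹ * z) ∂ν := by
  have hK := (IsCompact.image (hasCompactSupport_uncurry_mul_inv_mul hfs hhs) continuous_fst)
  refine HasCompactSupport.intro' hK.closure isClosed_closure ?_
  intro z hz
  refine integral_eq_zero_of_ae (Eventually.of_forall fun w => ?_)
  by_contra hne
  exact hz (subset_closure ⟨(z, w), subset_tsupport _ hne, rfl⟩)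

theorem integrable_mul_inv_mul [IsFiniteMeasureOnCompacts ν] {𝕜 : Type*} [RCLike 𝕜]
    {f h : Γ → 𝕜} (hf : Continuous f) (hfs : HasCompactSupport f) (hh : Continuous h) (z : Γ) :
    Integrable (fun w => f w * h (w⁻¹ * z)) ν :=
  Continuous.integrable_of_hasCompactSupport (hf.mul (hh.comp (by fun_prop))) hfs.mul_right

/-- Fubini for continuous integrands with compact support requires no σ-finiteness; left invariance
then evaluates the inner integral. -/
theorem integral_integral_mul_inv_mul [IsFiniteMeasureOnCompacts ν] [ν.IsMulLeftInvariant]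
    {f h : Γ → ℝ} (hf : Continuous f) (hfs : HasCompactSupport f) (hh : Continuous h)
    (hhs : HasCompactSupport h) :
    ∫ z, ∫ w, f w * h (w⁻¹ * z) ∂ν ∂ν = (∫ w, f w ∂ν) * ∫ w, h w ∂ν := by
  rw [integral_integral_swap_of_hasCompactSupport (continuous_uncurry_mul_inv_mul hf hh)
    (hasCompactSupport_uncurry_mul_inv_mul hfs hhs), ← integral_mul_const]
  congr 1 with w
  rw [integral_const_mul, integral_mul_left_eq_self (fun z => h z)]

/-- The convolution of the absolute values, as an extended nonnegative number. -/
def lconvNorm (ν : Measure Γ) (F H : Γ → ℂ) (z : Γ) : ℝ≥0∞ :=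
  ∫⁻ w, ‖F w‖ₑ * ‖H (w⁻¹ * z)‖ₑ ∂ν

theorem lconvNorm_eq_ofReal [IsFiniteMeasureOnCompacts ν] {f h : Γ → ℂ} (hf : Continuous f)
    (hfs : HasCompactSupport f) (hh : Continuous h) (z : Γ) :
    lconvNorm ν f h z = ENNReal.ofReal (∫ w, ‖f w‖ * ‖h (w⁻¹ * z)‖ ∂ν) := by
  rw [ofReal_integral_eq_lintegral_ofReal
    (integrable_mul_inv_mul (h := fun w => ‖h w‖) hf.norm hfs.norm hh.norm z)
    (Eventually.of_forall fun w => by positivity)]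
  simp only [lconvNorm]
  congr 1 with w
  rw [ENNReal.ofReal_mul (norm_nonneg _), ofReal_norm, ofReal_norm]

/-- Tonelli for the lower integral, obtained by rewriting each integral as a Bochner integral of a
continuous function with compact support. -/
theorem lintegral_lintegral_rpow [IsFiniteMeasureOnCompacts ν] [ν.IsMulLeftInvariant]
    {f h : Γ → ℂ} (hf : Continuous f) (hfs : HasCompactSupport f) (hh : Continuous h)
    (hhs : HasCompactSupport h) {r : ℝ} (hr : 0 < r) :
    ∫⁻ z, ∫⁻ w, ‖f w‖ₑ * ‖h (w⁻¹ * z)‖ₑ ^ r ∂ν ∂ν = (∫⁻ w, ‖f w‖ₑ ∂ν) * ∫⁻ w, ‖h w‖ₑ ^ r ∂ν := by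
  set k : Γ → ℝ := fun w => ‖h w‖ ^ r with hk
  have hkc : Continuous k := hh.norm.rpow_const fun _ => Or.inr hr.le
  have hks : HasCompactSupport k :=
    hhs.comp_left (g := fun t : ℂ => ‖t‖ ^ r) (by simp [Real.zero_rpow hr.ne'])
  have key := integral_integral_mul_inv_mul (ν := ν) hf.norm hfs.norm hkc hks
  have hfi : Integrable (fun w => ‖f w‖) ν :=
    hf.norm.integrable_of_hasCompactSupport hfs.norm
  have hki : Integrable k ν := hkc.integrable_of_hasCompactSupport hks
  have hk0 : ∀ w, 0 ≤ k w := fun w => by positivity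
  have e1 : ∀ z, ∫⁻ w, ‖f w‖ₑ * ‖h (w⁻¹ * z)‖ₑ ^ r ∂ν
      = ENNReal.ofReal (∫ w, ‖f w‖ * k (w⁻¹ * z) ∂ν) := by
    intro z
    rw [ofReal_integral_eq_lintegral_ofReal (integrable_mul_inv_mul hf.norm hfs.norm hkc z)
      (Eventually.of_forall fun w => mul_nonneg (norm_nonneg _) (hk0 _))]
    congr 1 with w
    rw [ENNReal.ofReal_mul (norm_nonneg _), ofReal_norm, hk,
      ← ENNReal.ofReal_rpow_of_nonneg (norm_nonneg _) hr.le, ofReal_norm]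
  have e2 : ∫⁻ w, ‖f w‖ₑ ∂ν = ENNReal.ofReal (∫ w, ‖f w‖ ∂ν) := by
    rw [ofReal_integral_eq_lintegral_ofReal hfi (Eventually.of_forall fun w => norm_nonneg _)]
    congr 1 with w
    rw [ofReal_norm]
  have e3 : ∫⁻ w, ‖h w‖ₑ ^ r ∂ν = ENNReal.ofReal (∫ w, k w ∂ν) := by
    rw [ofReal_integral_eq_lintegral_ofReal hki (Eventually.of_forall hk0)]
    congr 1 with w
    rw [hk, ← ENNReal.ofReal_rpow_of_nonneg (norm_nonneg _) hr.le, ofReal_norm]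
  rw [e2, e3, ← ENNReal.ofReal_mul (integral_nonneg fun _ => norm_nonneg _), ← key,
    ofReal_integral_eq_lintegral_ofReal]
  · exact lintegral_congr e1
  · exact Continuous.integrable_of_hasCompactSupport
      (continuous_integral_mul_inv_mul hf.norm hfs.norm hkc)
      (hasCompactSupport_integral_mul_inv_mul hfs.norm hks)
  · exact Eventually.of_forall fun z => integral_nonneg fun w => mul_nonneg (norm_nonneg _) (hk0 _)

/-- Hölder's inequality for $v$ and the constant $1$ with respect to the measure $u\,d\rho$. -/
theorem lintegral_mul_rpow_le {X : Type*} [MeasurableSpace X] (ρ : Measure X) {r : ℝ} (hr : 1 ≤ r)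
    {u v : X → ℝ≥0∞} (hu : Measurable u) (hv : Measurable v) :
    (∫⁻ w, u w * v w ∂ρ) ^ r ≤ (∫⁻ w, u w ∂ρ) ^ (r - 1) * ∫⁻ w, u w * v w ^ r ∂ρ := by
  rcases hr.eq_or_lt with rfl | hr1
  · simp
  have hr0 : 0 < r := by linarith
  have hpq : r.HolderConjugate (r / (r - 1)) := Real.HolderConjugate.conjExponent hr1
  have h := ENNReal.lintegral_mul_le_Lp_mul_Lq (ρ.withDensity u) hpq hv.aemeasurable
    (measurable_const (a := (1 : ℝ≥0∞))).aemeasurable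
  simp only [Pi.mul_apply, mul_one, ENNReal.one_rpow] at h
  rw [lintegral_withDensity_eq_lintegral_mul _ hu hv,
    lintegral_withDensity_eq_lintegral_mul _ hu (hv.pow_const r),
    lintegral_withDensity_eq_lintegral_mul _ hu measurable_const] at h
  simp only [Pi.mul_apply, mul_one] at h
  calc _ ≤ ((∫⁻ w, u w * v w ^ r ∂ρ) ^ (1 / r) * (∫⁻ w, u w ∂ρ) ^ (1 / (r / (r - 1)))) ^ r :=
        ENNReal.rpow_le_rpow h hr0.le
    _ = _ := by
      rw [ENNReal.mul_rpow_of_nonneg _ _ hr0.le, ← ENNReal.rpow_mul, ← ENNReal.rpow_mul, mul_comm]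
      congr 2
      · field_simp
      · rw [one_div, inv_mul_cancel₀ hr0.ne', ENNReal.rpow_one]

/-- Young's inequality in the regular case: Hölder at each point with weight $|f|$, then integration
over $z$ by `lintegral_lintegral_rpow`. The powers $r-1$ and $1$ of $\|f\|_1$ combine to $r$. -/
theorem eLpNorm_lconvNorm_le [IsFiniteMeasureOnCompacts ν] [ν.IsMulLeftInvariant] {p : ℝ≥0∞}
    (hp : 1 ≤ p) (hp' : p ≠ ∞)
    {f h : Γ → ℂ} (hf : Continuous f) (hfs : HasCompactSupport f) (hh : Continuous h)
    (hhs : HasCompactSupport h) :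
    eLpNorm (lconvNorm ν f h) p ν ≤ eLpNorm f 1 ν * eLpNorm h p ν := by
  have hp0 : p ≠ 0 := (zero_lt_one.trans_le hp).ne'
  have hr : 1 ≤ p.toReal := by
    rw [← ENNReal.toReal_one]; exact (ENNReal.toReal_le_toReal ENNReal.one_ne_top hp').2 hp
  set r := p.toReal with hrdef
  have hr0 : 0 < r := by linarith
  rw [eLpNorm_eq_lintegral_rpow_enorm_toReal hp0 hp', eLpNorm_eq_lintegral_rpow_enorm_toReal hp0 hp',
    eLpNorm_one_eq_lintegral_enorm, ← hrdef]
  have hmain : ∫⁻ z, lconvNorm ν f h z ^ r ∂ν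
      ≤ (∫⁻ w, ‖f w‖ₑ ∂ν) ^ r * ∫⁻ w, ‖h w‖ₑ ^ r ∂ν := by
    calc _ ≤ ∫⁻ z, (∫⁻ w, ‖f w‖ₑ ∂ν) ^ (r - 1) * ∫⁻ w, ‖f w‖ₑ * ‖h (w⁻¹ * z)‖ₑ ^ r ∂ν ∂ν := by
          refine lintegral_mono fun z => ?_
          exact lintegral_mul_rpow_le ν hr hf.enorm.measurable
            (hh.comp (by fun_prop : Continuous fun w : Γ => w⁻¹ * z)).enorm.measurable
      _ = (∫⁻ w, ‖f w‖ₑ ∂ν) ^ (r - 1) * ((∫⁻ w, ‖f w‖ₑ ∂ν) * ∫⁻ w, ‖h w‖ₑ ^ r ∂ν) := by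
          rw [lintegral_const_mul', lintegral_lintegral_rpow hf hfs hh hhs hr0]
          exact ENNReal.rpow_ne_top_of_nonneg (by linarith)
            (hf.integrable_of_hasCompactSupport hfs).2.ne
      _ = _ := by
          rw [← mul_assoc]
          congr 1
          rcases eq_or_ne (∫⁻ w, ‖f w‖ₑ ∂ν) 0 with h0 | h0
          · rw [h0, mul_zero, ENNReal.zero_rpow_of_pos hr0]
          · nth_rewrite 2 [← ENNReal.rpow_one (∫⁻ w, ‖f w‖ₑ ∂ν)]
            rw [← ENNReal.rpow_add _ _ h0 (hf.integrable_of_hasCompactSupport hfs).2.ne]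
            congr 1; ring
  calc _ ≤ ((∫⁻ w, ‖f w‖ₑ ∂ν) ^ r * ∫⁻ w, ‖h w‖ₑ ^ r ∂ν) ^ (1 / r) :=
        ENNReal.rpow_le_rpow (by simpa using hmain) (by positivity)
    _ = _ := by
      rw [ENNReal.mul_rpow_of_nonneg _ _ (by positivity), ← ENNReal.rpow_mul,
        mul_one_div_cancel hr0.ne', ENNReal.rpow_one]

/-- A function in `L^p` is almost everywhere the sum of an absolutely convergent series of continuous
functions with compact support whose norms add up to nearly the norm of the function. -/
theorem CcDense.exists_hasSum {p : ℝ≥0∞} (hp : 1 ≤ p) (hd : CcDense ν p)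
    {F : Γ → ℂ} (hF : MemLp F p ν) {ε : ℝ≥0∞} (hε : ε ≠ 0) (hε' : ε ≠ ∞) :
    ∃ f : ℕ → Γ → ℂ, (∀ n, Continuous (f n)) ∧ (∀ n, HasCompactSupport (f n)) ∧
      ∑' n, eLpNorm (f n) p ν ≤ eLpNorm F p ν + ε ∧
      ∀ᵐ x ∂ν, Summable (fun n => ‖f n x‖) ∧ HasSum (fun n => f n x) (F x) := by
  -- The approximants $g_n$ have error $\frac\varepsilon4 2^{-n}$, and the series is the telescoping
  -- one. The errors sum to $\frac\varepsilon4(1+1+2)=\varepsilon$: one part from $g_0$, the others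
  -- from $g_{k+1}$ and $g_k$ in each difference.
  have hε4 : ε / 4 ≠ 0 := by simp [hε]
  have hε4' : ε / 4 ≠ ∞ := by simp [ENNReal.div_eq_top, hε']
  have hδ : ∀ n : ℕ, (ε / 4) * 2⁻¹ ^ n ≠ 0 := fun n => mul_ne_zero hε4 (by simp)
  choose g hgc hgs hg using fun n : ℕ => hd F hF _ (hδ n)
  have hsm : ∀ n, AEStronglyMeasurable (g n) ν := fun n => (hgc n).aestronglyMeasurable
  let f : ℕ → Γ → ℂ := fun n => Nat.casesOn n (g 0) fun k => g (k + 1) - g k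
  have hf0 : f 0 = g 0 := rfl
  have hfs : ∀ k, f (k + 1) = g (k + 1) - g k := fun k => rfl
  have hfc : ∀ n, Continuous (f n) := by
    rintro (_ | k)
    · exact hgc 0
    · exact (hgc (k + 1)).sub (hgc k)
  have hfcs : ∀ n, HasCompactSupport (f n) := by
    rintro (_ | k)
    · exact hgs 0
    · exact (hgs (k + 1)).sub (hgs k)
  have hgeom : ∑' n : ℕ, (2⁻¹ : ℝ≥0∞) ^ n = 2 := by
    rw [ENNReal.tsum_geometric, ENNReal.one_sub_inv_two, inv_inv]
  have hsum : ∑' n, eLpNorm (f n) p ν ≤ eLpNorm F p ν + ε := by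
    rw [tsum_eq_zero_add' ENNReal.summable]
    have h0 : eLpNorm (f 0) p ν ≤ eLpNorm F p ν + ε / 4 := by
      have : f 0 = F - (F - g 0) := by rw [hf0]; abel
      rw [this]
      refine (eLpNorm_sub_le hF.1 (hF.1.sub (hsm 0)) hp).trans ?_
      gcongr
      simpa using hg 0
    have hk : ∀ k, eLpNorm (f (k + 1)) p ν ≤ (ε / 4) * 2⁻¹ ^ (k + 1) + (ε / 4) * 2⁻¹ ^ k := by
      intro k
      have : f (k + 1) = (F - g k) - (F - g (k + 1)) := by rw [hfs]; abel
      rw [this, add_comm (_ * 2⁻¹ ^ (k + 1))]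
      exact (eLpNorm_sub_le (hF.1.sub (hsm _)) (hF.1.sub (hsm _)) hp).trans
        (add_le_add (hg _) (hg _))
    calc _ ≤ (eLpNorm F p ν + ε / 4) + ∑' k : ℕ, ((ε / 4) * 2⁻¹ ^ (k + 1) + (ε / 4) * 2⁻¹ ^ k) :=
          add_le_add h0 (ENNReal.tsum_le_tsum hk)
      _ = eLpNorm F p ν + ε := by
          rw [ENNReal.tsum_add, ENNReal.tsum_mul_left, ENNReal.tsum_mul_left, hgeom]
          simp_rw [pow_succ]
          rw [ENNReal.tsum_mul_right, hgeom, ENNReal.mul_inv_cancel two_ne_zero ENNReal.ofNat_ne_top,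
            mul_one, add_assoc]
          congr 1
          have : ε / 4 + (ε / 4 + ε / 4 * 2) = 4 * (ε / 4) := by ring
          rw [this, ENNReal.mul_div_cancel (by norm_num) (by norm_num)]
  have hne : ∑' n, eLpNorm (f n) p ν ≠ ∞ :=
    (hsum.trans_lt (ENNReal.add_lt_top.2 ⟨hF.2, hε'.lt_top⟩)).ne
  -- Summable errors force $g_n\to F$ almost everywhere, without passing to a subsequence; this
  -- identifies the sum of the telescoping series.
  have hne' : ∑' n, eLpNorm (F - g n) p ν ≠ ∞ := by
    refine ((ENNReal.tsum_le_tsum hg).trans_lt ?_).ne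
    rw [ENNReal.tsum_mul_left, hgeom]
    exact ENNReal.mul_lt_top hε4'.lt_top (by norm_num)
  refine ⟨f, hfc, hfcs, hsum, ?_⟩
  filter_upwards [summable_norm_of_tsum_eLpNorm_ne_top hp
    (fun n => (hfc n).aestronglyMeasurable) hne,
    summable_norm_of_tsum_eLpNorm_ne_top hp (fun n => hF.1.sub (hsm n)) hne'] with x h1 h2
  refine ⟨h1, ?_⟩
  have hlim : Tendsto (fun n => g n x) atTop (𝓝 (F x)) := by
    have := h2.tendsto_atTop_zero
    have h3 := (tendsto_zero_iff_norm_tendsto_zero.2 this).const_sub (F x)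
    simpa using h3
  have hpart : ∀ n, ∑ k ∈ Finset.range (n + 1), f k x = g n x := by
    intro n
    induction n with
    | zero => simp [hf0]
    | succ n ih => rw [Finset.sum_range_succ, ih, hfs]; simp
  have hs : Summable fun n => f n x := h1.of_norm
  have := (tendsto_add_atTop_iff_nat 1).2 hs.hasSum.tendsto_sum_nat
  simp_rw [hpart] at this
  rw [← tendsto_nhds_unique this hlim]
  exact hs.hasSum

end Convolution

/-- Fatou's lemma for the partial sums, whose norms the triangle inequality bounds by the full
series. -/
theorem aestronglyMeasurable_and_eLpNorm_le_of_hasSum {X : Type*} [MeasurableSpace X]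
    {ρ : Measure X} {p : ℝ≥0∞} (hp : 1 ≤ p) {u : ℕ → X → ℂ} {g : X → ℂ}
    (hu : ∀ n, AEStronglyMeasurable (u n) ρ) (h : ∀ᵐ x ∂ρ, HasSum (fun n => u n x) (g x)) :
    AEStronglyMeasurable g ρ ∧ eLpNorm g p ρ ≤ ∑' n, eLpNorm (u n) p ρ := by
  have hlim : ∀ᵐ x ∂ρ, Tendsto (fun N => (∑ n ∈ Finset.range N, u n) x) atTop (𝓝 (g x)) := by
    filter_upwards [h] with x hx
    simpa using hx.tendsto_sum_nat
  have hs : ∀ N, AEStronglyMeasurable (∑ n ∈ Finset.range N, u n) ρ := fun N =>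
    Finset.aestronglyMeasurable_sum _ fun n _ => hu n
  refine ⟨aestronglyMeasurable_of_tendsto_ae atTop hs hlim,
    (Lp.eLpNorm_lim_le_liminf_eLpNorm hs g hlim).trans ?_⟩
  refine liminf_le_of_le (by isBoundedDefault) fun b hb => ?_
  obtain ⟨N, hN⟩ := hb.exists
  exact hN.trans ((eLpNorm_sum_le (fun n _ => hu n) hp).trans (ENNReal.sum_le_tsum _))

/-! ### Young's inequality for arbitrary functions in $L^1$ and $L^p$ -/

section Convolution

variable {Γ : Type*} [Group Γ] [TopologicalSpace Γ] [IsTopologicalGroup Γ]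
  [MeasurableSpace Γ] [BorelSpace Γ] {ν : Measure Γ}

theorem quasiMeasurePreserving_inv_mul [ν.IsMulLeftInvariant]
    (hinv : Measure.QuasiMeasurePreserving (fun w : Γ => w⁻¹) ν ν) (z : Γ) :
    Measure.QuasiMeasurePreserving (fun w : Γ => w⁻¹ * z) ν ν := by
  have h := hinv.comp (measurePreserving_mul_left ν z⁻¹).quasiMeasurePreserving
  have e : ((fun w : Γ => w⁻¹) ∘ fun w => z⁻¹ * w) = fun w => w⁻¹ * z := by
    ext w; simp
  rwa [e] at h

/-- Convolution at every point depends only on the classes of the functions. -/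
theorem groupConv_congr_ae [ν.IsMulLeftInvariant]
    (hinv : Measure.QuasiMeasurePreserving (fun w : Γ => w⁻¹) ν ν) {F F' H H' : Γ → ℂ}
    (hF : F =ᵐ[ν] F') (hH : H =ᵐ[ν] H') : groupConv ν F H = groupConv ν F' H' := by
  funext z
  refine integral_congr_ae ?_
  filter_upwards [hF, (quasiMeasurePreserving_inv_mul hinv z).ae_eq_comp hH] with w h1 h2
  rw [h1]
  exact congrArg _ h2

/-- Both functions are expanded into series of continuous functions with compact support. The
convolutions $|f_i|*|h_j|$ have $L^p$ norms with finite sum, so their sum is finite at almost every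
$z$; at each such $z$ integration and summation can be exchanged. Measurability of $F*H$ thus comes
from a series of continuous functions, never from measurability of $(z,w)\mapsto F(w)H(w^{-1}z)$.
The loss $\varepsilon$ is removed in `eLpNorm_groupConv_le`. -/
theorem groupConv_bound [IsFiniteMeasureOnCompacts ν] [ν.IsMulLeftInvariant]
    (hinv : Measure.QuasiMeasurePreserving (fun w : Γ => w⁻¹) ν ν) {p : ℝ≥0∞}
    (hp : 1 ≤ p) (hp' : p ≠ ∞) (hd₁ : CcDense ν 1) (hd : CcDense ν p) {F H : Γ → ℂ}
    (hF : MemLp F 1 ν) (hH : MemLp H p ν) {ε : ℝ≥0∞} (hε : ε ≠ 0) (hε' : ε ≠ ∞) :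
    (∀ᵐ z ∂ν, Integrable (fun w => F w * H (w⁻¹ * z)) ν) ∧
      AEStronglyMeasurable (groupConv ν F H) ν ∧
      eLpNorm (groupConv ν F H) p ν ≤ (eLpNorm F 1 ν + ε) * (eLpNorm H p ν + ε) := by
  obtain ⟨f, hfc, hfs, hfn, hfa⟩ := hd₁.exists_hasSum le_rfl hF hε hε'
  obtain ⟨h, hhc, hhs, hhn, hha⟩ := hd.exists_hasSum hp hH hε hε'
  obtain ⟨e⟩ : Nonempty (ℕ ≃ ℕ × ℕ) := ⟨Nat.pairEquiv.symm⟩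
  let k : ℕ → Γ → ℝ := fun i z => ∫ w, ‖f (e i).1 w‖ * ‖h (e i).2 (w⁻¹ * z)‖ ∂ν
  let u : ℕ → Γ → ℂ := fun i => groupConv ν (f (e i).1) (h (e i).2)
  have hkc : ∀ i, Continuous (k i) := fun i =>
    continuous_integral_mul_inv_mul (h := fun w => ‖h (e i).2 w‖) (hfc _).norm (hfs _).norm
      (hhc _).norm
  have huc : ∀ i, Continuous (u i) := fun i => continuous_integral_mul_inv_mul (hfc _) (hfs _) (hhc _)
  have hk0 : ∀ i z, 0 ≤ k i z := fun i z => integral_nonneg fun w => by positivity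
  have hkL : ∀ i, eLpNorm (k i) p ν ≤ eLpNorm (f (e i).1) 1 ν * eLpNorm (h (e i).2) p ν := by
    intro i
    refine le_trans (le_of_eq ?_) (eLpNorm_lconvNorm_le hp hp' (hfc _) (hfs _) (hhc _) (hhs _))
    refine eLpNorm_congr_enorm_ae (Eventually.of_forall fun z => ?_)
    rw [lconvNorm_eq_ofReal (hfc _) (hfs _) (hhc _), Real.enorm_eq_ofReal (hk0 i z)]
    rfl
  have hsum : ∑' i, eLpNorm (k i) p ν ≤ (eLpNorm F 1 ν + ε) * (eLpNorm H p ν + ε) := by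
    calc _ ≤ ∑' i, eLpNorm (f (e i).1) 1 ν * eLpNorm (h (e i).2) p ν :=
          ENNReal.tsum_le_tsum hkL
      _ = ∑' q : ℕ × ℕ, eLpNorm (f q.1) 1 ν * eLpNorm (h q.2) p ν :=
          e.tsum_eq fun q => eLpNorm (f q.1) 1 ν * eLpNorm (h q.2) p ν
      _ = (∑' n, eLpNorm (f n) 1 ν) * ∑' m, eLpNorm (h m) p ν := by
          rw [ENNReal.tsum_prod (f := fun n m => eLpNorm (f n) 1 ν * eLpNorm (h m) p ν)]
          simp_rw [ENNReal.tsum_mul_left, ENNReal.tsum_mul_right]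
      _ ≤ _ := mul_le_mul' hfn hhn
  have htop : ∑' i, eLpNorm (k i) p ν ≠ ∞ := (hsum.trans_lt (ENNReal.mul_lt_top
    (ENNReal.add_lt_top.2 ⟨hF.2, hε'.lt_top⟩) (ENNReal.add_lt_top.2 ⟨hH.2, hε'.lt_top⟩))).ne
  have hsummable := summable_norm_of_tsum_eLpNorm_ne_top hp
    (fun i => (hkc i).aestronglyMeasurable) htop
  have hint : ∀ i z, Integrable (fun w => f (e i).1 w * h (e i).2 (w⁻¹ * z)) ν := fun i z =>
    integrable_mul_inv_mul (hfc _) (hfs _) (hhc _) z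
  have hkey : ∀ᵐ z ∂ν, Integrable (fun w => F w * H (w⁻¹ * z)) ν ∧
      HasSum (fun i => u i z) (groupConv ν F H z) := by
    filter_upwards [hsummable] with z hz
    have hz' : Summable fun i => ∫ w, ‖f (e i).1 w * h (e i).2 (w⁻¹ * z)‖ ∂ν := by
      refine hz.congr fun i => ?_
      rw [Real.norm_of_nonneg (hk0 i z)]
      simp only [norm_mul, k]
    have hae : ∀ᵐ w ∂ν, HasSum (fun i => f (e i).1 w * h (e i).2 (w⁻¹ * z))
        (F w * H (w⁻¹ * z)) := by
      -- The point $z$ is fixed: the null set where the expansion of $H$ fails is pulled back along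
      -- $w\mapsto w^{-1}z$, and stays null.
      filter_upwards [hfa, (quasiMeasurePreserving_inv_mul hinv z).ae hha] with w h1 h2
      have hs := (summable_mul_of_summable_norm h1.1 h2.1).hasSum
      rw [← tsum_mul_tsum_of_summable_norm h1.1 h2.1, h1.2.tsum_eq, h2.2.tsum_eq] at hs
      exact (e.hasSum_iff (f := fun q : ℕ × ℕ => f q.1 w * h q.2 (w⁻¹ * z))).2 hs
    refine ⟨?_, ?_⟩
    · obtain ⟨a1, a2⟩ := aestronglyMeasurable_and_eLpNorm_le_of_hasSum (ρ := ν) (p := 1) le_rfl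
        (fun i => (hint i z).aestronglyMeasurable) hae
      refine memLp_one_iff_integrable.1 ⟨a1, a2.trans_lt ?_⟩
      simp_rw [eLpNorm_one_eq_lintegral_enorm, ← ofReal_integral_norm_eq_lintegral_enorm (hint _ z)]
      exact hz'.tsum_ofReal_lt_top
    · have := hasSum_integral_of_summable_integral_norm (fun i => hint i z) hz'
      rw [integral_congr_ae (hae.mono fun w hw => hw.tsum_eq)] at this
      exact this
  obtain ⟨h1, h2⟩ := aestronglyMeasurable_and_eLpNorm_le_of_hasSum (ρ := ν) hp
    (fun i => (huc i).aestronglyMeasurable) (hkey.mono fun z hz => hz.2)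
  refine ⟨hkey.mono fun z hz => hz.1, h1, h2.trans (le_trans ?_ hsum)⟩
  refine ENNReal.tsum_le_tsum fun i => eLpNorm_mono fun z => ?_
  rw [Real.norm_of_nonneg (hk0 i z)]
  refine (norm_integral_le_integral_norm _).trans (le_of_eq ?_)
  simp only [norm_mul, k]

/-- The bundle of hypotheses on a left-invariant measure under which convolution is studied. -/
structure IsConvMeasure (ν : Measure Γ) : Prop where
  finite : IsFiniteMeasureOnCompacts ν
  leftInvariant : ν.IsMulLeftInvariant
  inv : Measure.QuasiMeasurePreserving (fun w : Γ => w⁻¹) ν ν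
  dense : ∀ p : ℝ≥0∞, 1 ≤ p → p ≠ ∞ → CcDense ν p

namespace IsConvMeasure

variable {p : ℝ≥0∞}

theorem ae_integrable (hν : IsConvMeasure ν) (hp : 1 ≤ p) (hp' : p ≠ ∞) {F H : Γ → ℂ}
    (hF : MemLp F 1 ν) (hH : MemLp H p ν) :
    ∀ᵐ z ∂ν, Integrable (fun w => F w * H (w⁻¹ * z)) ν :=
  have := hν.finite
  have := hν.leftInvariant
  (groupConv_bound hν.inv hp hp' (hν.dense 1 le_rfl ENNReal.one_ne_top) (hν.dense p hp hp') hF hH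
    one_ne_zero ENNReal.one_ne_top).1

/-- Young's inequality. -/
theorem eLpNorm_groupConv_le (hν : IsConvMeasure ν) (hp : 1 ≤ p) (hp' : p ≠ ∞) {F H : Γ → ℂ}
    (hF : MemLp F 1 ν) (hH : MemLp H p ν) :
    eLpNorm (groupConv ν F H) p ν ≤ eLpNorm F 1 ν * eLpNorm H p ν := by
  have := hν.finite
  have := hν.leftInvariant
  have hlim : Tendsto (fun ε : ℝ≥0∞ => (eLpNorm F 1 ν + ε) * (eLpNorm H p ν + ε)) (𝓝[>] 0)
      (𝓝 ((eLpNorm F 1 ν + 0) * (eLpNorm H p ν + 0))) := by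
    refine tendsto_nhdsWithin_of_tendsto_nhds ?_
    refine ENNReal.Tendsto.mul (tendsto_const_nhds.add tendsto_id) (Or.inr ?_)
      (tendsto_const_nhds.add tendsto_id) (Or.inr ?_)
    · simpa using hH.2.ne
    · simpa using hF.2.ne
  simp only [add_zero] at hlim
  refine ge_of_tendsto hlim ?_
  filter_upwards [Ioo_mem_nhdsGT (zero_lt_one' ℝ≥0∞)] with ε hε
  exact (groupConv_bound hν.inv hp hp' (hν.dense 1 le_rfl ENNReal.one_ne_top) (hν.dense p hp hp')
    hF hH hε.1.ne' hε.2.ne_top).2.2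

theorem memLp_groupConv (hν : IsConvMeasure ν) (hp : 1 ≤ p) (hp' : p ≠ ∞) {F H : Γ → ℂ}
    (hF : MemLp F 1 ν) (hH : MemLp H p ν) : MemLp (groupConv ν F H) p ν := by
  have := hν.finite
  have := hν.leftInvariant
  exact ⟨(groupConv_bound hν.inv hp hp' (hν.dense 1 le_rfl ENNReal.one_ne_top) (hν.dense p hp hp')
    hF hH one_ne_zero ENNReal.one_ne_top).2.1,
    (hν.eLpNorm_groupConv_le hp hp' hF hH).trans_lt (ENNReal.mul_lt_top hF.2 hH.2)⟩

end IsConvMeasure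

end Convolution

/-! ### Convolution as a continuous bilinear map, and associativity -/

section Convolution

variable {Γ : Type*} [Group Γ] [TopologicalSpace Γ] [IsTopologicalGroup Γ]
  [MeasurableSpace Γ] [BorelSpace Γ] {ν : Measure Γ}

theorem groupConv_smul_left (r : ℂ) (F H : Γ → ℂ) :
    groupConv ν (r • F) H = r • groupConv ν F H := by
  funext z
  simp only [groupConv, Pi.smul_apply, smul_eq_mul, mul_assoc]
  exact integral_const_mul _ _

theorem groupConv_smul_right (r : ℂ) (F H : Γ → ℂ) :
    groupConv ν F (r • H) = r • groupConv ν F H := by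
  funext z
  simp only [groupConv, Pi.smul_apply, smul_eq_mul, mul_left_comm _ r]
  exact integral_const_mul _ _

/-- The factor $f(v)h(v^{-1}w)$ alone has compact support in $(w,v)$, so Fubini applies with $k$
merely continuous; the substitution $w\mapsto vw$ finishes. -/
theorem groupConv_assoc_of_hasCompactSupport [IsFiniteMeasureOnCompacts ν] [ν.IsMulLeftInvariant]
    {f h k : Γ → ℂ} (hf : Continuous f) (hfs : HasCompactSupport f) (hh : Continuous h)
    (hhs : HasCompactSupport h) (hk : Continuous k) :
    groupConv ν (groupConv ν f h) k = groupConv ν f (groupConv ν h k) := by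
  funext z
  have e1 : ∀ w, groupConv ν f h w * k (w⁻¹ * z)
      = ∫ v, (f v * h (v⁻¹ * w)) * k (w⁻¹ * z) ∂ν := fun w => (integral_mul_const _ _).symm
  have hcont : Continuous (Function.uncurry fun w v : Γ => (f v * h (v⁻¹ * w)) * k (w⁻¹ * z)) :=
    (continuous_uncurry_mul_inv_mul hf hh).mul (hk.comp (by fun_prop))
  have hsupp : HasCompactSupport
      (Function.uncurry fun w v : Γ => (f v * h (v⁻¹ * w)) * k (w⁻¹ * z)) :=
    HasCompactSupport.mul_right (f' := fun q : Γ × Γ => k (q.1⁻¹ * z))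
      (hasCompactSupport_uncurry_mul_inv_mul hfs hhs)
  calc groupConv ν (groupConv ν f h) k z
      = ∫ w, ∫ v, (f v * h (v⁻¹ * w)) * k (w⁻¹ * z) ∂ν ∂ν := integral_congr_ae (.of_forall e1)
    _ = ∫ v, ∫ w, (f v * h (v⁻¹ * w)) * k (w⁻¹ * z) ∂ν ∂ν :=
        integral_integral_swap_of_hasCompactSupport hcont hsupp
    _ = ∫ v, f v * groupConv ν h k (v⁻¹ * z) ∂ν := by
        congr 1 with v
        simp_rw [mul_assoc (f v)]
        rw [integral_const_mul, ← integral_mul_left_eq_self _ v]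
        simp [groupConv, mul_assoc]
    _ = _ := rfl

/-- The class in `L^p` of a continuous function with compact support. -/
def ccToLp (ν : Measure Γ) [IsFiniteMeasureOnCompacts ν] (p : ℝ≥0∞)
    (g : {g : Γ → ℂ // Continuous g ∧ HasCompactSupport g}) : Lp ℂ p ν :=
  (g.2.1.memLp_of_hasCompactSupport g.2.2).toLp g.1

theorem CcDense.denseRange_ccToLp [IsFiniteMeasureOnCompacts ν] {p : ℝ≥0∞} [Fact (1 ≤ p)]
    (hd : CcDense ν p) : DenseRange (ccToLp ν p) := by
  intro F
  rw [Metric.mem_closure_iff]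
  intro ε hε
  obtain ⟨g, hgc, hgs, hg⟩ := hd F (Lp.memLp F) (ENNReal.ofReal (ε / 2)) (by simpa using hε)
  refine ⟨_, ⟨⟨g, hgc, hgs⟩, rfl⟩, ?_⟩
  rw [dist_eq_norm, Lp.norm_def]
  have : eLpNorm (⇑(F - ccToLp ν p ⟨g, hgc, hgs⟩)) p ν = eLpNorm (⇑F - g) p ν :=
    eLpNorm_congr_ae ((Lp.coeFn_sub _ _).trans ((ae_eq_refl _).sub (MemLp.coeFn_toLp _)))
  rw [this]
  refine (ENNReal.toReal_le_of_le_ofReal (by positivity) hg).trans_lt (by linarith)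

namespace IsConvMeasure

variable {p : ℝ≥0∞}

theorem groupConv_add_left (hν : IsConvMeasure ν) (hp : 1 ≤ p) (hp' : p ≠ ∞) {F F' H : Γ → ℂ}
    (hF : MemLp F 1 ν) (hF' : MemLp F' 1 ν) (hH : MemLp H p ν) :
    groupConv ν (F + F') H =ᵐ[ν] groupConv ν F H + groupConv ν F' H := by
  filter_upwards [hν.ae_integrable hp hp' hF hH, hν.ae_integrable hp hp' hF' hH] with z h1 h2
  simp only [groupConv, Pi.add_apply, add_mul]
  exact integral_add h1 h2

theorem groupConv_add_right (hν : IsConvMeasure ν) (hp : 1 ≤ p) (hp' : p ≠ ∞) {F H H' : Γ → ℂ}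
    (hF : MemLp F 1 ν) (hH : MemLp H p ν) (hH' : MemLp H' p ν) :
    groupConv ν F (H + H') =ᵐ[ν] groupConv ν F H + groupConv ν F H' := by
  filter_upwards [hν.ae_integrable hp hp' hF hH, hν.ae_integrable hp hp' hF hH'] with z h1 h2
  simp only [groupConv, Pi.add_apply, mul_add]
  exact integral_add h1 h2

/-- Convolution of classes of functions. -/
def convLp (hν : IsConvMeasure ν) [hp : Fact (1 ≤ p)] (hp' : p ≠ ∞) (F : Lp ℂ 1 ν)
    (H : Lp ℂ p ν) : Lp ℂ p ν :=
  (hν.memLp_groupConv hp.out hp' (Lp.memLp F) (Lp.memLp H)).toLp _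

theorem coeFn_convLp (hν : IsConvMeasure ν) [hp : Fact (1 ≤ p)] (hp' : p ≠ ∞) (F : Lp ℂ 1 ν)
    (H : Lp ℂ p ν) : hν.convLp hp' F H =ᵐ[ν] groupConv ν F H :=
  MemLp.coeFn_toLp _

theorem norm_convLp_le (hν : IsConvMeasure ν) [hp : Fact (1 ≤ p)] (hp' : p ≠ ∞) (F : Lp ℂ 1 ν)
    (H : Lp ℂ p ν) : ‖hν.convLp hp' F H‖ ≤ ‖F‖ * ‖H‖ := by
  rw [Lp.norm_def, Lp.norm_def, Lp.norm_def, ← ENNReal.toReal_mul]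
  refine ENNReal.toReal_mono (ENNReal.mul_ne_top (Lp.memLp F).2.ne (Lp.memLp H).2.ne) ?_
  rw [eLpNorm_congr_ae (hν.coeFn_convLp hp' F H)]
  exact hν.eLpNorm_groupConv_le hp.out hp' (Lp.memLp F) (Lp.memLp H)

theorem convLp_add_left (hν : IsConvMeasure ν) [hp : Fact (1 ≤ p)] (hp' : p ≠ ∞)
    (F F' : Lp ℂ 1 ν) (H : Lp ℂ p ν) :
    hν.convLp hp' (F + F') H = hν.convLp hp' F H + hν.convLp hp' F' H := by
  have := hν.leftInvariant
  refine Lp.ext ((hν.coeFn_convLp hp' _ _).trans ?_)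
  rw [groupConv_congr_ae hν.inv (Lp.coeFn_add F F') (ae_eq_refl H)]
  refine (hν.groupConv_add_left hp.out hp' (Lp.memLp F) (Lp.memLp F') (Lp.memLp H)).trans ?_
  exact (((hν.coeFn_convLp hp' F H).add (hν.coeFn_convLp hp' F' H)).symm).trans
    (Lp.coeFn_add _ _).symm

theorem convLp_add_right (hν : IsConvMeasure ν) [hp : Fact (1 ≤ p)] (hp' : p ≠ ∞)
    (F : Lp ℂ 1 ν) (H H' : Lp ℂ p ν) :
    hν.convLp hp' F (H + H') = hν.convLp hp' F H + hν.convLp hp' F H' := by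
  have := hν.leftInvariant
  refine Lp.ext ((hν.coeFn_convLp hp' _ _).trans ?_)
  rw [groupConv_congr_ae hν.inv (ae_eq_refl F) (Lp.coeFn_add H H')]
  refine (hν.groupConv_add_right hp.out hp' (Lp.memLp F) (Lp.memLp H) (Lp.memLp H')).trans ?_
  exact (((hν.coeFn_convLp hp' F H).add (hν.coeFn_convLp hp' F H')).symm).trans
    (Lp.coeFn_add _ _).symm

theorem convLp_smul_left (hν : IsConvMeasure ν) [hp : Fact (1 ≤ p)] (hp' : p ≠ ∞)
    (r : ℂ) (F : Lp ℂ 1 ν) (H : Lp ℂ p ν) :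
    hν.convLp hp' (r • F) H = r • hν.convLp hp' F H := by
  have := hν.leftInvariant
  refine Lp.ext ((hν.coeFn_convLp hp' _ _).trans ?_)
  rw [groupConv_congr_ae hν.inv (Lp.coeFn_smul r F) (ae_eq_refl H), groupConv_smul_left]
  exact ((hν.coeFn_convLp hp' F H).const_smul r).symm.trans (Lp.coeFn_smul _ _).symm

theorem convLp_smul_right (hν : IsConvMeasure ν) [hp : Fact (1 ≤ p)] (hp' : p ≠ ∞)
    (r : ℂ) (F : Lp ℂ 1 ν) (H : Lp ℂ p ν) :
    hν.convLp hp' F (r • H) = r • hν.convLp hp' F H := by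
  have := hν.leftInvariant
  refine Lp.ext ((hν.coeFn_convLp hp' _ _).trans ?_)
  rw [groupConv_congr_ae hν.inv (ae_eq_refl F) (Lp.coeFn_smul r H), groupConv_smul_right]
  exact ((hν.coeFn_convLp hp' F H).const_smul r).symm.trans (Lp.coeFn_smul _ _).symm

/-- Convolution as a bilinear map `L¹ × L^p → L^p`. -/
def convBilin (hν : IsConvMeasure ν) (p : ℝ≥0∞) [hp : Fact (1 ≤ p)] (hp' : p ≠ ∞) :
    Lp ℂ 1 ν →ₗ[ℂ] Lp ℂ p ν →ₗ[ℂ] Lp ℂ p ν :=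
  LinearMap.mk₂ ℂ (fun F H => hν.convLp hp' F H) (hν.convLp_add_left hp')
    (hν.convLp_smul_left hp') (hν.convLp_add_right hp') (hν.convLp_smul_right hp')

theorem norm_convBilin_le (hν : IsConvMeasure ν) [hp : Fact (1 ≤ p)] (hp' : p ≠ ∞) (F : Lp ℂ 1 ν)
    (H : Lp ℂ p ν) : ‖hν.convBilin p hp' F H‖ ≤ 1 * ‖F‖ * ‖H‖ := by
  rw [one_mul]
  exact hν.norm_convLp_le hp' F H

/-- Convolution as a continuous bilinear map `L¹ × L^p → L^p`. -/
def convL (hν : IsConvMeasure ν) (p : ℝ≥0∞) [hp : Fact (1 ≤ p)] (hp' : p ≠ ∞) :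
    Lp ℂ 1 ν →L[ℂ] Lp ℂ p ν →L[ℂ] Lp ℂ p ν :=
  LinearMap.mkContinuous₂ (hν.convBilin p hp') 1 (hν.norm_convBilin_le hp')

theorem coeFn_convL (hν : IsConvMeasure ν) [hp : Fact (1 ≤ p)] (hp' : p ≠ ∞) (F : Lp ℂ 1 ν)
    (H : Lp ℂ p ν) : hν.convL p hp' F H =ᵐ[ν] groupConv ν F H :=
  hν.coeFn_convLp hp' F H

/-- Both sides are continuous in three variables of $L^1$, so equality on the dense set of
continuous functions with compact support suffices. -/
theorem groupConv_assoc (hν : IsConvMeasure ν) {F H K : Γ → ℂ} (hF : MemLp F 1 ν)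
    (hH : MemLp H 1 ν) (hK : MemLp K 1 ν) :
    groupConv ν (groupConv ν F H) K =ᵐ[ν] groupConv ν F (groupConv ν H K) := by
  have := hν.finite
  have := hν.leftInvariant
  have h1 : (1 : ℝ≥0∞) ≠ ∞ := ENNReal.one_ne_top
  have hd := (hν.dense 1 le_rfl h1).denseRange_ccToLp
  let L := hν.convL 1 h1
  have hL : ∀ F H K : Lp ℂ 1 ν, L (L F H) K = L F (L H K) := by
    intro F H K
    refine isClosed_property3 hd (p := fun F H K => L (L F H) K = L F (L H K)) ?_ ?_ F H K
    · exact isClosed_eq (by fun_prop) (by fun_prop)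
    · rintro ⟨f, hf⟩ ⟨h, hh⟩ ⟨k, hk⟩
      refine Lp.ext ?_
      have hf' : ccToLp ν 1 ⟨f, hf⟩ =ᵐ[ν] f := MemLp.coeFn_toLp _
      have hh' : ccToLp ν 1 ⟨h, hh⟩ =ᵐ[ν] h := MemLp.coeFn_toLp _
      have hk' : ccToLp ν 1 ⟨k, hk⟩ =ᵐ[ν] k := MemLp.coeFn_toLp _
      refine (hν.coeFn_convL h1 _ _).trans
        (Filter.EventuallyEq.trans (Filter.EventuallyEq.of_eq ?_) (hν.coeFn_convL h1 _ _).symm)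
      rw [groupConv_congr_ae hν.inv (hν.coeFn_convL h1 _ _) hk',
        groupConv_congr_ae hν.inv hf' (hν.coeFn_convL h1 _ _),
        groupConv_congr_ae hν.inv hf' hh', groupConv_congr_ae hν.inv hh' hk']
      exact groupConv_assoc_of_hasCompactSupport hf.1 hf.2 hh.1 hh.2 hk.1
  have hF' : hF.toLp F =ᵐ[ν] F := hF.coeFn_toLp
  have hH' : hH.toLp H =ᵐ[ν] H := hH.coeFn_toLp
  have hK' : hK.toLp K =ᵐ[ν] K := hK.coeFn_toLp
  have e1 : L (L (hF.toLp F) (hH.toLp H)) (hK.toLp K) =ᵐ[ν] groupConv ν (groupConv ν F H) K := by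
    refine (hν.coeFn_convL h1 _ _).trans (Filter.EventuallyEq.of_eq ?_)
    rw [groupConv_congr_ae hν.inv (hν.coeFn_convL h1 _ _) hK',
      groupConv_congr_ae hν.inv hF' hH']
  have e2 : L (hF.toLp F) (L (hH.toLp H) (hK.toLp K)) =ᵐ[ν] groupConv ν F (groupConv ν H K) := by
    refine (hν.coeFn_convL h1 _ _).trans (Filter.EventuallyEq.of_eq ?_)
    rw [groupConv_congr_ae hν.inv hF' (hν.coeFn_convL h1 _ _),
      groupConv_congr_ae hν.inv hH' hK']
  rw [hL] at e1
  exact e1.symm.trans e2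

end IsConvMeasure

end Convolution

/-! ### Fourier series on the circle -/

instance : haarT.IsHaarMeasure := inferInstanceAs (Measure.haarMeasure ⊤).IsHaarMeasure

theorem isConvMeasure_haarT : IsConvMeasure haarT where
  finite := inferInstance
  leftInvariant := inferInstance
  inv := (Measure.measurePreserving_inv haarT).quasiMeasurePreserving
  dense p _ hp' f hf ε hε := by
    obtain ⟨g, h1, h2, h3, -⟩ := hf.exists_hasCompactSupport_eLpNorm_sub_le hp' hε
    exact ⟨g, h3, h1, h2⟩

/-- The normalized Haar measure of the additive circle is carried to that of the circle. -/
theorem haarT_eq_map : haarT = Measure.map (AddCircle.toCircle (T := 2 * Real.pi))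
    (haveI : Fact (0 < 2 * Real.pi) := ⟨Real.two_pi_pos⟩; AddCircle.haarAddCircle) := by
  have : Fact (0 < 2 * Real.pi) := ⟨Real.two_pi_pos⟩
  have hm : Measurable (AddCircle.toCircle (T := 2 * Real.pi)) :=
    AddCircle.continuous_toCircle.measurable
  set ρ : Measure Circle := Measure.map (AddCircle.toCircle (T := 2 * Real.pi))
    AddCircle.haarAddCircle with hρ
  have hprob : IsProbabilityMeasure ρ := Measure.isProbabilityMeasure_map hm.aemeasurable
  have hinv : ρ.IsMulLeftInvariant := by
    constructor
    intro w
    obtain ⟨t, rfl⟩ : ∃ t : AddCircle (2 * Real.pi), t.toCircle = w := by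
      obtain ⟨t, ht⟩ := (AddCircle.homeomorphCircle Real.two_pi_pos.ne').surjective w
      exact ⟨t, by rw [← ht, AddCircle.homeomorphCircle_apply]⟩
    rw [hρ, Measure.map_map (measurable_const_mul _) hm]
    have : ((fun z => t.toCircle * z) ∘ (AddCircle.toCircle (T := 2 * Real.pi)))
        = AddCircle.toCircle ∘ fun s => t + s := by
      ext s; simp [AddCircle.toCircle_add]
    rw [this, ← Measure.map_map hm (measurable_const_add t), map_add_left_eq_self]
  have h := Measure.haarMeasure_unique ρ ⊤
  have h1 : ρ ((⊤ : TopologicalSpace.PositiveCompacts Circle) : Set Circle) = 1 := measure_univ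
  rw [h1, one_smul] at h
  exact h.symm

/-- This gives access to the mean value property of holomorphic functions, used in
`integral_cpow_of_re_pos`. -/
theorem integral_haarT_eq_circleAverage (f : ℂ → ℂ) :
    ∫ τ : Circle, f τ ∂haarT = Real.circleAverage f 0 1 := by
  have : Fact (0 < 2 * Real.pi) := ⟨Real.two_pi_pos⟩
  rw [haarT_eq_map]
  have he := (AddCircle.homeomorphCircle (T := 2 * Real.pi) Real.two_pi_pos.ne').measurableEmbedding
  have hcoe : (AddCircle.toCircle (T := 2 * Real.pi))
      = AddCircle.homeomorphCircle (T := 2 * Real.pi) Real.two_pi_pos.ne' := by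
    funext t; rw [AddCircle.homeomorphCircle_apply]
  rw [hcoe, he.integral_map, Real.circleAverage_def]
  have h2 := AddCircle.intervalIntegral_preimage (2 * Real.pi) 0
    (fun t : AddCircle (2 * Real.pi) => f (t.toCircle : ℂ))
  rw [AddCircle.volume_eq_smul_haarAddCircle, integral_smul_measure, zero_add] at h2
  simp only [AddCircle.homeomorphCircle_apply]
  have h3 : ∀ θ : ℝ, circleMap 0 1 θ = (AddCircle.toCircle (θ : AddCircle (2 * Real.pi)) : ℂ) := by
    intro θ
    rw [AddCircle.toCircle_apply_mk, div_self Real.two_pi_pos.ne', one_mul]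
    simp [circleMap]
  simp_rw [h3]
  rw [h2, ENNReal.toReal_ofReal Real.two_pi_pos.le, smul_smul, inv_mul_cancel₀ Real.two_pi_pos.ne',
    one_smul]

theorem Circle.conj_zpow (τ : Circle) (n : ℤ) :
    (starRingEnd ℂ (τ : ℂ)) ^ n = (τ : ℂ) ^ (-n) := by
  rw [← Circle.coe_inv_eq_conj, Circle.coe_inv, inv_zpow, zpow_neg]

theorem Circle.continuous_coe_zpow (n : ℤ) : Continuous fun τ : Circle => (τ : ℂ) ^ n :=
  Continuous.zpow₀ continuous_subtype_val n fun τ => Or.inl (Circle.coe_ne_zero τ)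

theorem Circle.norm_coe_zpow (τ : Circle) (n : ℤ) : ‖(τ : ℂ) ^ n‖ = 1 := by
  rw [norm_zpow, Circle.norm_coe, one_zpow]

theorem integral_zpow_haarT (n : ℤ) :
    ∫ τ : Circle, (τ : ℂ) ^ n ∂haarT = if n = 0 then 1 else 0 := by
  split_ifs with hn
  · simp [hn]
  -- Translation by $e^{i\pi/n}$ multiplies $\tau^n$ by $-1$, so the integral is its own negative.
  · have hw : ((Circle.exp (Real.pi / n) : Circle) : ℂ) ^ n = -1 := by
      rw [Circle.coe_exp, ← Complex.exp_int_mul, ← Complex.exp_pi_mul_I]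
      congr 1
      push_cast
      field_simp
    have h := integral_mul_left_eq_self (μ := haarT) (fun τ : Circle => (τ : ℂ) ^ n)
      (Circle.exp (Real.pi / n))
    simp only [Circle.coe_mul, mul_zpow, hw, neg_one_mul] at h
    rw [integral_neg] at h
    exact self_eq_neg.mp h.symm

/-- The Fourier coefficients of a function on the circle. -/
def circleCoeff (f : Circle → ℂ) (n : ℤ) : ℂ :=
  ∫ τ : Circle, f τ * (starRingEnd ℂ (τ : ℂ)) ^ n ∂haarT

/-- The trigonometric polynomial with given frequencies and coefficients. -/
def trigPoly (s : Finset ℤ) (a : ℤ → ℂ) (τ : Circle) : ℂ := ∑ n ∈ s, a n * (τ : ℂ) ^ n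

theorem continuous_trigPoly (s : Finset ℤ) (a : ℤ → ℂ) : Continuous (trigPoly s a) :=
  continuous_finsetSum _ fun n _ => continuous_const.mul (Circle.continuous_coe_zpow n)

theorem memLp_of_continuous_circle {f : Circle → ℂ} (hf : Continuous f) (p : ℝ≥0∞) :
    MemLp f p haarT :=
  hf.memLp_of_hasCompactSupport (HasCompactSupport.of_compactSpace f)

theorem memLp_trigPoly (s : Finset ℤ) (a : ℤ → ℂ) (p : ℝ≥0∞) : MemLp (trigPoly s a) p haarT :=
  memLp_of_continuous_circle (continuous_trigPoly s a) p

theorem integrable_mul_conj_zpow {f : Circle → ℂ} (hf : Integrable f haarT) (n : ℤ) :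
    Integrable (fun τ : Circle => f τ * (starRingEnd ℂ (τ : ℂ)) ^ n) haarT := by
  simp_rw [Circle.conj_zpow]
  exact hf.mul_bdd (c := 1) (Circle.continuous_coe_zpow _).aestronglyMeasurable
    (Eventually.of_forall fun τ => (Circle.norm_coe_zpow τ _).le)

theorem circleCoeff_add {f g : Circle → ℂ} (hf : Integrable f haarT) (hg : Integrable g haarT)
    (n : ℤ) : circleCoeff (f + g) n = circleCoeff f n + circleCoeff g n := by
  simp only [circleCoeff, Pi.add_apply, add_mul]
  exact integral_add (integrable_mul_conj_zpow hf n) (integrable_mul_conj_zpow hg n)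

theorem circleCoeff_const_mul (r : ℂ) (f : Circle → ℂ) (n : ℤ) :
    circleCoeff (fun τ => r * f τ) n = r * circleCoeff f n := by
  simp only [circleCoeff, mul_assoc]
  exact integral_const_mul _ _

theorem circleCoeff_sub {f g : Circle → ℂ} (hf : Integrable f haarT) (hg : Integrable g haarT)
    (n : ℤ) : circleCoeff (f - g) n = circleCoeff f n - circleCoeff g n := by
  simp only [circleCoeff, Pi.sub_apply, sub_mul]
  exact integral_sub (integrable_mul_conj_zpow hf n) (integrable_mul_conj_zpow hg n)

theorem circleCoeff_trigPoly (s : Finset ℤ) (a : ℤ → ℂ) (n : ℤ) :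
    circleCoeff (trigPoly s a) n = if n ∈ s then a n else 0 := by
  simp only [circleCoeff, trigPoly, Finset.sum_mul, Circle.conj_zpow]
  rw [integral_finsetSum]
  · have : ∀ k ∈ s, ∫ τ : Circle, a k * (τ : ℂ) ^ k * (τ : ℂ) ^ (-n) ∂haarT
        = if k = n then a k else 0 := by
      intro k _
      simp_rw [mul_assoc, ← zpow_add₀ (Circle.coe_ne_zero _)]
      rw [integral_const_mul, integral_zpow_haarT]
      simp [← sub_eq_add_neg, sub_eq_zero]
    rw [Finset.sum_congr rfl this, Finset.sum_ite_eq' s n a]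
  · intro k _
    refine ((Continuous.memLp_of_hasCompactSupport (p := 1) ?_
      (HasCompactSupport.of_compactSpace _))).integrable le_rfl
    exact (continuous_const.mul (Circle.continuous_coe_zpow k)).mul (Circle.continuous_coe_zpow _)

theorem norm_circleCoeff_le {f : Circle → ℂ} (hf : AEStronglyMeasurable f haarT) {p : ℝ≥0∞}
    (hp : 1 ≤ p) (n : ℤ) : ‖circleCoeff f n‖ₑ ≤ eLpNorm f p haarT := by
  refine (enorm_integral_le_lintegral_enorm _).trans ?_
  refine le_trans (le_of_eq ?_) (eLpNorm_le_eLpNorm_of_exponent_le hp hf)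
  rw [eLpNorm_one_eq_lintegral_enorm]
  refine lintegral_congr fun τ => ?_
  rw [enorm_mul, Circle.conj_zpow]
  have : ‖(τ : ℂ) ^ (-n)‖ₑ = 1 := by
    rw [← ofReal_norm, Circle.norm_coe_zpow, ENNReal.ofReal_one]
  rw [this, mul_one]

/-- Characters are eigenvectors of convolution: with $v=\tau/w$ one has $w^n=\tau^n\bar v^{\,n}$. -/
theorem groupConv_trigPoly {f : Circle → ℂ} (hf : Integrable f haarT) (s : Finset ℤ) (a : ℤ → ℂ) :
    groupConv haarT (trigPoly s a) f = trigPoly s fun n => a n * circleCoeff f n := by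
  funext τ
  have h : ∀ n : ℤ, ∀ w : Circle, a n * (w : ℂ) ^ n * f (w⁻¹ * τ)
      = a n * (τ : ℂ) ^ n * (fun v : Circle => f v * (starRingEnd ℂ (v : ℂ)) ^ n) (τ / w) := by
    intro n w
    have hτ := Circle.coe_ne_zero τ
    have hw := Circle.coe_ne_zero w
    change _ = a n * (τ : ℂ) ^ n * (f (τ / w) * (starRingEnd ℂ ((τ / w : Circle) : ℂ)) ^ n)
    rw [Circle.conj_zpow, Circle.coe_div, zpow_neg, div_zpow, inv_div, div_eq_inv_mul τ w]
    field_simp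
  have hint : Integrable (fun w : Circle => f (w⁻¹ * τ)) haarT := by
    have := hf.comp_div_left τ
    refine this.congr (Eventually.of_forall fun w => ?_)
    simp only [div_eq_inv_mul]
  simp only [groupConv, trigPoly, Finset.sum_mul]
  rw [integral_finsetSum]
  · refine Finset.sum_congr rfl fun n _ => ?_
    simp_rw [h n]
    rw [integral_const_mul, integral_div_left_eq_self
      (fun v : Circle => f v * (starRingEnd ℂ (v : ℂ)) ^ n), circleCoeff]
    ring
  · intro n _
    refine Integrable.bdd_mul (c := ‖a n‖) hint
      (continuous_const.mul (Circle.continuous_coe_zpow n)).aestronglyMeasurable ?_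
    exact Eventually.of_forall fun w => by
      rw [norm_mul, Circle.norm_coe_zpow, mul_one]

/-! ### Partial sums, Cesàro means and the Fejér kernel -/

/-- The symmetric partial sums of the Fourier series of a function on the circle. -/
def circlePartial (f : Circle → ℂ) (N : ℕ) : Circle → ℂ :=
  trigPoly (Finset.Icc (-(N : ℤ)) N) (circleCoeff f)

/-- The Cesàro means of the Fourier series of a function on the circle. -/
def circleCesaro (f : Circle → ℂ) (N : ℕ) (τ : Circle) : ℂ :=
  ((N : ℂ) + 1)⁻¹ * ∑ k ∈ Finset.range (N + 1), circlePartial f k τ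

/-- The weights `1 - |n| / (N + 1)` of the Cesàro means. -/
def fejerWeight (N : ℕ) (n : ℤ) : ℝ := (N + 1 - |(n : ℝ)|) / (N + 1)

theorem sum_Icc_neg_nat {M : Type*} [AddCommMonoid M] (g : ℤ → M) (N : ℕ) :
    ∑ n ∈ Finset.Icc (-(N : ℤ)) N, g n
      = g 0 + ∑ j ∈ Finset.range N, (g (j + 1) + g (-(j + 1))) := by
  induction N with
  | zero => simp
  | succ N ih =>
    have : Finset.Icc (-((N + 1 : ℕ) : ℤ)) ((N + 1 : ℕ) : ℤ)
        = insert ((N : ℤ) + 1) (insert (-((N : ℤ) + 1)) (Finset.Icc (-(N : ℤ)) N)) := by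
      ext n; simp only [Finset.mem_Icc, Finset.mem_insert]; omega
    rw [this, Finset.sum_insert, Finset.sum_insert, ih, Finset.sum_range_succ]
    · simp only [← add_assoc]
      ac_rfl
    · simp only [Finset.mem_Icc]; omega
    · simp only [Finset.mem_Icc, Finset.mem_insert]; omega

/-- The frequency $n$ occurs in the partial sums of index $k\ge|n|$, that is, $N+1-|n|$ times. In
the induction the two new frequencies $\pm(N+1)$ have weight $0$ in the old sum. -/
theorem sum_trigPoly_Icc (a : ℤ → ℂ) (N : ℕ) (τ : Circle) :
    ∑ k ∈ Finset.range (N + 1), trigPoly (Finset.Icc (-(k : ℤ)) k) a τ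
      = ∑ n ∈ Finset.Icc (-(N : ℤ)) N, ((N + 1 - |(n : ℝ)| : ℝ) : ℂ) * (a n * (τ : ℂ) ^ n) := by
  induction N with
  | zero => simp [trigPoly]
  | succ N ih =>
    rw [Finset.sum_range_succ, ih, trigPoly]
    have hsub : Finset.Icc (-(N : ℤ)) N ⊆ Finset.Icc (-((N + 1 : ℕ) : ℤ)) ((N + 1 : ℕ) : ℤ) :=
      Finset.Icc_subset_Icc (by push_cast; omega) (by push_cast; omega)
    rw [Finset.sum_subset hsub, ← Finset.sum_add_distrib]
    · refine Finset.sum_congr rfl fun n _ => ?_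
      push_cast
      ring
    · intro n h1 h2
      have h3 : |n| = (N : ℤ) + 1 := by
        simp only [Finset.mem_Icc] at h1 h2
        rcases abs_cases n with h | h <;> push_cast at h1 <;> omega
      have h4 : |(n : ℝ)| = (N : ℝ) + 1 := by exact_mod_cast h3
      rw [h4]; simp

theorem cesaro_trigPoly (a : ℤ → ℂ) (N : ℕ) (τ : Circle) :
    ((N : ℂ) + 1)⁻¹ * ∑ k ∈ Finset.range (N + 1), trigPoly (Finset.Icc (-(k : ℤ)) k) a τ
      = trigPoly (Finset.Icc (-(N : ℤ)) N) (fun n => fejerWeight N n * a n) τ := by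
  rw [sum_trigPoly_Icc, Finset.mul_sum, trigPoly]
  refine Finset.sum_congr rfl fun n _ => ?_
  rw [fejerWeight]
  push_cast
  have : (N : ℂ) + 1 ≠ 0 := Nat.cast_add_one_ne_zero N
  field_simp

theorem circleCesaro_eq (f : Circle → ℂ) (N : ℕ) : circleCesaro f N
    = trigPoly (Finset.Icc (-(N : ℤ)) N) (fun n => fejerWeight N n * circleCoeff f n) :=
  funext fun τ => cesaro_trigPoly _ N τ

/-- The Fejér kernel. -/
def fejerKernel (N : ℕ) : Circle → ℂ :=
  trigPoly (Finset.Icc (-(N : ℤ)) N) (fun n => fejerWeight N n)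

theorem circleCesaro_eq_groupConv {f : Circle → ℂ} (hf : Integrable f haarT) (N : ℕ) :
    circleCesaro f N = groupConv haarT (fejerKernel N) f := by
  rw [fejerKernel, groupConv_trigPoly hf, circleCesaro_eq]

/-- Induction: if $A=\sum_{j\le N}\tau^j$, replacing $A$ by $A+\tau^{N+1}$ adds
$1+A\overline{\tau^{N+1}}+\bar A\tau^{N+1}$ to $A\bar A$, which is the Dirichlet kernel of order
$N+1$. -/
theorem sum_trigPoly_one_eq_normSq (N : ℕ) (τ : Circle) :
    ∑ k ∈ Finset.range (N + 1), trigPoly (Finset.Icc (-(k : ℤ)) k) 1 τ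
      = (∑ j ∈ Finset.range (N + 1), (τ : ℂ) ^ j)
        * starRingEnd ℂ (∑ j ∈ Finset.range (N + 1), (τ : ℂ) ^ j) := by
  have hconj : starRingEnd ℂ (τ : ℂ) = (τ : ℂ)⁻¹ := by
    rw [← Circle.coe_inv_eq_conj, Circle.coe_inv]
  have hτ : (τ : ℂ) ≠ 0 := Circle.coe_ne_zero τ
  induction N with
  | zero => simp [trigPoly]
  | succ N ih =>
    rw [Finset.sum_range_succ, ih, Finset.sum_range_succ (fun j => (τ : ℂ) ^ j) (N + 1), map_add]
    set A := ∑ j ∈ Finset.range (N + 1), (τ : ℂ) ^ j with hA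
    have e1 : A * starRingEnd ℂ ((τ : ℂ) ^ (N + 1))
        = ∑ j ∈ Finset.range (N + 1), (τ : ℂ) ^ (-((j : ℤ) + 1)) := by
      rw [hA, Finset.sum_mul, ← Finset.sum_range_reflect]
      refine Finset.sum_congr rfl fun j hj => ?_
      have hj' : j ≤ N := by simpa [Nat.lt_succ_iff] using hj
      rw [map_pow, hconj, inv_pow, ← div_eq_mul_inv, ← zpow_natCast, ← zpow_natCast,
        ← zpow_sub₀ hτ]
      congr 1
      push_cast [Nat.add_sub_cancel, Nat.cast_sub hj']
      ring
    have e2 : starRingEnd ℂ A * (τ : ℂ) ^ (N + 1)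
        = ∑ j ∈ Finset.range (N + 1), (τ : ℂ) ^ ((j : ℤ) + 1) := by
      rw [hA, map_sum, Finset.sum_mul, ← Finset.sum_range_reflect]
      refine Finset.sum_congr rfl fun j hj => ?_
      have hj' : j ≤ N := by simpa [Nat.lt_succ_iff] using hj
      rw [map_pow, hconj, inv_pow, mul_comm, ← div_eq_mul_inv, ← zpow_natCast, ← zpow_natCast,
        ← zpow_sub₀ hτ]
      congr 1
      push_cast [Nat.add_sub_cancel, Nat.cast_sub hj']
      ring
    have e3 : (τ : ℂ) ^ (N + 1) * starRingEnd ℂ ((τ : ℂ) ^ (N + 1)) = 1 := by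
      rw [map_pow, hconj, inv_pow, mul_inv_cancel₀ (pow_ne_zero _ hτ)]
    have e4 : trigPoly (Finset.Icc (-((N + 1 : ℕ) : ℤ)) ((N + 1 : ℕ) : ℤ)) 1 τ
        = 1 + (A * starRingEnd ℂ ((τ : ℂ) ^ (N + 1)) + starRingEnd ℂ A * (τ : ℂ) ^ (N + 1)) := by
      rw [e1, e2, ← Finset.sum_add_distrib, trigPoly, sum_Icc_neg_nat]
      simp [add_comm]
    rw [e4]
    linear_combination -e3

theorem fejerKernel_eq (N : ℕ) (τ : Circle) : fejerKernel N τ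
    = (((N : ℝ) + 1)⁻¹ * ‖∑ j ∈ Finset.range (N + 1), (τ : ℂ) ^ j‖ ^ 2 : ℝ) := by
  have h := cesaro_trigPoly 1 N τ
  simp only [Pi.one_apply, mul_one] at h
  rw [fejerKernel, ← h, sum_trigPoly_one_eq_normSq, Complex.mul_conj']
  push_cast
  rfl

theorem integral_fejerKernel (N : ℕ) : ∫ τ, fejerKernel N τ ∂haarT = 1 := by
  have h := circleCoeff_trigPoly (Finset.Icc (-(N : ℤ)) N) (fun n => fejerWeight N n) 0
  rw [circleCoeff] at h
  simp only [zpow_zero, mul_one] at h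
  rw [fejerKernel, h, if_pos (by simp), fejerWeight]
  have : (N : ℝ) + 1 ≠ 0 := by positivity
  simp [this]

/-- The kernel is nonnegative, so its $L^1$ norm is its integral, the coefficient of frequency $0$.
-/
theorem eLpNorm_fejerKernel (N : ℕ) : eLpNorm (fejerKernel N) 1 haarT = 1 := by
  have hi : Integrable (fejerKernel N) haarT := (memLp_trigPoly _ _ 1).integrable le_rfl
  rw [eLpNorm_one_eq_lintegral_enorm, ← ofReal_integral_norm_eq_lintegral_enorm hi]
  have h : ∀ τ, ((‖fejerKernel N τ‖ : ℝ) : ℂ) = fejerKernel N τ := by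
    intro τ
    rw [fejerKernel_eq, Complex.norm_real, Real.norm_of_nonneg (by positivity)]
  have h2 : ((∫ τ, ‖fejerKernel N τ‖ ∂haarT : ℝ) : ℂ) = 1 := by
    rw [← integral_complex_ofReal, ← integral_fejerKernel N]
    exact integral_congr_ae (Eventually.of_forall h)
  have h3 : ∫ τ, ‖fejerKernel N τ‖ ∂haarT = 1 := by exact_mod_cast h2
  rw [h3, ENNReal.ofReal_one]

/-- Young's inequality for a kernel of norm one. -/
theorem eLpNorm_circleCesaro_le {p : ℝ≥0∞} (hp : 1 ≤ p) (hp' : p ≠ ∞) {f : Circle → ℂ}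
    (hf : MemLp f p haarT) (N : ℕ) : eLpNorm (circleCesaro f N) p haarT ≤ eLpNorm f p haarT := by
  rw [circleCesaro_eq_groupConv (hf.integrable hp)]
  refine (isConvMeasure_haarT.eLpNorm_groupConv_le hp hp' (memLp_trigPoly _ _ 1) hf).trans ?_
  rw [← fejerKernel, eLpNorm_fejerKernel, one_mul]

theorem eLpNorm_trigPoly_le {p : ℝ≥0∞} (hp : 1 ≤ p) (s : Finset ℤ) (a : ℤ → ℂ) :
    eLpNorm (trigPoly s a) p haarT ≤ ∑ n ∈ s, ‖a n‖ₑ := by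
  have h : trigPoly s a = ∑ n ∈ s, fun τ : Circle => a n * (τ : ℂ) ^ n := by
    funext τ; simp [trigPoly]
  rw [h]
  refine (eLpNorm_sum_le (fun n _ => (continuous_const.mul
    (Circle.continuous_coe_zpow n)).aestronglyMeasurable) hp).trans ?_
  refine Finset.sum_le_sum fun n _ => ?_
  have hp0 : p ≠ 0 := (zero_lt_one.trans_le hp).ne'
  have : eLpNorm (fun τ : Circle => a n * (τ : ℂ) ^ n) p haarT
      = eLpNorm (fun _ : Circle => a n) p haarT := by
    refine eLpNorm_congr_norm_ae (Eventually.of_forall fun τ => ?_)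
    rw [norm_mul, Circle.norm_coe_zpow, mul_one]
  change eLpNorm (fun τ : Circle => a n * (τ : ℂ) ^ n) p haarT ≤ _
  rw [this, eLpNorm_const _ hp0 (IsProbabilityMeasure.ne_zero haarT)]
  simp

/-! ### Density of trigonometric polynomials and Fejér's theorem -/

/-- Trigonometric polynomials are dense in `L^p` of the circle. -/
theorem exists_trigPoly_eLpNorm_sub_le {p : ℝ≥0∞} (hp : 1 ≤ p) (hp' : p ≠ ∞) {f : Circle → ℂ}
    (hf : MemLp f p haarT) {ε : ℝ≥0∞} (hε : ε ≠ 0) :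
    ∃ s a, eLpNorm (f - trigPoly s a) p haarT ≤ ε := by
  have : Fact (0 < 2 * Real.pi) := ⟨Real.two_pi_pos⟩
  have hε2 : ε / 2 ≠ 0 := by simpa using hε
  obtain ⟨g, -, h2, h3, h4⟩ := hf.exists_hasCompactSupport_eLpNorm_sub_le hp' hε2
  -- The uniform approximation needs a real tolerance, while $\varepsilon$ may be infinite.
  obtain ⟨δ, hδ0, hδ⟩ : ∃ δ : ℝ, 0 < δ ∧ ENNReal.ofReal δ ≤ ε / 2 := by
    rcases eq_or_ne (ε / 2) ∞ with h | h
    · exact ⟨1, one_pos, by simp [h]⟩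
    · exact ⟨(ε / 2).toReal, ENNReal.toReal_pos hε2 h, (ENNReal.ofReal_toReal h).le⟩
  let G : C(AddCircle (2 * Real.pi), ℂ) :=
    ⟨fun t => g (AddCircle.toCircle t), h3.comp AddCircle.continuous_toCircle⟩
  have hG : G ∈ (Submodule.span ℂ (Set.range (fourier (T := 2 * Real.pi)))).topologicalClosure := by
    rw [span_fourier_closure_eq_top]; trivial
  obtain ⟨P, hP, hGP⟩ := Metric.mem_closure_iff.1 hG δ hδ0
  obtain ⟨a, rfl⟩ := Finsupp.mem_span_range_iff_exists_finsupp.1 hP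
  refine ⟨a.support, a, ?_⟩
  have hsup : ∀ τ : Circle, ‖(g - trigPoly a.support a) τ‖ ≤ δ := by
    intro τ
    obtain ⟨t, ht⟩ := (AddCircle.homeomorphCircle (T := 2 * Real.pi) Real.two_pi_pos.ne').surjective τ
    rw [AddCircle.homeomorphCircle_apply] at ht
    subst ht
    refine le_trans (le_of_eq ?_) (((G - a.sum fun i b => b • fourier i).norm_coe_le_norm t).trans
      (by rw [← dist_eq_norm]; exact hGP.le))
    congr 1
    simp [G, trigPoly, Finsupp.sum, fourier_apply, AddCircle.toCircle_zsmul]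
  have hsup' : eLpNorm (g - trigPoly a.support a) p haarT ≤ ENNReal.ofReal δ := by
    refine (eLpNorm_le_of_ae_bound (Eventually.of_forall hsup)).trans ?_
    simp
  have e : f - trigPoly a.support a = (f - g) + (g - trigPoly a.support a) := by abel
  rw [e]
  refine (eLpNorm_add_le (hf.1.sub h3.aestronglyMeasurable) (h3.aestronglyMeasurable.sub
    (continuous_trigPoly _ _).aestronglyMeasurable) hp).trans ?_
  calc _ ≤ ε / 2 + ε / 2 := add_le_add h2 (hsup'.trans hδ)
    _ = ε := ENNReal.add_halves ε

/-- Uniformly bounded operators that converge on trigonometric polynomials converge on `L^p`. -/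
theorem tendsto_eLpNorm_of_trigPoly {p : ℝ≥0∞} (hp : 1 ≤ p) (hp' : p ≠ ∞)
    {T : ℕ → (Circle → ℂ) → Circle → ℂ} {C : ℝ≥0∞} (hC : C ≠ ∞)
    (hm : ∀ N f, MemLp f p haarT → AEStronglyMeasurable (T N f) haarT)
    (hsub : ∀ N f g, MemLp f p haarT → MemLp g p haarT → T N (f - g) = T N f - T N g)
    (hb : ∀ N f, MemLp f p haarT → eLpNorm (T N f) p haarT ≤ C * eLpNorm f p haarT)
    (ht : ∀ s a, Tendsto (fun N => eLpNorm (T N (trigPoly s a) - trigPoly s a) p haarT) atTop (𝓝 0))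
    {f : Circle → ℂ} (hf : MemLp f p haarT) :
    Tendsto (fun N => eLpNorm (T N f - f) p haarT) atTop (𝓝 0) := by
  rw [ENNReal.tendsto_nhds_zero]
  intro ε hε
  have hC1 : C + 1 ≠ 0 := by simp
  have hC2 : C + 1 ≠ ∞ := by simp [hC]
  -- A polynomial at distance $\delta=\varepsilon/(2(C+1))$ costs $C\delta$ through the operator and
  -- $\delta$ directly, together $\varepsilon/2$.
  have hδ : ε / 2 / (C + 1) ≠ 0 := by
    rw [Ne, ENNReal.div_eq_zero_iff, ENNReal.div_eq_zero_iff]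
    simp [hε.ne', hC]
  obtain ⟨s, a, hsa⟩ := exists_trigPoly_eLpNorm_sub_le hp hp' hf hδ
  have hP := memLp_trigPoly s a p
  filter_upwards [(ENNReal.tendsto_nhds_zero.1 (ht s a)) (ε / 2) (ENNReal.half_pos hε.ne')] with N hN
  have e : T N f - f = (T N (f - trigPoly s a) - (f - trigPoly s a))
      + (T N (trigPoly s a) - trigPoly s a) := by
    rw [hsub N f _ hf hP]; abel
  rw [e]
  have hd := hf.sub hP
  refine (eLpNorm_add_le ((hm N _ hd).sub hd.1) ((hm N _ hP).sub hP.1) hp).trans ?_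
  refine (add_le_add (eLpNorm_sub_le (hm N _ hd) hd.1 hp) hN).trans ?_
  calc _ ≤ (C * (ε / 2 / (C + 1)) + ε / 2 / (C + 1)) + ε / 2 := by
        gcongr
        exact (hb N _ hd).trans (by gcongr)
    _ = (C + 1) * (ε / 2 / (C + 1)) + ε / 2 := by rw [add_mul, one_mul]
    _ = ε := by rw [ENNReal.mul_div_cancel hC1 hC2, ENNReal.add_halves]

theorem trigPoly_congr_subset {s t : Finset ℤ} (hst : s ⊆ t) {a b : ℤ → ℂ}
    (h1 : ∀ n ∈ s, b n = a n) (h2 : ∀ n ∈ t, n ∉ s → b n = 0) : trigPoly t b = trigPoly s a := by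
  funext τ
  rw [trigPoly, trigPoly, ← Finset.sum_subset hst]
  · exact Finset.sum_congr rfl fun n hn => by rw [h1 n hn]
  · intro n hn hns
    rw [h2 n hn hns, zero_mul]

theorem trigPoly_sub (s : Finset ℤ) (a b : ℤ → ℂ) :
    trigPoly s (fun n => a n - b n) = trigPoly s a - trigPoly s b := by
  funext τ
  simp [trigPoly, sub_mul, Finset.sum_sub_distrib]

theorem eventually_subset_Icc (s : Finset ℤ) :
    ∀ᶠ N : ℕ in atTop, s ⊆ Finset.Icc (-(N : ℤ)) N := by
  filter_upwards [eventually_ge_atTop (s.sup Int.natAbs)] with N hN n hn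
  have := (Finset.le_sup (f := Int.natAbs) hn).trans hN
  rw [Finset.mem_Icc]; omega

theorem tendsto_fejerWeight (n : ℤ) : Tendsto (fun N : ℕ => fejerWeight N n) atTop (𝓝 1) := by
  have h : ∀ N : ℕ, fejerWeight N n = 1 - |(n : ℝ)| * (1 / ((N : ℝ) + 1)) := by
    intro N
    have : (N : ℝ) + 1 ≠ 0 := by positivity
    rw [fejerWeight]
    field_simp
  simp_rw [h]
  simpa using (tendsto_one_div_add_atTop_nhds_zero_nat.const_mul |(n : ℝ)|).const_sub 1

/-- Fejér's theorem in `L^p` of the circle. -/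
theorem tendsto_circleCesaro {p : ℝ≥0∞} (hp : 1 ≤ p) (hp' : p ≠ ∞) {f : Circle → ℂ}
    (hf : MemLp f p haarT) :
    Tendsto (fun N => eLpNorm (circleCesaro f N - f) p haarT) atTop (𝓝 0) := by
  refine tendsto_eLpNorm_of_trigPoly (T := fun N f => circleCesaro f N) hp hp' (C := 1)
    ENNReal.one_ne_top ?_ ?_ ?_ ?_ hf
  · intro N f _
    simp only [circleCesaro_eq]
    exact (continuous_trigPoly _ _).aestronglyMeasurable
  · intro N f g hf hg
    simp only [circleCesaro_eq]
    rw [← trigPoly_sub]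
    congr 1 with n
    rw [circleCoeff_sub (hf.integrable hp) (hg.integrable hp), mul_sub]
  · intro N f hf
    simpa using eLpNorm_circleCesaro_le hp hp' hf N
  · intro s a
    have hlim : Tendsto (fun N : ℕ => ∑ n ∈ s, ‖((fejerWeight N n : ℝ) : ℂ) * a n - a n‖ₑ) atTop
        (𝓝 (∑ n ∈ s, 0)) := by
      refine tendsto_finsetSum _ fun n _ => ?_
      have h1 : Tendsto (fun N : ℕ => ((fejerWeight N n : ℝ) : ℂ) * a n - a n) atTop
          (𝓝 (((1 : ℝ) : ℂ) * a n - a n)) :=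
        (((Complex.continuous_ofReal.tendsto _).comp (tendsto_fejerWeight n)).mul_const _).sub_const _
      simpa using h1.enorm
    rw [Finset.sum_const_zero] at hlim
    refine tendsto_of_tendsto_of_tendsto_of_le_of_le' tendsto_const_nhds hlim
      (Eventually.of_forall fun _ => zero_le) ?_
    filter_upwards [eventually_subset_Icc s] with N hN
    have e : circleCesaro (trigPoly s a) N = trigPoly s fun n => fejerWeight N n * a n := by
      rw [circleCesaro_eq]
      refine trigPoly_congr_subset hN ?_ ?_
      · intro n hn; rw [circleCoeff_trigPoly, if_pos hn]
      · intro n _ hn; rw [circleCoeff_trigPoly, if_neg hn, mul_zero]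
    rw [e, ← trigPoly_sub]
    exact eLpNorm_trigPoly_le hp s _

/-! ### M. Riesz's theorem for exponents up to 2 -/

/-- Near $\pm\pi/2$ the term $\cos r\theta$ is negative because $r>1$, and elsewhere $\cos\theta$ is
bounded below. The cut $t$ is the midpoint of $\pi/(2r)$ and $\pi/2$. For $|\theta|\ge t$ the choice
$B=-1/\cos(rt)$ suffices, as $\cos$ decreases on $[0,\pi]$ and $r\le2$. For $|\theta|\le t$ the
choice $A=(1+B)/\cos^r t$ absorbs the term with $B$. -/
theorem exists_one_le_cos_rpow_sub {r : ℝ} (hr : 1 < r) (hr2 : r ≤ 2) :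
    ∃ A B : ℝ, 0 ≤ A ∧ 0 ≤ B ∧ ∀ θ ∈ Set.Icc (-(Real.pi / 2)) (Real.pi / 2),
      1 ≤ A * Real.cos θ ^ r - B * Real.cos (θ * r) := by
  have hpi := Real.pi_pos
  set t : ℝ := (Real.pi / 2 + Real.pi / 2 / r) / 2 with ht
  have hr0 : 0 < r := by linarith
  have hlt : Real.pi / 2 / r < Real.pi / 2 := div_lt_self (by positivity) hr
  have ht0 : 0 < t := by positivity
  have ht1 : t < Real.pi / 2 := by rw [ht]; linarith
  have htr : t * r = (Real.pi / 2 * r + Real.pi / 2) / 2 := by rw [ht]; field_simp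
  have htr1 : Real.pi / 2 < t * r := by rw [htr]; nlinarith
  have htr2 : t * r < Real.pi + Real.pi / 2 := by rw [htr]; nlinarith
  have hneg : Real.cos (t * r) < 0 := Real.cos_neg_of_pi_div_two_lt_of_lt htr1 htr2
  have hpos : 0 < Real.cos t := Real.cos_pos_of_mem_Ioo ⟨by linarith, ht1⟩
  have hB : 0 ≤ -(Real.cos (t * r))⁻¹ := by
    have := inv_neg''.2 hneg
    linarith
  refine ⟨(1 - (Real.cos (t * r))⁻¹) / Real.cos t ^ r, -(Real.cos (t * r))⁻¹,
    div_nonneg (by linarith) (by positivity), hB, ?_⟩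
  intro θ hθ
  have habs : |θ| ≤ Real.pi / 2 := abs_le.2 hθ
  have e1 : Real.cos θ = Real.cos |θ| := (Real.cos_abs θ).symm
  have e2 : Real.cos (θ * r) = Real.cos (|θ| * r) := by
    rw [← Real.cos_abs (θ * r), abs_mul, abs_of_pos hr0]
  rw [e1, e2]
  have hcos0 : 0 ≤ Real.cos |θ| :=
    Real.cos_nonneg_of_mem_Icc ⟨by linarith [abs_nonneg θ], habs⟩
  rcases le_total t |θ| with h | h
  · have h1 : Real.cos (|θ| * r) ≤ Real.cos (t * r) := by
      refine Real.cos_le_cos_of_nonneg_of_le_pi (by positivity) ?_ (by gcongr)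
      nlinarith
    have h2 : 1 ≤ - (-(Real.cos (t * r))⁻¹ * Real.cos (|θ| * r)) := by
      have := mul_le_mul_of_nonneg_left h1 hB
      have hc : -(Real.cos (t * r))⁻¹ * Real.cos (t * r) = -1 := by
        rw [neg_mul, inv_mul_cancel₀ hneg.ne]
      linarith
    have h3 : 0 ≤ (1 - (Real.cos (t * r))⁻¹) / Real.cos t ^ r * Real.cos |θ| ^ r :=
      mul_nonneg (div_nonneg (by linarith) (by positivity)) (by positivity)
    linarith
  · have h1 : Real.cos t ≤ Real.cos |θ| :=
      Real.cos_le_cos_of_nonneg_of_le_pi (abs_nonneg _) (by linarith) h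
    have h2 : Real.cos t ^ r ≤ Real.cos |θ| ^ r := Real.rpow_le_rpow hpos.le h1 hr0.le
    have h3 : 1 - (Real.cos (t * r))⁻¹
        ≤ (1 - (Real.cos (t * r))⁻¹) / Real.cos t ^ r * Real.cos |θ| ^ r := by
      have hx : 0 < Real.cos t ^ r := Real.rpow_pos_of_pos hpos r
      have := mul_le_mul_of_nonneg_left h2
        (div_nonneg (by linarith : 0 ≤ 1 - (Real.cos (t * r))⁻¹) hx.le)
      rwa [div_mul_cancel₀ _ hx.ne'] at this
    have h4 : -(Real.cos (t * r))⁻¹ * Real.cos (|θ| * r) ≤ -(Real.cos (t * r))⁻¹ * 1 :=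
      mul_le_mul_of_nonneg_left (Real.cos_le_one _) hB
    linarith

/-- The preceding inequality at $\theta=\arg w$, multiplied by $|w|^r$: here
$\operatorname{Re}w=|w|\cos\theta$ and $\operatorname{Re}w^r=|w|^r\cos r\theta$. -/
theorem exists_norm_rpow_le {r : ℝ} (hr : 1 < r) (hr2 : r ≤ 2) :
    ∃ A B : ℝ, 0 ≤ A ∧ 0 ≤ B ∧ ∀ w : ℂ, 0 < w.re →
      ‖w‖ ^ r ≤ A * w.re ^ r - B * (w ^ (r : ℂ)).re := by
  obtain ⟨A, B, hA, hB, h⟩ := exists_one_le_cos_rpow_sub hr hr2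
  refine ⟨A, B, hA, hB, fun w hw => ?_⟩
  have harg : |w.arg| < Real.pi / 2 := Complex.abs_arg_lt_pi_div_two_iff.2 (Or.inl hw)
  have h1 := h w.arg (abs_le.1 harg.le)
  have hre : w.re = ‖w‖ * Real.cos w.arg := (Complex.norm_mul_cos_arg w).symm
  have hcos : 0 ≤ Real.cos w.arg := Real.cos_nonneg_of_mem_Icc (abs_le.1 harg.le)
  rw [Complex.cpow_ofReal_re, hre, Real.mul_rpow (norm_nonneg _) hcos]
  have h2 := mul_le_mul_of_nonneg_left h1 (Real.rpow_nonneg (norm_nonneg w) r)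
  linarith

/-- The maximum principle for $e^{-q}$ carries the bound $\operatorname{Re}q\ge\delta$ from the
circle into the disc. There the principal branch of $q^r$ is holomorphic, and the mean value
property applies. -/
theorem integral_cpow_of_re_pos {q : ℂ → ℂ} (hq : Differentiable ℂ q) {δ : ℝ} (hδ : 0 < δ)
    (h : ∀ τ : Circle, δ ≤ (q τ).re) (r : ℝ) :
    ∫ τ : Circle, q τ ^ (r : ℂ) ∂haarT = q 0 ^ (r : ℂ) := by
  have hball : ∀ z ∈ Metric.closedBall (0 : ℂ) 1, 0 < (q z).re := by
    intro z hz
    have hb : ‖Complex.exp (-q z)‖ ≤ Real.exp (-δ) := by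
      refine Complex.norm_le_of_forall_mem_frontier_norm_le (U := Metric.ball (0 : ℂ) 1)
        (f := fun z => Complex.exp (-q z)) Metric.isBounded_ball
        (hq.neg.cexp.diffContOnCl) ?_ (by rwa [closure_ball _ one_ne_zero])
      intro w hw
      rw [frontier_ball _ one_ne_zero] at hw
      have hw1 : ‖w‖ = 1 := by simpa using hw
      rw [Complex.norm_exp, Complex.neg_re]
      have := h ⟨w, by simpa [Submonoid.unitSphere] using hw1⟩
      exact Real.exp_le_exp.2 (by simpa using this)
    rw [Complex.norm_exp, Complex.neg_re, Real.exp_le_exp] at hb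
    linarith
  have hd : DifferentiableOn ℂ (fun z => q z ^ (r : ℂ)) (Metric.closedBall 0 1) := fun z hz =>
    ((hq z).cpow_const (Or.inl (hball z hz))).differentiableWithinAt
  have hcl : DiffContOnCl ℂ (fun z => q z ^ (r : ℂ)) (Metric.ball 0 |1|) := by
    rw [abs_one]
    refine DifferentiableOn.diffContOnCl ?_
    rwa [closure_ball _ one_ne_zero]
  exact (integral_haarT_eq_circleAverage fun z => q z ^ (r : ℂ)).trans hcl.circleAverage

theorem lintegral_enorm_rpow_circle {f : Circle → ℂ} (hf : Continuous f) {r : ℝ} (hr : 0 ≤ r) :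
    ∫⁻ τ, ‖f τ‖ₑ ^ r ∂haarT = ENNReal.ofReal (∫ τ, ‖f τ‖ ^ r ∂haarT) := by
  rw [ofReal_integral_eq_lintegral_ofReal]
  · refine lintegral_congr fun τ => ?_
    rw [← ENNReal.ofReal_rpow_of_nonneg (norm_nonneg _) hr, ofReal_norm]
  · exact (hf.norm.rpow_const fun _ => Or.inr hr).integrable_of_hasCompactSupport
      (HasCompactSupport.of_compactSpace _)
  · exact Eventually.of_forall fun τ => Real.rpow_nonneg (norm_nonneg _) _

/-- The inequality of `exists_norm_rpow_le` is integrated over the circle. The mean of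
$\operatorname{Re}q^r$ is $q(0)^r\ge0$, so the term with $B$ can be dropped, leaving the constant
$A^{1/r}$. -/
theorem exists_eLpNorm_le_re {p : ℝ≥0∞} (hp : 1 < p) (hp2 : p ≤ 2) :
    ∃ C : ℝ≥0∞, C ≠ ∞ ∧ ∀ q : ℂ → ℂ, Differentiable ℂ q → (∃ δ > 0, ∀ τ : Circle, δ ≤ (q τ).re) →
      0 ≤ (q 0).re → (q 0).im = 0 →
      eLpNorm (fun τ : Circle => q τ) p haarT
        ≤ C * eLpNorm (fun τ : Circle => ((q τ).re : ℂ)) p haarT := by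
  have hp' : p ≠ ∞ := (hp2.trans_lt (by simp)).ne
  have hp0 : p ≠ 0 := (zero_lt_one.trans hp).ne'
  have hr : 1 < p.toReal := by
    rw [← ENNReal.toReal_one]; exact (ENNReal.toReal_lt_toReal ENNReal.one_ne_top hp').2 hp
  have hr2 : p.toReal ≤ 2 := by
    have := (ENNReal.toReal_le_toReal hp' ENNReal.ofNat_ne_top).2 hp2
    simpa using this
  set r := p.toReal with hrdef
  have hr0 : 0 < r := by linarith
  obtain ⟨A, B, hA, hB, hAB⟩ := exists_norm_rpow_le hr hr2
  refine ⟨ENNReal.ofReal A ^ (1 / r), ENNReal.rpow_ne_top_of_nonneg (by positivity) (by simp), ?_⟩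
  rintro q hq ⟨δ, hδ, hqδ⟩ h0 h0'
  have hqc : Continuous fun τ : Circle => q τ := hq.continuous.comp continuous_subtype_val
  have hrec : Continuous fun τ : Circle => ((q τ).re : ℂ) :=
    Complex.continuous_ofReal.comp (Complex.continuous_re.comp hqc)
  have hpos : ∀ τ : Circle, 0 < (q τ).re := fun τ => hδ.trans_le (hqδ τ)
  have hpw : Continuous fun τ : Circle => q τ ^ (r : ℂ) :=
    hqc.cpow continuous_const fun τ => Or.inl (hpos τ)
  have int : ∀ {E : Type} [NormedAddCommGroup E] {g : Circle → E}, Continuous g →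
      Integrable g haarT := fun hg =>
    hg.integrable_of_hasCompactSupport (HasCompactSupport.of_compactSpace _)
  have hi1 : Integrable (fun τ : Circle => ‖((q τ).re : ℂ)‖ ^ r) haarT :=
    int (hrec.norm.rpow_const fun _ => Or.inr hr0.le)
  have hi2 : Integrable (fun τ : Circle => (q τ ^ (r : ℂ)).re) haarT :=
    int (Complex.continuous_re.comp hpw)
  have hre : 0 ≤ ∫ τ : Circle, (q τ ^ (r : ℂ)).re ∂haarT := by
    have h1 : ∫ τ : Circle, (q τ ^ (r : ℂ)).re ∂haarT = (q 0 ^ (r : ℂ)).re := by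
      rw [← integral_cpow_of_re_pos hq hδ hqδ r]
      exact integral_re (int hpw)
    rw [h1]
    have h2 : q 0 = ((q 0).re : ℂ) := by
      apply Complex.ext <;> simp [h0']
    rw [h2, ← Complex.ofReal_cpow h0, Complex.ofReal_re]
    positivity
  have hmain : ∫ τ : Circle, ‖q τ‖ ^ r ∂haarT ≤ A * ∫ τ : Circle, ‖((q τ).re : ℂ)‖ ^ r ∂haarT := by
    calc _ ≤ ∫ τ : Circle, (A * ‖((q τ).re : ℂ)‖ ^ r - B * (q τ ^ (r : ℂ)).re) ∂haarT := by
          refine integral_mono (int (hqc.norm.rpow_const fun _ => Or.inr hr0.le))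
            ((hi1.const_mul A).sub (hi2.const_mul B)) fun τ => ?_
          have := hAB (q τ) (hpos τ)
          rwa [Complex.norm_real, Real.norm_of_nonneg (hpos τ).le]
      _ = A * ∫ τ : Circle, ‖((q τ).re : ℂ)‖ ^ r ∂haarT
          - B * ∫ τ : Circle, (q τ ^ (r : ℂ)).re ∂haarT := by
          rw [integral_sub (hi1.const_mul A) (hi2.const_mul B), integral_const_mul,
            integral_const_mul]
      _ ≤ _ := by
          have := mul_nonneg hB hre
          linarith
  rw [eLpNorm_eq_lintegral_rpow_enorm_toReal hp0 hp', eLpNorm_eq_lintegral_rpow_enorm_toReal hp0 hp',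
    ← hrdef, lintegral_enorm_rpow_circle hqc hr0.le, lintegral_enorm_rpow_circle hrec hr0.le,
    ← ENNReal.mul_rpow_of_nonneg _ _ (by positivity), ← ENNReal.ofReal_mul hA]
  exact ENNReal.rpow_le_rpow (ENNReal.ofReal_le_ofReal hmain) (by positivity)

/-- The analytic half of the Cesàro mean. -/
def halfCesaro (f : Circle → ℂ) (N : ℕ) : Circle → ℂ :=
  trigPoly (Finset.Icc 0 (N : ℤ)) (fun n => fejerWeight N n * circleCoeff f n)

theorem sum_Icc_zero_nat {M : Type*} [AddCommMonoid M] (g : ℤ → M) (N : ℕ) :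
    ∑ n ∈ Finset.Icc 0 (N : ℤ), g n = g 0 + ∑ j ∈ Finset.range N, g (j + 1) := by
  induction N with
  | zero => simp
  | succ N ih =>
    have : Finset.Icc 0 ((N + 1 : ℕ) : ℤ) = insert ((N : ℤ) + 1) (Finset.Icc 0 (N : ℤ)) := by
      ext n; simp only [Finset.mem_Icc, Finset.mem_insert]; omega
    rw [this, Finset.sum_insert, ih, Finset.sum_range_succ, add_comm, add_assoc]
    simp only [Finset.mem_Icc]; omega

theorem circleCoeff_neg_of_real {f : Circle → ℂ} (hf : ∀ τ, (starRingEnd ℂ) (f τ) = f τ) (n : ℤ) :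
    circleCoeff f (-n) = starRingEnd ℂ (circleCoeff f n) := by
  rw [circleCoeff, circleCoeff, ← integral_conj]
  refine integral_congr_ae (Eventually.of_forall fun τ => ?_)
  simp only [map_mul, hf, map_zpow₀, Circle.conj_zpow, neg_neg]

theorem fejerWeight_zero (N : ℕ) : fejerWeight N 0 = 1 := by
  have : (N : ℝ) + 1 ≠ 0 := by positivity
  simp [fejerWeight, this]

theorem fejerWeight_neg (N : ℕ) (n : ℤ) : fejerWeight N (-n) = fejerWeight N n := by
  simp [fejerWeight]

theorem circleCesaro_of_nonneg {f : Circle → ℝ} (hf0 : ∀ τ, 0 ≤ f τ)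
    (hf : Integrable (fun τ => (f τ : ℂ)) haarT) (N : ℕ) (τ : Circle) :
    ∃ x : ℝ, 0 ≤ x ∧ circleCesaro (fun τ => (f τ : ℂ)) N τ = x := by
  refine ⟨∫ w, ((N : ℝ) + 1)⁻¹ * ‖∑ j ∈ Finset.range (N + 1), (w : ℂ) ^ j‖ ^ 2 * f (w⁻¹ * τ) ∂haarT,
    integral_nonneg fun w => mul_nonneg (by positivity) (hf0 _), ?_⟩
  rw [circleCesaro_eq_groupConv hf, groupConv, ← integral_complex_ofReal]
  refine integral_congr_ae (Eventually.of_forall fun w => ?_)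
  simp only [fejerKernel_eq]
  push_cast
  rfl

/-- For $f\ge0$ the Cesàro mean is nonnegative, because the Fejér kernel is, and up to a positive
constant $\varepsilon$ it is the real part of a polynomial $q$ on the circle. So $q$ is controlled
by its real part, hence by $f$, and half the polynomial is the analytic half of the mean. The
constant $\varepsilon$ makes the real part strictly positive and tends to $0$ at the end. -/
theorem exists_eLpNorm_halfCesaro_le_of_nonneg {p : ℝ≥0∞} (hp : 1 < p) (hp2 : p ≤ 2) :
    ∃ C : ℝ≥0∞, C ≠ ∞ ∧ ∀ (f : Circle → ℝ) (N : ℕ), (∀ τ, 0 ≤ f τ) →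
      MemLp (fun τ => (f τ : ℂ)) p haarT →
      eLpNorm (halfCesaro (fun τ => (f τ : ℂ)) N) p haarT
        ≤ C * eLpNorm (fun τ => (f τ : ℂ)) p haarT := by
  have hp' : p ≠ ∞ := (hp2.trans_lt (by simp)).ne
  have hp0 : p ≠ 0 := (zero_lt_one.trans hp).ne'
  obtain ⟨C, hC, h⟩ := exists_eLpNorm_le_re hp hp2
  refine ⟨C + 1, by simp [hC], fun f N hf0 hf => ?_⟩
  set g : Circle → ℂ := fun τ => (f τ : ℂ) with hg
  have hgi := hf.integrable hp.le
  have hreal : ∀ τ, (starRingEnd ℂ) (g τ) = g τ := fun τ => Complex.conj_ofReal _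
  have hc0im : (circleCoeff g 0).im = 0 := by
    have := circleCoeff_neg_of_real hreal 0
    rw [neg_zero] at this
    exact Complex.conj_eq_iff_im.1 this.symm
  have hc0re : 0 ≤ (circleCoeff g 0).re := by
    have : circleCoeff g 0 = ((∫ τ, f τ ∂haarT : ℝ) : ℂ) := by
      rw [circleCoeff, ← integral_complex_ofReal]
      simp [hg]
    rw [this, Complex.ofReal_re]
    exact integral_nonneg hf0
  have key : ∀ ε : ℝ, 0 < ε → eLpNorm (halfCesaro g N) p haarT
      ≤ (C + 1) * (eLpNorm g p haarT + ENNReal.ofReal ε) := by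
    intro ε hε
    let b : ℕ → ℂ := fun j => fejerWeight N ((j : ℤ) + 1) * circleCoeff g ((j : ℤ) + 1)
    -- On the circle $\operatorname{Re}q=\varepsilon+\sigma_Nf$, since coefficients of a real
    -- function at opposite frequencies are conjugate; and the analytic half is
    -- $(q+c_0-\varepsilon)/2$.
    let q : ℂ → ℂ := fun z => ε + circleCoeff g 0 + 2 * ∑ j ∈ Finset.range N, b j * z ^ (j + 1)
    have hq : Differentiable ℂ q := by fun_prop
    have hq0 : q 0 = ε + circleCoeff g 0 := by simp [q]
    have hz : ∀ (z : ℂ) (j : ℕ), z ^ ((j : ℤ) + 1) = z ^ (j + 1) := fun z j => by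
      exact_mod_cast zpow_natCast z (j + 1)
    have hces : ∀ τ : Circle, circleCesaro g N τ
        = circleCoeff g 0 + ∑ j ∈ Finset.range N,
          (b j * (τ : ℂ) ^ (j + 1) + starRingEnd ℂ (b j * (τ : ℂ) ^ (j + 1))) := by
      intro τ
      rw [circleCesaro_eq, trigPoly, sum_Icc_neg_nat]
      simp only [fejerWeight_zero, Complex.ofReal_one, one_mul, zpow_zero, mul_one]
      congr 1
      refine Finset.sum_congr rfl fun j _ => ?_
      rw [hz, fejerWeight_neg, circleCoeff_neg_of_real hreal, ← Circle.conj_zpow, hz]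
      simp only [b, map_mul, map_pow, Complex.conj_ofReal]
    have hqre : ∀ τ : Circle, ((q τ).re : ℂ) = ε + circleCesaro g N τ := by
      intro τ
      have h1 : (circleCesaro g N τ) = ((circleCoeff g 0).re : ℂ)
          + ((2 * (∑ j ∈ Finset.range N, b j * (τ : ℂ) ^ (j + 1)).re : ℝ) : ℂ) := by
        rw [hces, Finset.sum_add_distrib, ← map_sum, Complex.add_conj]
        congr 1
        exact Complex.ext (by simp) (by simp [hc0im])
      rw [h1]
      have h2 : (q τ).re = ε + (circleCoeff g 0).re
          + 2 * (∑ j ∈ Finset.range N, b j * (τ : ℂ) ^ (j + 1)).re := by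
        simp only [q, Complex.add_re, Complex.ofReal_re, Complex.mul_re, Complex.re_ofNat,
          Complex.im_ofNat, zero_mul, sub_zero]
      rw [h2]
      push_cast
      ring
    have hqpos : ∀ τ : Circle, ε ≤ (q τ).re := by
      intro τ
      obtain ⟨x, hx, hxe⟩ := circleCesaro_of_nonneg hf0 hgi N τ
      have h1 := hqre τ
      rw [show circleCesaro g N τ = x from hxe] at h1
      have : (q τ).re = ε + x := by exact_mod_cast h1
      linarith
    have hhalf : halfCesaro g N = fun τ : Circle => (2 : ℂ)⁻¹ * (q τ + (circleCoeff g 0 - ε)) := by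
      funext τ
      rw [halfCesaro, trigPoly, sum_Icc_zero_nat]
      simp only [fejerWeight_zero, Complex.ofReal_one, one_mul, zpow_zero, mul_one, hz, q, b]
      ring
    have hqc : Continuous fun τ : Circle => q τ := hq.continuous.comp continuous_subtype_val
    have hcont : Continuous (circleCesaro g N) := by
      rw [circleCesaro_eq]; exact continuous_trigPoly _ _
    have hconst : ∀ w : ℂ, eLpNorm (fun _ : Circle => w) p haarT = ‖w‖ₑ := fun w => by
      rw [eLpNorm_const _ hp0 (IsProbabilityMeasure.ne_zero haarT)]; simp
    have hεe : ‖(ε : ℂ)‖ₑ = ENNReal.ofReal ε := by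
      rw [← ofReal_norm, Complex.norm_real, Real.norm_of_nonneg hε.le]
    have hqn : eLpNorm (fun τ : Circle => q τ) p haarT
        ≤ C * (ENNReal.ofReal ε + eLpNorm g p haarT) := by
      refine (h q hq ⟨ε, hε, hqpos⟩ ?_ ?_).trans ?_
      · rw [hq0]; simp only [Complex.add_re, Complex.ofReal_re]; positivity
      · rw [hq0]; simp [hc0im]
      · gcongr
        have e : (fun τ : Circle => ((q τ).re : ℂ)) = (fun _ => (ε : ℂ)) + circleCesaro g N :=
          funext hqre
        rw [e]
        refine (eLpNorm_add_le continuous_const.aestronglyMeasurable hcont.aestronglyMeasurable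
          hp.le).trans (add_le_add ?_ (eLpNorm_circleCesaro_le hp.le hp' hf N))
        rw [hconst, hεe]
    have hhn : eLpNorm (halfCesaro g N) p haarT
        ≤ eLpNorm (fun τ : Circle => q τ) p haarT + ‖circleCoeff g 0 - ε‖ₑ := by
      have e : halfCesaro g N
          = (2 : ℂ)⁻¹ • ((fun τ : Circle => q τ) + fun _ => (circleCoeff g 0 - ε)) := by
        rw [hhalf]; rfl
      rw [e, eLpNorm_const_smul]
      have h2 : ‖(2 : ℂ)⁻¹‖ₑ ≤ 1 := by
        rw [← ofReal_norm]
        refine ENNReal.ofReal_le_one.2 ?_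
        norm_num
      refine (mul_le_of_le_one_left' h2).trans ?_
      refine (eLpNorm_add_le hqc.aestronglyMeasurable continuous_const.aestronglyMeasurable
        hp.le).trans ?_
      rw [hconst]
    refine hhn.trans ?_
    calc _ ≤ C * (ENNReal.ofReal ε + eLpNorm g p haarT) + (eLpNorm g p haarT + ENNReal.ofReal ε) := by
          refine add_le_add hqn ((enorm_sub_le).trans ?_)
          rw [hεe]
          gcongr
          exact norm_circleCoeff_le hf.1 hp.le 0
      _ = _ := by rw [add_mul, one_mul, add_comm (ENNReal.ofReal ε)]
  have hlim : Tendsto (fun ε : ℝ => (C + 1) * (eLpNorm g p haarT + ENNReal.ofReal ε)) (𝓝[>] 0)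
      (𝓝 ((C + 1) * (eLpNorm g p haarT + ENNReal.ofReal 0))) := by
    refine tendsto_nhdsWithin_of_tendsto_nhds ?_
    refine ENNReal.Tendsto.const_mul (tendsto_const_nhds.add
      (ENNReal.continuous_ofReal.tendsto 0)) (Or.inr (by simp [hC]))
  rw [ENNReal.ofReal_zero, add_zero] at hlim
  refine ge_of_tendsto hlim ?_
  filter_upwards [self_mem_nhdsWithin] with ε hε using key ε hε

theorem halfCesaro_add {f g : Circle → ℂ} (hf : Integrable f haarT) (hg : Integrable g haarT)
    (N : ℕ) : halfCesaro (f + g) N = halfCesaro f N + halfCesaro g N := by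
  funext τ
  simp only [halfCesaro, trigPoly, Pi.add_apply, ← Finset.sum_add_distrib, circleCoeff_add hf hg]
  exact Finset.sum_congr rfl fun n _ => by ring

theorem halfCesaro_const_mul (r : ℂ) (f : Circle → ℂ) (N : ℕ) :
    halfCesaro (fun τ => r * f τ) N = fun τ => r * halfCesaro f N τ := by
  funext τ
  simp only [halfCesaro, trigPoly, Finset.mul_sum, circleCoeff_const_mul]
  exact Finset.sum_congr rfl fun n _ => by ring

/-- Positive and negative parts of the real and imaginary parts are treated separately, whence the
factor $4$. -/
theorem exists_eLpNorm_halfCesaro_le {p : ℝ≥0∞} (hp : 1 < p) (hp2 : p ≤ 2) :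
    ∃ C : ℝ≥0∞, C ≠ ∞ ∧ ∀ (f : Circle → ℂ) (N : ℕ), MemLp f p haarT →
      eLpNorm (halfCesaro f N) p haarT ≤ C * eLpNorm f p haarT := by
  obtain ⟨C, hC, h⟩ := exists_eLpNorm_halfCesaro_le_of_nonneg hp hp2
  refine ⟨4 * C, ENNReal.mul_ne_top (by simp) hC, fun f N hf => ?_⟩
  have hm : ∀ g N, AEStronglyMeasurable (halfCesaro g N) haarT := fun g N =>
    (continuous_trigPoly _ _).aestronglyMeasurable
  have hpart : ∀ φ : ℂ → ℝ, Continuous φ → (∀ z, 0 ≤ φ z) → (∀ z, φ z ≤ ‖z‖) → ∀ r : ℂ, ‖r‖ = 1 →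
      MemLp (fun τ => r * (φ (f τ) : ℂ)) p haarT ∧
      eLpNorm (halfCesaro (fun τ => r * (φ (f τ) : ℂ)) N) p haarT ≤ C * eLpNorm f p haarT := by
    intro φ hφ h0 h1 r hr
    have hle : ∀ τ, ‖(φ (f τ) : ℂ)‖ ≤ ‖f τ‖ := fun τ => by
      rw [Complex.norm_real, Real.norm_of_nonneg (h0 _)]; exact h1 _
    have hmem : MemLp (fun τ => (φ (f τ) : ℂ)) p haarT :=
      hf.mono ((Complex.continuous_ofReal.comp hφ).comp_aestronglyMeasurable hf.1)
        (Eventually.of_forall hle)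
    refine ⟨hmem.const_mul r, ?_⟩
    rw [halfCesaro_const_mul]
    have : eLpNorm (fun τ => r * halfCesaro (fun τ => (φ (f τ) : ℂ)) N τ) p haarT
        = eLpNorm (halfCesaro (fun τ => (φ (f τ) : ℂ)) N) p haarT :=
      eLpNorm_congr_norm_ae (Eventually.of_forall fun τ => by rw [norm_mul, hr, one_mul])
    rw [this]
    refine (h (fun τ => φ (f τ)) N (fun τ => h0 _) hmem).trans ?_
    gcongr
    exact eLpNorm_mono hle
  obtain ⟨m1, b1⟩ := hpart (fun z => max z.re 0) (by fun_prop) (fun z => le_max_right _ _)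
    (fun z => max_le ((le_abs_self _).trans (Complex.abs_re_le_norm z)) (norm_nonneg z)) 1 (by simp)
  obtain ⟨m2, b2⟩ := hpart (fun z => max (-z.re) 0) (by fun_prop) (fun z => le_max_right _ _)
    (fun z => max_le ((neg_le_abs _).trans (Complex.abs_re_le_norm z)) (norm_nonneg z)) (-1) (by simp)
  obtain ⟨m3, b3⟩ := hpart (fun z => max z.im 0) (by fun_prop) (fun z => le_max_right _ _)
    (fun z => max_le ((le_abs_self _).trans (Complex.abs_im_le_norm z)) (norm_nonneg z))
    Complex.I (by simp)
  obtain ⟨m4, b4⟩ := hpart (fun z => max (-z.im) 0) (by fun_prop) (fun z => le_max_right _ _)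
    (fun z => max_le ((neg_le_abs _).trans (Complex.abs_im_le_norm z)) (norm_nonneg z))
    (-Complex.I) (by simp)
  set f1 : Circle → ℂ := fun τ => 1 * ((max (f τ).re 0 : ℝ) : ℂ)
  set f2 : Circle → ℂ := fun τ => -1 * ((max (-(f τ).re) 0 : ℝ) : ℂ)
  set f3 : Circle → ℂ := fun τ => Complex.I * ((max (f τ).im 0 : ℝ) : ℂ)
  set f4 : Circle → ℂ := fun τ => -Complex.I * ((max (-(f τ).im) 0 : ℝ) : ℂ)
  have hmax : ∀ x : ℝ, max x 0 - max (-x) 0 = x := fun x => by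
    rcases le_total x 0 with h | h
    · rw [max_eq_right h, max_eq_left (by linarith)]; ring
    · rw [max_eq_left h, max_eq_right (by linarith)]; ring
  have hsum : f = (f1 + f2) + (f3 + f4) := by
    funext τ
    have h1 := hmax (f τ).re
    have h2 := hmax (f τ).im
    apply Complex.ext
    · simp only [f1, f2, f3, f4, Pi.add_apply, Complex.add_re, Complex.mul_re, Complex.neg_re,
        Complex.neg_im, Complex.one_re, Complex.one_im, Complex.ofReal_re, Complex.ofReal_im,
        Complex.I_re, Complex.I_im]
      linarith
    · simp only [f1, f2, f3, f4, Pi.add_apply, Complex.add_im, Complex.mul_im, Complex.neg_re,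
        Complex.neg_im, Complex.one_re, Complex.one_im, Complex.ofReal_re, Complex.ofReal_im,
        Complex.I_re, Complex.I_im]
      linarith
  have hi : ∀ {g : Circle → ℂ}, MemLp g p haarT → Integrable g haarT := fun hg =>
    hg.integrable hp.le
  have hH : halfCesaro f N
      = (halfCesaro f1 N + halfCesaro f2 N) + (halfCesaro f3 N + halfCesaro f4 N) := by
    conv_lhs => rw [hsum]
    rw [halfCesaro_add ((hi m1).add (hi m2)) ((hi m3).add (hi m4)), halfCesaro_add (hi m1) (hi m2),
      halfCesaro_add (hi m3) (hi m4)]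
  rw [hH]
  refine (eLpNorm_add_le ((hm _ _).add (hm _ _)) ((hm _ _).add (hm _ _)) hp.le).trans ?_
  refine (add_le_add (eLpNorm_add_le (hm _ _) (hm _ _) hp.le)
    (eLpNorm_add_le (hm _ _) (hm _ _) hp.le)).trans ?_
  refine (add_le_add (add_le_add b1 b2) (add_le_add b3 b4)).trans (le_of_eq ?_)
  ring

/-- The M. Riesz projection is bounded on trigonometric polynomials. -/
theorem exists_eLpNorm_filter_nonneg_le {p : ℝ≥0∞} (hp : 1 < p) (hp2 : p ≤ 2) :
    ∃ C : ℝ≥0∞, C ≠ ∞ ∧ ∀ (s : Finset ℤ) (a : ℤ → ℂ),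
      eLpNorm (trigPoly (s.filter (0 ≤ ·)) a) p haarT ≤ C * eLpNorm (trigPoly s a) p haarT := by
  obtain ⟨C, hC, h⟩ := exists_eLpNorm_halfCesaro_le hp hp2
  refine ⟨C, hC, fun s a => ?_⟩
  -- For a fixed polynomial the weights tend to $1$, so the half means converge pointwise to the
  -- Riesz projection, and Fatou's lemma passes the bound to the limit.
  have hlim : ∀ τ, Tendsto (fun N => halfCesaro (trigPoly s a) N τ) atTop
      (𝓝 (trigPoly (s.filter (0 ≤ ·)) a τ)) := by
    intro τ
    have h1 : Tendsto (fun N : ℕ => trigPoly (s.filter (0 ≤ ·)) (fun n => fejerWeight N n * a n) τ)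
        atTop (𝓝 (trigPoly (s.filter (0 ≤ ·)) a τ)) := by
      refine tendsto_finsetSum _ fun n _ => ?_
      have := ((Complex.continuous_ofReal.tendsto _).comp (tendsto_fejerWeight n)).mul_const (a n)
      simpa using this.mul_const ((τ : ℂ) ^ n)
    refine h1.congr' ?_
    filter_upwards [eventually_subset_Icc s] with N hN
    refine congrFun (trigPoly_congr_subset ?_ ?_ ?_).symm τ
    · intro n hn
      rw [Finset.mem_filter] at hn
      have := Finset.mem_Icc.1 (hN hn.1)
      exact Finset.mem_Icc.2 ⟨hn.2, this.2⟩
    · intro n hn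
      rw [circleCoeff_trigPoly, if_pos (Finset.mem_filter.1 hn).1]
    · intro n hn hns
      rw [circleCoeff_trigPoly, if_neg, mul_zero]
      exact fun hs => hns (Finset.mem_filter.2 ⟨hs, (Finset.mem_Icc.1 hn).1⟩)
  refine (Lp.eLpNorm_lim_le_liminf_eLpNorm
    (fun N => (continuous_trigPoly _ _).aestronglyMeasurable) _ (Eventually.of_forall hlim)).trans ?_
  refine liminf_le_of_le (by isBoundedDefault) fun b hb => ?_
  obtain ⟨N, hN⟩ := hb.exists
  exact hN.trans (h _ N (memLp_trigPoly _ _ _))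

theorem eLpNorm_trigPoly_shift (p : ℝ≥0∞) (s : Finset ℤ) (a : ℤ → ℂ) (k : ℤ) :
    eLpNorm (trigPoly (s.map (Equiv.addRight (-k)).toEmbedding) fun n => a (n + k)) p haarT
      = eLpNorm (trigPoly s a) p haarT := by
  refine eLpNorm_congr_norm_ae (Eventually.of_forall fun τ => ?_)
  have : trigPoly s a τ = (τ : ℂ) ^ k
      * trigPoly (s.map (Equiv.addRight (-k)).toEmbedding) (fun n => a (n + k)) τ := by
    rw [trigPoly, trigPoly, Finset.sum_map, Finset.mul_sum]
    refine Finset.sum_congr rfl fun n _ => ?_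
    simp only [Equiv.coe_toEmbedding, Equiv.coe_addRight, neg_add_cancel_right]
    rw [mul_left_comm, ← zpow_add₀ (Circle.coe_ne_zero τ)]
    congr 2
    ring
  rw [this, norm_mul, Circle.norm_coe_zpow, one_mul]

/-- Multiplication by $\tau^{-k}$ is isometric and moves the cut from $k$ to $0$, so the constant
does not depend on $k$. -/
theorem exists_eLpNorm_filter_le {p : ℝ≥0∞} (hp : 1 < p) (hp2 : p ≤ 2) :
    ∃ C : ℝ≥0∞, C ≠ ∞ ∧ ∀ (s : Finset ℤ) (a : ℤ → ℂ) (k : ℤ),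
      eLpNorm (trigPoly (s.filter (k ≤ ·)) a) p haarT ≤ C * eLpNorm (trigPoly s a) p haarT := by
  obtain ⟨C, hC, h⟩ := exists_eLpNorm_filter_nonneg_le hp hp2
  refine ⟨C, hC, fun s a k => ?_⟩
  rw [← eLpNorm_trigPoly_shift p s a k, ← eLpNorm_trigPoly_shift p (s.filter (k ≤ ·)) a k]
  have : (s.filter (k ≤ ·)).map (Equiv.addRight (-k)).toEmbedding
      = (s.map (Equiv.addRight (-k)).toEmbedding).filter (0 ≤ ·) := by
    ext m
    simp only [Finset.mem_map_equiv, Finset.mem_filter]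
    simp
  rw [this]
  exact h _ _

theorem circlePartial_sub {f g : Circle → ℂ} (hf : Integrable f haarT) (hg : Integrable g haarT)
    (N : ℕ) : circlePartial (f - g) N = circlePartial f N - circlePartial g N := by
  rw [circlePartial, circlePartial, circlePartial, ← trigPoly_sub]
  congr 1 with n
  rw [circleCoeff_sub hf hg]

/-- A symmetric partial sum is a difference of two half-line projections, each bounded independently
of $N$. -/
theorem circlePartial_trigPoly (s : Finset ℤ) (a : ℤ → ℂ) (N : ℕ) :
    circlePartial (trigPoly s a) N
      = trigPoly (s.filter (-(N : ℤ) ≤ ·)) a - trigPoly (s.filter ((N : ℤ) + 1 ≤ ·)) a := by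
  funext τ
  simp only [circlePartial, trigPoly, Pi.sub_apply, circleCoeff_trigPoly]
  have h1 : s.filter (-(N : ℤ) ≤ ·)
      = (s.filter fun n => n ∈ Finset.Icc (-(N : ℤ)) N) ∪ s.filter ((N : ℤ) + 1 ≤ ·) := by
    ext n; simp only [Finset.mem_filter, Finset.mem_union, Finset.mem_Icc]
    constructor
    · rintro ⟨h1, h2⟩
      rcases le_or_gt n N with h | h
      · exact Or.inl ⟨h1, h2, h⟩
      · exact Or.inr ⟨h1, h⟩
    · rintro (⟨h1, h2⟩ | ⟨h1, h2⟩)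
      · exact ⟨h1, h2.1⟩
      · exact ⟨h1, by omega⟩
  rw [h1, Finset.sum_union, add_sub_cancel_right, Finset.sum_filter]
  · simp only [ite_mul, zero_mul]
    rw [← Finset.sum_filter, ← Finset.sum_filter]
    refine Finset.sum_congr ?_ fun _ _ => rfl
    ext n; simp only [Finset.mem_filter]; tauto
  · rw [Finset.disjoint_left]
    intro n hn hn'
    simp only [Finset.mem_filter, Finset.mem_Icc] at hn hn'
    omega

/-- The M. Riesz theorem for `1 < p ≤ 2`. -/
theorem exists_eLpNorm_circlePartial_le_of_le_two {p : ℝ≥0∞} (hp : 1 < p) (hp2 : p ≤ 2) :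
    ∃ C : ℝ≥0∞, C ≠ ∞ ∧ ∀ (N : ℕ) (f : Circle → ℂ), MemLp f p haarT →
      eLpNorm (circlePartial f N) p haarT ≤ C * eLpNorm f p haarT := by
  have hp' : p ≠ ∞ := (hp2.trans_lt (by simp)).ne
  obtain ⟨C, hC, h⟩ := exists_eLpNorm_filter_le hp hp2
  have hm : ∀ g N, AEStronglyMeasurable (circlePartial g N) haarT := fun g N =>
    (continuous_trigPoly _ _).aestronglyMeasurable
  refine ⟨C + C, by simp [hC], fun N f hf => ?_⟩
  -- The bound $K$ grows with $N$, but it is only applied to the error of approximation by a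
  -- polynomial and disappears as that error tends to $0$.
  set K : ℝ≥0∞ := ((Finset.Icc (-(N : ℤ)) N).card : ℝ≥0∞) with hK
  have hK' : K ≠ ∞ := ENNReal.natCast_ne_top _
  have hcrude : ∀ g, MemLp g p haarT →
      eLpNorm (circlePartial g N) p haarT ≤ K * eLpNorm g p haarT := by
    intro g hg
    refine (eLpNorm_trigPoly_le hp.le _ _).trans ?_
    refine (Finset.sum_le_card_nsmul _ _ (eLpNorm g p haarT)
      fun n _ => norm_circleCoeff_le hg.1 hp.le n).trans (le_of_eq ?_)
    rw [nsmul_eq_mul]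
  have key : ∀ ε : ℝ≥0∞, ε ≠ 0 → eLpNorm (circlePartial f N) p haarT
      ≤ (C + C) * (eLpNorm f p haarT + ε) + K * ε := by
    intro ε hε
    obtain ⟨s, a, hsa⟩ := exists_trigPoly_eLpNorm_sub_le hp.le hp' hf hε
    have hP := memLp_trigPoly s a p
    have e1 : circlePartial f N = circlePartial (trigPoly s a) N
        + circlePartial (f - trigPoly s a) N := by
      rw [circlePartial_sub (hf.integrable hp.le) (hP.integrable hp.le)]; abel
    rw [e1]
    refine (eLpNorm_add_le (hm _ _) (hm _ _) hp.le).trans (add_le_add ?_ ?_)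
    · have hPn : eLpNorm (trigPoly s a) p haarT ≤ eLpNorm f p haarT + ε := by
        have : trigPoly s a = f - (f - trigPoly s a) := by abel
        rw [this]
        refine (eLpNorm_sub_le hf.1 (hf.1.sub hP.1) hp.le).trans ?_
        gcongr
      rw [circlePartial_trigPoly]
      refine (eLpNorm_sub_le (continuous_trigPoly _ _).aestronglyMeasurable
        (continuous_trigPoly _ _).aestronglyMeasurable hp.le).trans ?_
      rw [add_mul]
      exact add_le_add ((h s a _).trans (by gcongr)) ((h s a _).trans (by gcongr))
    · refine (hcrude _ (hf.sub hP)).trans ?_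
      gcongr
  have hlim : Tendsto (fun ε : ℝ≥0∞ => (C + C) * (eLpNorm f p haarT + ε) + K * ε) (𝓝[>] 0)
      (𝓝 ((C + C) * (eLpNorm f p haarT + 0) + K * 0)) := by
    refine tendsto_nhdsWithin_of_tendsto_nhds ?_
    exact (ENNReal.Tendsto.const_mul (tendsto_const_nhds.add tendsto_id)
      (Or.inr (by simp [hC]))).add (ENNReal.Tendsto.const_mul tendsto_id (Or.inr hK'))
  rw [add_zero, mul_zero, add_zero] at hlim
  refine ge_of_tendsto hlim ?_
  filter_upwards [self_mem_nhdsWithin] with ε hε using key ε (ne_of_gt hε)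

/-! ### Duality and convergence of Fourier series for all exponents -/

/-- The partial sum operator is symmetric: both sides equal $\sum_{|n|\le N}\hat f(n)\overline{\hat
h(n)}$. -/
theorem integral_circlePartial_mul_conj {f h : Circle → ℂ} (hf : Integrable f haarT)
    (hh : Integrable h haarT) (N : ℕ) :
    ∫ τ, circlePartial f N τ * starRingEnd ℂ (h τ) ∂haarT
      = ∫ τ, f τ * starRingEnd ℂ (circlePartial h N τ) ∂haarT := by
  have hstar : Integrable (fun τ => starRingEnd ℂ (h τ)) haarT :=
    (Complex.conjCLE.toContinuousLinearMap).integrable_comp hh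
  have b1 : ∀ (n : ℤ) (g : Circle → ℂ), Integrable g haarT →
      Integrable (fun τ : Circle => (τ : ℂ) ^ n * g τ) haarT := fun n g hg =>
    hg.bdd_mul (c := 1) (Circle.continuous_coe_zpow n).aestronglyMeasurable
      (Eventually.of_forall fun τ => (Circle.norm_coe_zpow τ n).le)
  have e1 : ∫ τ, circlePartial f N τ * starRingEnd ℂ (h τ) ∂haarT
      = ∑ n ∈ Finset.Icc (-(N : ℤ)) N, circleCoeff f n * starRingEnd ℂ (circleCoeff h n) := by
    simp only [circlePartial, trigPoly, Finset.sum_mul, mul_assoc]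
    rw [integral_finsetSum _ fun n _ => (b1 n _ hstar).const_mul _]
    refine Finset.sum_congr rfl fun n _ => ?_
    rw [integral_const_mul, circleCoeff, circleCoeff, ← integral_conj]
    congr 2
    funext τ
    rw [map_mul, map_zpow₀, Complex.conj_conj, mul_comm]
  have e2 : ∫ τ, f τ * starRingEnd ℂ (circlePartial h N τ) ∂haarT
      = ∑ n ∈ Finset.Icc (-(N : ℤ)) N, circleCoeff f n * starRingEnd ℂ (circleCoeff h n) := by
    simp only [circlePartial, trigPoly, map_sum, map_mul, map_zpow₀, Finset.mul_sum]
    rw [integral_finsetSum]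
    · refine Finset.sum_congr rfl fun n _ => ?_
      rw [circleCoeff.eq_1 f, ← integral_mul_const]
      congr 1
      funext τ
      ring
    · intro n _
      refine ((integrable_mul_conj_zpow hf n).mul_const (starRingEnd ℂ (circleCoeff h n))).congr
        (Eventually.of_forall fun τ => ?_)
      simp only []
      ring
  rw [e1, e2]

/-- Boundedness of the partial sums passes to the conjugate exponent. -/
theorem eLpNorm_circlePartial_le_of_conj {p q : ℝ≥0∞} (hp : 1 < p) (hp' : p ≠ ∞) (hq : 1 < q)
    (hq' : q ≠ ∞) (hpq : p.toReal.HolderConjugate q.toReal) {C : ℝ≥0∞}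
    (h : ∀ (N : ℕ) (f : Circle → ℂ), MemLp f q haarT →
      eLpNorm (circlePartial f N) q haarT ≤ C * eLpNorm f q haarT)
    (N : ℕ) {f : Circle → ℂ} (hf : MemLp f p haarT) :
    eLpNorm (circlePartial f N) p haarT ≤ C * eLpNorm f p haarT := by
  set r := p.toReal with hr
  set t := q.toReal with ht
  have hr1 : 1 < r := hpq.lt
  have hr0 : 0 < r := by linarith
  have hp0 : p ≠ 0 := (zero_lt_one.trans hp).ne'
  have hq0 : q ≠ 0 := (zero_lt_one.trans hq).ne'
  set g := circlePartial f N with hg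
  have hgc : Continuous g := continuous_trigPoly _ _
  have hgp : MemLp g p haarT := memLp_of_continuous_circle hgc p
  -- The extremal function for duality: $g\bar k=|g|^r$ and $|k|^t=|g|^r$. Where $g=0$ the factor
  -- $g$ makes $k$ vanish whatever the power is.
  set k : Circle → ℂ := fun τ => g τ * ((‖g τ‖ ^ (r - 2) : ℝ) : ℂ) with hk
  have hkn : ∀ τ, ‖k τ‖ = ‖g τ‖ ^ (r - 1) := by
    intro τ
    rw [hk]
    simp only [norm_mul, Complex.norm_real]
    rw [Real.norm_of_nonneg (by positivity)]
    rcases eq_or_ne (g τ) 0 with h0 | h0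
    · rw [h0, norm_zero, zero_mul, Real.zero_rpow (by linarith)]
    · have h1 : 0 < ‖g τ‖ := norm_pos_iff.2 h0
      nth_rewrite 1 [← Real.rpow_one ‖g τ‖]
      rw [← Real.rpow_add h1]
      congr 1; ring
  have hkm : AEStronglyMeasurable k haarT := by
    refine Measurable.aestronglyMeasurable ?_
    exact hgc.measurable.mul (Complex.measurable_ofReal.comp (hgc.norm.measurable.pow_const _))
  have hgk : ∀ τ, g τ * starRingEnd ℂ (k τ) = ((‖g τ‖ ^ r : ℝ) : ℂ) := by
    intro τ
    rw [hk]
    simp only [map_mul, Complex.conj_ofReal]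
    rw [← mul_assoc, Complex.mul_conj']
    rcases eq_or_ne (g τ) 0 with h0 | h0
    · rw [h0, norm_zero, Real.zero_rpow hr0.ne']; simp
    · have h1 : 0 < ‖g τ‖ := norm_pos_iff.2 h0
      rw [← Complex.ofReal_pow, ← Complex.ofReal_mul]
      congr 1
      rw [← Real.rpow_natCast, ← Real.rpow_add h1]
      congr 1; push_cast; ring
  set I : ℝ≥0∞ := ∫⁻ τ, ‖g τ‖ₑ ^ r ∂haarT with hI
  have hgI : eLpNorm g p haarT = I ^ (1 / r) := by
    rw [eLpNorm_eq_lintegral_rpow_enorm_toReal hp0 hp']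
  have hkI : eLpNorm k q haarT = I ^ (1 / t) := by
    rw [eLpNorm_eq_lintegral_rpow_enorm_toReal hq0 hq', ← ht]
    congr 1
    refine lintegral_congr fun τ => ?_
    rw [← ofReal_norm, hkn, ← ENNReal.ofReal_rpow_of_nonneg (norm_nonneg _) (by linarith),
      ofReal_norm, ← ENNReal.rpow_mul, hpq.sub_one_mul_conj]
  have hItop : I ≠ ∞ := by
    intro h0
    have h1 := hgp.2
    rw [hgI, h0, ENNReal.top_rpow_of_pos (by positivity)] at h1
    exact lt_irrefl _ h1
  have ht0 : 0 < t := hpq.symm.pos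
  have hkq : MemLp k q haarT := ⟨hkm, by
    rw [hkI]; exact ENNReal.rpow_lt_top_of_nonneg (by positivity) hItop⟩
  have hmain : I ≤ eLpNorm f p haarT * (C * I ^ (1 / t)) := by
    have h1 : I = ENNReal.ofReal (∫ τ, ‖g τ‖ ^ r ∂haarT) := lintegral_enorm_rpow_circle hgc hr0.le
    have h2 : ((∫ τ, ‖g τ‖ ^ r ∂haarT : ℝ) : ℂ)
        = ∫ τ, f τ * starRingEnd ℂ (circlePartial k N τ) ∂haarT := by
      rw [← integral_circlePartial_mul_conj (hf.integrable hp.le) (hkq.integrable hq.le),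
        ← integral_complex_ofReal]
      exact integral_congr_ae (Eventually.of_forall fun τ => (hgk τ).symm)
    have h3 : I = ‖∫ τ, f τ * starRingEnd ℂ (circlePartial k N τ) ∂haarT‖ₑ := by
      rw [← h2, ← ofReal_norm, Complex.norm_real, Real.norm_of_nonneg, h1]
      exact integral_nonneg fun τ => Real.rpow_nonneg (norm_nonneg _) _
    refine h3.le.trans ((enorm_integral_le_lintegral_enorm _).trans ?_)
    have h4 := ENNReal.lintegral_mul_le_Lp_mul_Lq haarT hpq hf.1.enorm
      (continuous_trigPoly (Finset.Icc (-(N : ℤ)) N) (circleCoeff k)).aestronglyMeasurable.enorm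
    refine le_trans (le_of_eq ?_) (h4.trans ?_)
    · refine lintegral_congr fun τ => ?_
      rw [enorm_mul, RCLike.enorm_conj]
      rfl
    · have h5 := h N k hkq
      rw [hkI] at h5
      rw [eLpNorm_eq_lintegral_rpow_enorm_toReal hp0 hp']
      refine mul_le_mul' le_rfl ?_
      rw [eLpNorm_eq_lintegral_rpow_enorm_toReal hq0 hq'] at h5
      exact h5
  rw [hgI]
  rcases eq_or_ne I 0 with h0 | h0
  · rw [h0, ENNReal.zero_rpow_of_pos (by positivity)]; exact zero_le
  have hIt0 : I ^ (1 / t) ≠ 0 := by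
    rw [Ne, ENNReal.rpow_eq_zero_iff_of_pos (by positivity)]; exact h0
  have hIt : I ^ (1 / t) ≠ ∞ := ENNReal.rpow_ne_top_of_nonneg (by positivity) hItop
  -- The factor $I^{1/t}$ is cancelled; this is legitimate because $I$ is finite, $g$ being a
  -- trigonometric polynomial, and is nonzero here.
  have hsplit : I = I ^ (1 / r) * I ^ (1 / t) := by
    rw [← ENNReal.rpow_add _ _ h0 hItop, one_div, one_div, hpq.inv_add_inv_eq_one, ENNReal.rpow_one]
  have h6 : I ^ (1 / r) * I ^ (1 / t) ≤ C * eLpNorm f p haarT * I ^ (1 / t) := by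
    rw [← hsplit]
    refine hmain.trans (le_of_eq ?_)
    ring
  exact (ENNReal.mul_le_mul_iff_left hIt0 hIt).1 h6

/-- The M. Riesz theorem: the partial sums of Fourier series are uniformly bounded on `L^p`. -/
theorem exists_eLpNorm_circlePartial_le {p : ℝ≥0∞} (hp : 1 < p) (hp' : p ≠ ∞) :
    ∃ C : ℝ≥0∞, C ≠ ∞ ∧ ∀ (N : ℕ) (f : Circle → ℂ), MemLp f p haarT →
      eLpNorm (circlePartial f N) p haarT ≤ C * eLpNorm f p haarT := by
  rcases le_or_gt p 2 with hp2 | hp2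
  · exact exists_eLpNorm_circlePartial_le_of_le_two hp hp2
  · have hr2 : 2 < p.toReal := by
      have := (ENNReal.toReal_lt_toReal ENNReal.ofNat_ne_top hp').2 hp2
      simpa using this
    set t : ℝ := p.toReal / (p.toReal - 1) with ht
    have hpq : p.toReal.HolderConjugate t := Real.HolderConjugate.conjExponent (by linarith)
    have ht1 : 1 < t := hpq.symm.lt
    have ht2 : t ≤ 2 := by
      rw [ht, div_le_iff₀ (by linarith)]; linarith
    have hq : (1 : ℝ≥0∞) < ENNReal.ofReal t := by
      rw [← ENNReal.ofReal_one]; exact (ENNReal.ofReal_lt_ofReal_iff (by linarith)).2 ht1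
    have hq2 : ENNReal.ofReal t ≤ 2 := by
      rw [← ENNReal.ofReal_ofNat 2]; exact ENNReal.ofReal_le_ofReal ht2
    obtain ⟨C, hC, h⟩ := exists_eLpNorm_circlePartial_le_of_le_two hq hq2
    refine ⟨C, hC, fun N f hf => ?_⟩
    refine eLpNorm_circlePartial_le_of_conj hp hp' hq ENNReal.ofReal_ne_top ?_ h N hf
    rwa [ENNReal.toReal_ofReal (by linarith)]

/-- Fourier series converge in `L^p` of the circle for `1 < p < ∞`. -/
theorem tendsto_circlePartial {p : ℝ≥0∞} (hp : 1 < p) (hp' : p ≠ ∞) {f : Circle → ℂ}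
    (hf : MemLp f p haarT) :
    Tendsto (fun N => eLpNorm (circlePartial f N - f) p haarT) atTop (𝓝 0) := by
  obtain ⟨C, hC, h⟩ := exists_eLpNorm_circlePartial_le hp hp'
  refine tendsto_eLpNorm_of_trigPoly (T := fun N f => circlePartial f N) hp.le hp' hC
    ?_ ?_ h ?_ hf
  · exact fun N f _ => (continuous_trigPoly _ _).aestronglyMeasurable
  · exact fun N f g hf hg => circlePartial_sub (hf.integrable hp.le) (hg.integrable hp.le) N
  · intro s a
    refine tendsto_const_nhds.congr' ?_
    filter_upwards [eventually_subset_Icc s] with N hN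
    have e : circlePartial (trigPoly s a) N = trigPoly s a := by
      refine trigPoly_congr_subset hN ?_ ?_
      · intro n hn; rw [circleCoeff_trigPoly, if_pos hn]
      · intro n _ hn; rw [circleCoeff_trigPoly, if_neg hn]
    rw [e, sub_self, eLpNorm_zero]

/-! ### The modular function and inversion -/

section Modular

variable {G : Type*} [Group G] [TopologicalSpace G] [IsTopologicalGroup G] [LocallyCompactSpace G]

theorem modularCharacterFun_inv_mul (x : G) :
    Measure.modularCharacterFun x⁻¹ * Measure.modularCharacterFun x = 1 := by
  rw [← Measure.modularCharacterFun_map_mul, inv_mul_cancel, Measure.modularCharacterFun_map_one]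

variable [MeasurableSpace G] [BorelSpace G] (μ : Measure G) [μ.IsHaarMeasure] [μ.Regular]

theorem map_mul_right_eq_modularCharacterFun_smul_of_regular (x : G) :
    μ.map (fun y => y * x) = Measure.modularCharacterFun x • μ := by
  rw [Measure.modularCharacterFun_eq_haarScalarFactor μ]
  have : (μ.map (fun y => y * x)).Regular := Measure.Regular.map (Homeomorph.mulRight x)
  exact Measure.isMulLeftInvariant_eq_smul_of_regular _ μ

theorem lintegral_mul_right_eq_modularCharacterFun_mul {f : G → ℝ≥0∞} (hf : Measurable f) (x : G) :
    ∫⁻ y, f (y * x) ∂μ = Measure.modularCharacterFun x * ∫⁻ y, f y ∂μ := by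
  have h := lintegral_map (μ := μ) hf (measurable_mul_const x)
  rw [map_mul_right_eq_modularCharacterFun_smul_of_regular μ x] at h
  rw [← h, lintegral_smul_measure]
  rfl

/-- The value at $g$ is the ratio of $\int f(xg)\,d\mu(x)$ to $\int f\,d\mu$. After inversion of the
variable the numerator is a convolution integral against `μ.inv`, continuous in $g$. -/
theorem continuous_modularCharacterFun :
    Continuous (Measure.modularCharacterFun : G → ℝ≥0) := by
  let μ : Measure G := Measure.haar
  obtain ⟨⟨f, f_cont⟩, f_comp, f_nonneg, f_one⟩ :
    ∃ f : C(G, ℝ), HasCompactSupport f ∧ 0 ≤ f ∧ f 1 ≠ 0 := exists_continuous_nonneg_pos 1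
  have hpos : 0 < ∫ x, f x ∂μ :=
    f_cont.integral_pos_of_hasCompactSupport_nonneg_nonzero f_comp f_nonneg f_one
  have h1 : ∀ g : G, (Measure.modularCharacterFun g : ℝ)
      = (∫ x, f (x⁻¹ * g) ∂μ.inv) / ∫ x, f x ∂μ := by
    intro g
    have hi : ∫ x, f (x⁻¹ * g) ∂μ.inv = ∫ x, f (x * g) ∂μ := by
      have := (MeasurableEquiv.inv G).measurableEmbedding.integral_map (μ := μ)
        fun x => f (x⁻¹ * g)
      simpa [Measure.inv_def] using this
    rw [eq_div_iff hpos.ne', hi]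
    have h := (MeasurableEquiv.mulRight g).measurableEmbedding.integral_map (μ := μ) f
    simp only [MeasurableEquiv.coe_mulRight] at h
    rw [← h, map_mul_right_eq_modularCharacterFun_smul_of_regular μ g,
      integral_smul_nnreal_measure]
    rfl
  rw [NNReal.isEmbedding_coe.continuous_iff]
  have h2 : (NNReal.toReal ∘ Measure.modularCharacterFun : G → ℝ)
      = fun g => (∫ x, f (x⁻¹ * g) ∂μ.inv) / ∫ x, f x ∂μ := funext h1
  rw [h2]
  exact (continuous_integral_apply_inv_mul f_cont f_comp).div_const _

theorem continuous_modularFn : Continuous (modularFn : G → ℝ) :=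
  NNReal.continuous_coe.comp (continuous_modularCharacterFun.comp continuous_inv)

/-- The Haar measure transported by inversion, with the density that makes it left invariant. -/
def invModularMeasure : Measure G :=
  (μ.withDensity fun x => (Measure.modularCharacterFun x : ℝ≥0∞)).map fun x => x⁻¹

theorem measurable_coe_modularCharacterFun :
    Measurable fun x : G => (Measure.modularCharacterFun x : ℝ≥0∞) :=
  (ENNReal.continuous_coe.comp continuous_modularCharacterFun).measurable

theorem lintegral_invModularMeasure {f : G → ℝ≥0∞} (hf : Measurable f) :
    ∫⁻ x, f x ∂invModularMeasure μ = ∫⁻ x, Measure.modularCharacterFun x * f x⁻¹ ∂μ := by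
  rw [invModularMeasure, lintegral_map hf measurable_inv]
  exact lintegral_withDensity_eq_lintegral_mul _ measurable_coe_modularCharacterFun
    (hf.comp measurable_inv)

theorem invModularMeasure_apply {s : Set G} (hs : MeasurableSet s) :
    invModularMeasure μ s = ∫⁻ x in s⁻¹, Measure.modularCharacterFun x ∂μ := by
  rw [invModularMeasure, Measure.map_apply measurable_inv hs,
    withDensity_apply _ (measurable_inv hs)]
  rfl

/-- A left translation becomes a right translation under inversion; the factor by which it scales
$\mu$ is cancelled by multiplicativity of the density. -/
theorem isMulLeftInvariant_invModularMeasure : (invModularMeasure μ).IsMulLeftInvariant := by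
  constructor
  intro a
  refine Measure.ext_of_lintegral _ fun f hf => ?_
  rw [lintegral_map hf (measurable_const_mul a), lintegral_invModularMeasure μ hf]
  refine (lintegral_invModularMeasure μ (hf.comp (measurable_const_mul a))).trans ?_
  have hφ : Measurable fun x : G => (Measure.modularCharacterFun x : ℝ≥0∞) * f x⁻¹ :=
    measurable_coe_modularCharacterFun.mul (hf.comp measurable_inv)
  have h := lintegral_mul_right_eq_modularCharacterFun_mul μ hφ a⁻¹
  have h0 : (Measure.modularCharacterFun a⁻¹ : ℝ≥0∞) ≠ 0 := by
    simpa using (Measure.modularCharacterFun_pos a⁻¹).ne'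
  rw [← ENNReal.mul_right_inj h0 ENNReal.coe_ne_top, ← h, ← lintegral_const_mul' _ _
    ENNReal.coe_ne_top]
  refine lintegral_congr fun x => ?_
  rw [Measure.modularCharacterFun_map_mul, ENNReal.coe_mul, mul_inv_rev, inv_inv]
  simp only [Function.comp_apply]
  ring

theorem isHaarMeasure_invModularMeasure : (invModularMeasure μ).IsHaarMeasure := by
  have := isMulLeftInvariant_invModularMeasure μ
  obtain ⟨K, hK, hKc, hK1⟩ := exists_mem_nhds_isCompact_isClosed (1 : G)
  have hKi : K⁻¹ ∈ 𝓝 (1 : G) := inv_mem_nhds_one G hK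
  have hint : (interior K).Nonempty := ⟨1, mem_interior_iff_mem_nhds.2 hK⟩
  refine Measure.isHaarMeasure_of_isCompact_nonempty_interior _ K hKc hint ?_ ?_
  · rw [invModularMeasure_apply μ hK1.measurableSet, Ne,
      lintegral_eq_zero_iff measurable_coe_modularCharacterFun, Filter.EventuallyEq,
      ae_iff]
    have : {a : G | ¬(Measure.modularCharacterFun a : ℝ≥0∞) = (0 : G → ℝ≥0∞) a} = Set.univ := by
      ext a
      simpa using (Measure.modularCharacterFun_pos a).ne'
    rw [this, Measure.restrict_apply_univ]
    exact (Measure.measure_pos_of_mem_nhds μ hKi).ne'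
  · rw [invModularMeasure_apply μ hK1.measurableSet]
    obtain ⟨C, hC⟩ := hKc.inv.bddAbove_image (continuous_modularCharacterFun (G := G)).continuousOn
    refine ((setLIntegral_mono' hK1.inv.measurableSet fun x hx =>
      ENNReal.coe_le_coe.2 (hC ⟨x, hx, rfl⟩)).trans_lt ?_).ne
    rw [setLIntegral_const]
    exact ENNReal.mul_lt_top ENNReal.coe_lt_top hKc.inv.measure_lt_top

/-- Regularity of the transported measure is not known beforehand, so uniqueness of Haar measure is
used on open sets only. A set with $\mu(s)<\infty$ lies in an open $U$ of finite measure, and two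
finite measures on $U$ that agree on the π-system of open sets are equal. -/
theorem invModularMeasure_eq_smul_of_ne_top [(invModularMeasure μ).IsHaarMeasure] {s : Set G}
    (hs : MeasurableSet s) (hsμ : μ s ≠ ∞) :
    invModularMeasure μ s = Measure.haarScalarFactor (invModularMeasure μ) μ • μ s := by
  set k := Measure.haarScalarFactor (invModularMeasure μ) μ with hk
  obtain ⟨U, hsU, hU, hUμ⟩ := s.exists_isOpen_lt_of_lt (μ := μ) ∞ hsμ.lt_top
  have hopen : ∀ V : Set G, IsOpen V → invModularMeasure μ V = (k • μ) V := fun V hV =>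
    Measure.measure_isHaarMeasure_eq_smul_of_isOpen _ μ hV
  have hfin : IsFiniteMeasure ((k • μ).restrict U) := ⟨by
    rw [Measure.restrict_apply_univ]
    exact ENNReal.mul_lt_top ENNReal.coe_lt_top hUμ⟩
  have hfin' : IsFiniteMeasure ((invModularMeasure μ).restrict U) := ⟨by
    rw [Measure.restrict_apply_univ, hopen U hU]
    exact ENNReal.mul_lt_top ENNReal.coe_lt_top hUμ⟩
  have heq : (invModularMeasure μ).restrict U = (k • μ).restrict U := by
    refine ext_of_generate_finite {V | IsOpen V} (BorelSpace.measurable_eq) isPiSystem_isOpen ?_ ?_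
    · intro V hV
      rw [Measure.restrict_apply hV.measurableSet, Measure.restrict_apply hV.measurableSet]
      exact hopen _ (hV.inter hU)
    · rw [Measure.restrict_apply_univ, Measure.restrict_apply_univ]
      exact hopen U hU
  have h := congrArg (fun m : Measure G => m s) heq
  simp only [Measure.restrict_apply hs, Set.inter_eq_self_of_subset_left hsU] at h
  exact h

/-- What remains is $\mu(s)=\infty$ with the transported measure of $s$ finite. The set is exhausted
by pieces in the symmetric sets $W_n$, where the modular function and its inverse are at most $n+1$.
On such a piece $t$ finiteness passes from the transported measure of $t$ to $\mu(t^{-1})$, then to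
the transported measure of $t^{-1}$, then to $\mu(t)$, and the finite case applies. -/
theorem invModularMeasure_eq_smul [(invModularMeasure μ).IsHaarMeasure] :
    invModularMeasure μ = Measure.haarScalarFactor (invModularMeasure μ) μ • μ := by
  set k := Measure.haarScalarFactor (invModularMeasure μ) μ with hk
  have hk0 : k ≠ 0 := (Measure.haarScalarFactor_pos_of_isHaarMeasure _ μ).ne'
  ext s hs
  by_cases hμ : μ s = ∞
  swap
  · exact invModularMeasure_eq_smul_of_ne_top μ hs hμ
  by_cases hν : invModularMeasure μ s = ∞
  · rw [hν, Measure.smul_apply, hμ, ENNReal.smul_top, if_neg hk0]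
  let W : ℕ → Set G := fun n => {x | (Measure.modularCharacterFun x : ℝ≥0) ≤ n + 1} ∩
    {x | (Measure.modularCharacterFun x⁻¹ : ℝ≥0) ≤ n + 1}
  have hWm : ∀ n, MeasurableSet (W n) := fun n =>
    ((isClosed_le continuous_modularCharacterFun continuous_const).inter
      (isClosed_le (continuous_modularCharacterFun.comp continuous_inv)
        continuous_const)).measurableSet
  have hWmono : Monotone W := fun m n hmn x hx => by
    have h1 : ((m : ℝ≥0) + 1) ≤ n + 1 := by gcongr
    exact ⟨le_trans hx.1 h1, le_trans hx.2 h1⟩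
  have hWU : ⋃ n, W n = Set.univ := by
    refine Set.eq_univ_of_forall fun x => ?_
    obtain ⟨n, hn⟩ := exists_nat_ge (max (Measure.modularCharacterFun x)
      (Measure.modularCharacterFun x⁻¹))
    refine Set.mem_iUnion.2 ⟨n, ?_, ?_⟩
    · exact ((le_max_left _ _).trans hn).trans (le_add_of_nonneg_right zero_le_one)
    · exact ((le_max_right _ _).trans hn).trans (le_add_of_nonneg_right zero_le_one)
  have hWinv : ∀ n, (W n)⁻¹ = W n := fun n => by
    ext x; simp only [W, Set.mem_inv, Set.mem_inter_iff, Set.mem_ofPred_eq, inv_inv]; tauto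
  have hlow : ∀ n, ∀ t ⊆ W n, MeasurableSet t → invModularMeasure μ t ≠ ∞ → μ t⁻¹ ≠ ∞ := by
    intro n t ht htm htν
    rw [invModularMeasure_apply μ htm] at htν
    have hc : ((n : ℝ≥0∞) + 1)⁻¹ ≠ 0 := by simp
    have h1 : ((n : ℝ≥0∞) + 1)⁻¹ * μ t⁻¹ ≤ ∫⁻ x in t⁻¹, Measure.modularCharacterFun x ∂μ := by
      rw [← setLIntegral_const]
      refine setLIntegral_mono' (measurable_inv htm) fun x hx => ?_
      have hx2 : x ∈ W n := by rw [← hWinv]; exact ht hx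
      have h2 : (Measure.modularCharacterFun x⁻¹ : ℝ≥0∞) ≤ (n : ℝ≥0∞) + 1 := by
        have := ENNReal.coe_le_coe.2 hx2.2
        simpa using this
      have h3 : (Measure.modularCharacterFun x⁻¹ : ℝ≥0∞) * Measure.modularCharacterFun x = 1 := by
        rw [← ENNReal.coe_mul, modularCharacterFun_inv_mul, ENNReal.coe_one]
      rw [ENNReal.inv_le_iff_le_mul (by simp) (by simp)]
      exact h3.symm.le.trans (by gcongr)
    intro htop
    rw [htop, ENNReal.mul_top hc] at h1
    exact htν (top_le_iff.1 h1)
  have hpiece : ∀ n, invModularMeasure μ (s ∩ W n) = (k • μ) (s ∩ W n) := by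
    intro n
    have hm := hs.inter (hWm n)
    have hm' : MeasurableSet (s ∩ W n)⁻¹ := measurable_inv hm
    have h1 : μ (s ∩ W n)⁻¹ ≠ ∞ := hlow n _ Set.inter_subset_right hm
      (ne_top_of_le_ne_top hν (measure_mono Set.inter_subset_left))
    have h2 : invModularMeasure μ (s ∩ W n)⁻¹ ≠ ∞ := by
      rw [invModularMeasure_eq_smul_of_ne_top μ hm' h1]
      exact ENNReal.mul_ne_top ENNReal.coe_ne_top h1
    have h3 : μ (s ∩ W n) ≠ ∞ := by
      have := hlow n (s ∩ W n)⁻¹ (fun x hx => by rw [← hWinv]; exact hx.2) hm' h2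
      rwa [inv_inv] at this
    exact invModularMeasure_eq_smul_of_ne_top μ hm h3
  have hsU : s = ⋃ n, s ∩ W n := by rw [← Set.inter_iUnion, hWU, Set.inter_univ]
  have hmono : Monotone fun n => s ∩ W n := fun m n hmn => Set.inter_subset_inter_right _ (hWmono hmn)
  rw [hsU, hmono.measure_iUnion, hmono.measure_iUnion]
  simp_rw [hpiece]

/-- Inversion carries the Haar measure with the modular function as density to the Haar measure. -/
theorem invModularMeasure_eq : invModularMeasure μ = μ := by
  have := isHaarMeasure_invModularMeasure μ
  have h := invModularMeasure_eq_smul μ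
  set k := Measure.haarScalarFactor (invModularMeasure μ) μ with hk
  obtain ⟨K, hK, hKc, hK1⟩ := exists_mem_nhds_isCompact_isClosed (1 : G)
  have hl : ∀ f : G → ℝ≥0∞, Measurable f →
      ∫⁻ x, Measure.modularCharacterFun x * f x⁻¹ ∂μ = k * ∫⁻ x, f x ∂μ := by
    intro f hf
    rw [← lintegral_invModularMeasure μ hf, h, lintegral_smul_measure]
    rfl
  have hg : Measurable (K.indicator (1 : G → ℝ≥0∞)) := measurable_one.indicator hK1.measurableSet
  have h1 := hl _ hg
  -- The transformation $f\mapsto\Delta(x)f(x^{-1})$, with $\Delta$ the density, is an involution,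
  -- so applying it twice gives $k^2=1$.
  have h2 := hl (fun x => Measure.modularCharacterFun x * K.indicator (1 : G → ℝ≥0∞) x⁻¹)
    (measurable_coe_modularCharacterFun.mul (hg.comp measurable_inv))
  rw [h1] at h2
  have h3 : ∫⁻ x, (Measure.modularCharacterFun x : ℝ≥0∞) *
      (Measure.modularCharacterFun x⁻¹ * K.indicator (1 : G → ℝ≥0∞) x⁻¹⁻¹) ∂μ = μ K := by
    rw [← lintegral_indicator_one hK1.measurableSet]
    refine lintegral_congr fun x => ?_
    rw [inv_inv, ← mul_assoc, mul_comm (Measure.modularCharacterFun x : ℝ≥0∞), ← ENNReal.coe_mul,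
      modularCharacterFun_inv_mul, ENNReal.coe_one, one_mul]
  rw [h3, lintegral_indicator_one hK1.measurableSet, ← mul_assoc] at h2
  have hK0 : μ K ≠ 0 := (Measure.measure_pos_of_mem_nhds μ hK).ne'
  have h4 : (k : ℝ≥0∞) * k = 1 := by
    rw [← ENNReal.mul_left_inj hK0 hKc.measure_lt_top.ne, one_mul, ← h2]
  have h5 : k * k = 1 := by exact_mod_cast h4
  have h6 : k = 1 := by
    have : k ^ 2 = 1 := by rw [sq, h5]
    exact (pow_eq_one_iff.1 this).resolve_right two_ne_zero
  rw [h, h6, one_smul]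

theorem lintegral_modularCharacterFun_mul_inv {f : G → ℝ≥0∞} (hf : Measurable f) :
    ∫⁻ x, Measure.modularCharacterFun x * f x⁻¹ ∂μ = ∫⁻ x, f x ∂μ := by
  rw [← lintegral_invModularMeasure μ hf, invModularMeasure_eq]

/-- The density relating $\mu$ to its image under inversion is strictly positive, so null sets
correspond. -/
theorem quasiMeasurePreserving_inv_of_regular :
    Measure.QuasiMeasurePreserving (fun x : G => x⁻¹) μ μ := by
  refine ⟨measurable_inv, Measure.AbsolutelyContinuous.mk fun s hs h0 => ?_⟩
  rw [← invModularMeasure_eq μ, invModularMeasure_apply μ hs,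
    lintegral_eq_zero_iff measurable_coe_modularCharacterFun] at h0
  rw [Measure.map_apply measurable_inv hs]
  have : ∀ᵐ x ∂(μ.restrict s⁻¹), False := h0.mono fun x hx =>
    (Measure.modularCharacterFun_pos x).ne' (by simpa using hx)
  rw [Filter.eventually_false_iff_eq_bot, ae_eq_bot, Measure.restrict_eq_zero] at this
  exact this

end Modular

/-! ### Density of continuous functions with compact support -/

section Density

/-- For compact $K\subseteq s\subseteq U$ open with $\mu(U\setminus K)\le\eta$, a Urysohn function
times $a$ differs from the indicator only on $U\setminus K$, by at most $|a|$. -/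
theorem exists_hasCompactSupport_eLpNorm_sub_indicator_le {X : Type*} [TopologicalSpace X]
    [LocallyCompactSpace X] [RegularSpace X] [MeasurableSpace X] [BorelSpace X] (μ : Measure X)
    [μ.Regular] {p : ℝ≥0∞} (hp' : p ≠ ∞) (a : ℂ) {s : Set X} (hs : MeasurableSet s)
    (hμs : μ s < ∞) {ε : ℝ≥0∞} (hε : ε ≠ 0) :
    ∃ g : X → ℂ, eLpNorm (g - s.indicator fun _ => a) p μ ≤ ε ∧
      Continuous g ∧ HasCompactSupport g := by
  obtain ⟨η, hη, hηε⟩ := exists_eLpNorm_indicator_le (μ := μ) hp' a hε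
  have hη2 : ((η / 2 : ℝ≥0) : ℝ≥0∞) ≠ 0 := by
    simpa using hη.ne'
  obtain ⟨K, hKs, hK, -, hKμ⟩ := hs.exists_isCompact_isClosed_sdiff_lt hμs.ne hη2
  obtain ⟨U, hsU, hU, -, hUμ⟩ := hs.exists_isOpen_sdiff_lt hμs.ne hη2
  obtain ⟨f, hf1, hf0, hfs, hf01⟩ :=
    exists_continuous_one_zero_of_isCompact hK hU.isClosed_compl
      (Set.disjoint_compl_right_iff_subset.2 (hKs.trans hsU))
  refine ⟨fun x => f x * a, ?_, by fun_prop, ?_⟩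
  · have hμ : μ (U \ K) ≤ η := by
      have h : U \ K ⊆ (U \ s) ∪ (s \ K) := by
        intro x hx
        by_cases hxs : x ∈ s
        · exact Or.inr ⟨hxs, hx.2⟩
        · exact Or.inl ⟨hx.1, hxs⟩
      refine (measure_mono h).trans ((measure_union_le _ _).trans ?_)
      refine (add_le_add hUμ.le hKμ.le).trans (le_of_eq ?_)
      rw [← ENNReal.coe_add, add_halves]
    refine (eLpNorm_mono fun x => ?_).trans (hηε _ hμ)
    have h01 := hf01 x
    by_cases hxK : x ∈ K
    · have := hf1 hxK
      simp only [Pi.one_apply] at this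
      simp [this, Set.indicator_of_mem (hKs hxK)]
    · by_cases hxU : x ∈ U
      · rw [Set.indicator_of_mem (show x ∈ U \ K from ⟨hxU, hxK⟩), Pi.sub_apply]
        by_cases hxs : x ∈ s
        · rw [Set.indicator_of_mem hxs]
          have : (f x : ℂ) * a - a = ((f x - 1 : ℝ) : ℂ) * a := by push_cast; ring
          rw [this, norm_mul, Complex.norm_real, Real.norm_eq_abs]
          refine mul_le_of_le_one_left (norm_nonneg _) (abs_le.2 ⟨?_, ?_⟩) <;>
            linarith [h01.1, h01.2]
        · rw [Set.indicator_of_notMem hxs, sub_zero, norm_mul, Complex.norm_real, Real.norm_eq_abs]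
          refine mul_le_of_le_one_left (norm_nonneg _) (abs_le.2 ⟨?_, ?_⟩) <;>
            linarith [h01.1, h01.2]
      · have := hf0 (show x ∈ Uᶜ from hxU)
        simp only [Pi.zero_apply] at this
        simp [this, Set.indicator_of_notMem fun h => hxU (hsU h), Set.indicator_of_notMem
          (show x ∉ U \ K from fun h => hxU h.1)]
  · exact HasCompactSupport.mul_right (hfs.comp_left (g := fun t : ℝ => (t : ℂ)) (by simp))

theorem ccDense_of_regular {Γ : Type*} [Group Γ] [TopologicalSpace Γ] [IsTopologicalGroup Γ]
    [LocallyCompactSpace Γ] [MeasurableSpace Γ] [BorelSpace Γ] (μ : Measure Γ) [μ.Regular]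
    {p : ℝ≥0∞} (hp' : p ≠ ∞) : CcDense μ p := by
  intro f hf ε hε
  obtain ⟨g, hg, hgc, hgs⟩ := hf.induction_dense hp'
    (fun g : Γ → ℂ => Continuous g ∧ HasCompactSupport g)
    (fun a s hs hμs ε hε => exists_hasCompactSupport_eLpNorm_sub_indicator_le μ hp' a hs hμs hε)
    (fun f g hf hg => ⟨hf.1.add hg.1, hf.2.add hg.2⟩)
    (fun f hf => (hf.1.memLp_of_hasCompactSupport (p := p) hf.2).1) hε
  exact ⟨g, hgc, hgs, hg⟩

end Density

/-! ### The Mackey group as a topological group with a measure -/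

namespace MackeyGroup

variable {G : Type*} [Group G] [TopologicalSpace G] {c : ContinuousTwoCocycle G}

@[simp] theorem base_mk (x : G) (τ : Circle) : (mk c x τ).base = x := rfl

@[simp] theorem phase_mk (x : G) (τ : Circle) : (mk c x τ).phase = τ := rfl

theorem mk_inv (x : G) (τ : Circle) : (mk c x τ)⁻¹ = mk c x⁻¹ (τ⁻¹ * c x⁻¹ x) := rfl

theorem base_inv (z : MackeyGroup c) : z⁻¹.base = z.base⁻¹ := rfl

theorem base_mul (z w : MackeyGroup c) : (z * w).base = z.base * w.base := rfl

theorem continuous_base : Continuous (base : MackeyGroup c → G) :=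
  (continuous_fst : Continuous (Prod.fst : G × Circle → G))

theorem continuous_phase : Continuous (phase : MackeyGroup c → Circle) :=
  (continuous_snd : Continuous (Prod.snd : G × Circle → Circle))

theorem continuous_mk {X : Type*} [TopologicalSpace X] {f : X → G} {g : X → Circle}
    (hf : Continuous f) (hg : Continuous g) : Continuous fun t => mk c (f t) (g t) :=
  (hf.prodMk hg : Continuous fun t => ((f t, g t) : G × Circle))

instance [IsTopologicalGroup G] : IsTopologicalGroup (MackeyGroup c) where
  continuous_mul := by
    have hb := continuous_base (c := c)
    have hq := continuous_phase (c := c)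
    have hc : Continuous fun q : MackeyGroup c × MackeyGroup c => c q.1.base q.2.base :=
      c.continuous_toFun.comp ((hb.comp continuous_fst).prodMk (hb.comp continuous_snd))
    exact continuous_mk ((hb.comp continuous_fst).mul (hb.comp continuous_snd))
      (((hq.comp continuous_fst).mul (hq.comp continuous_snd)).mul hc.inv)
  continuous_inv := by
    have hb := continuous_base (c := c)
    have hq := continuous_phase (c := c)
    have hc : Continuous fun z : MackeyGroup c => c z.base⁻¹ z.base :=
      c.continuous_toFun.comp ((hb.comp continuous_id).inv.prodMk hb)
    exact continuous_mk hb.inv (hq.inv.mul hc)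

variable [MeasurableSpace G]

instance [BorelSpace G] : BorelSpace (MackeyGroup c) :=
  inferInstanceAs (BorelSpace (G × Circle))

theorem measurable_base : Measurable (base : MackeyGroup c → G) :=
  (measurable_fst : Measurable (Prod.fst : G × Circle → G))

end MackeyGroup

section MackeyMeasure

variable {G : Type*} [Group G] [TopologicalSpace G] [MeasurableSpace G]
  {c : ContinuousTwoCocycle G} {μ : Measure G}

theorem lintegral_mackeyMeasure {f : MackeyGroup c → ℝ≥0∞}
    (hf : AEMeasurable f (mackeyMeasure c μ)) :
    ∫⁻ z, f z ∂mackeyMeasure c μ = ∫⁻ x, ∫⁻ τ, f (MackeyGroup.mk c x τ) ∂haarT ∂μ :=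
  lintegral_prod (μ := μ) (ν := haarT) f hf

theorem measurable_lintegral_fibre {f : MackeyGroup c → ℝ≥0∞} (hf : Measurable f) :
    Measurable fun x => ∫⁻ τ, f (MackeyGroup.mk c x τ) ∂haarT :=
  Measurable.lintegral_prod_right' (ν := haarT) (f := fun z : G × Circle => f z) hf

theorem ae_fibre_of_ae {P : MackeyGroup c → Prop} (h : ∀ᵐ z ∂mackeyMeasure c μ, P z) :
    ∀ᵐ x ∂μ, ∀ᵐ τ ∂haarT, P (MackeyGroup.mk c x τ) :=
  Measure.ae_ae_of_ae_prod (μ := μ) (ν := haarT) h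

theorem aestronglyMeasurable_fibre {F : MackeyGroup c → ℂ}
    (hF : AEStronglyMeasurable F (mackeyMeasure c μ)) :
    ∀ᵐ x ∂μ, AEStronglyMeasurable (fun τ => F (MackeyGroup.mk c x τ)) haarT :=
  AEStronglyMeasurable.prodMk_left (μ := μ) (ν := haarT) hF

theorem quasiMeasurePreserving_base :
    Measure.QuasiMeasurePreserving (MackeyGroup.base : MackeyGroup c → G) (mackeyMeasure c μ) μ :=
  Measure.quasiMeasurePreserving_fst (μ := μ) (ν := haarT)

instance [IsFiniteMeasureOnCompacts μ] : IsFiniteMeasureOnCompacts (mackeyMeasure c μ) :=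
  inferInstanceAs (IsFiniteMeasureOnCompacts (μ.prod haarT))

instance [IsTopologicalGroup G] [BorelSpace G] [μ.IsMulLeftInvariant] :
    (mackeyMeasure c μ).IsMulLeftInvariant :=
  ⟨fun w => (measurePreserving_mackey_mul_left c μ w).map_eq⟩

/-- On the fibre over $x$ inversion is $\tau\mapsto\tau^{-1}c(x^{-1},x)$, which preserves the Haar
measure of the circle. The claim thus reduces to the one on $G$, and the modular function of $G_c$
is that of $G$. -/
theorem lintegral_modularCharacterFun_mul_mackey_inv [IsTopologicalGroup G]
    [LocallyCompactSpace G] [BorelSpace G] [μ.IsHaarMeasure] [μ.Regular]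
    {f : MackeyGroup c → ℝ≥0∞} (hf : Measurable f) :
    ∫⁻ z, Measure.modularCharacterFun z.base * f z⁻¹ ∂mackeyMeasure c μ
      = ∫⁻ z, f z ∂mackeyMeasure c μ := by
  have hm : Measurable fun z : MackeyGroup c =>
      (Measure.modularCharacterFun z.base : ℝ≥0∞) * f z⁻¹ :=
    (measurable_coe_modularCharacterFun.comp MackeyGroup.measurable_base).mul
      (hf.comp measurable_inv)
  rw [lintegral_mackeyMeasure hm.aemeasurable, lintegral_mackeyMeasure hf.aemeasurable,
    ← lintegral_modularCharacterFun_mul_inv μ (measurable_lintegral_fibre hf)]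
  refine lintegral_congr fun x => ?_
  simp only [MackeyGroup.mk_inv, MackeyGroup.base_mk]
  rw [lintegral_const_mul' _ _ ENNReal.coe_ne_top]
  congr 1
  have h1 := lintegral_inv_eq_self (μ := haarT)
    (fun τ => f (MackeyGroup.mk c x⁻¹ (τ * c x⁻¹ x)))
  have h2 := lintegral_mul_right_eq_self (μ := haarT)
    (fun τ => f (MackeyGroup.mk c x⁻¹ τ)) (c x⁻¹ x)
  rw [h1, h2]

theorem quasiMeasurePreserving_mackey_inv [IsTopologicalGroup G]
    [LocallyCompactSpace G] [BorelSpace G] [μ.IsHaarMeasure] [μ.Regular] :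
    Measure.QuasiMeasurePreserving (fun z : MackeyGroup c => z⁻¹) (mackeyMeasure c μ)
      (mackeyMeasure c μ) := by
  refine ⟨measurable_inv, Measure.AbsolutelyContinuous.mk fun s hs h0 => ?_⟩
  rw [Measure.map_apply measurable_inv hs]
  have hi : Measurable (s.indicator (1 : MackeyGroup c → ℝ≥0∞)) := measurable_one.indicator hs
  have h := lintegral_modularCharacterFun_mul_mackey_inv (c := c) (μ := μ) hi
  have hm : Measurable fun z : MackeyGroup c =>
      (Measure.modularCharacterFun z.base : ℝ≥0∞) * s.indicator 1 z⁻¹ :=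
    (measurable_coe_modularCharacterFun.comp MackeyGroup.measurable_base).mul
      (hi.comp measurable_inv)
  rw [lintegral_indicator_one hs, h0, lintegral_eq_zero_iff hm] at h
  rw [measure_eq_zero_iff_ae_notMem]
  filter_upwards [h] with z hz hzs
  have hzs' : z⁻¹ ∈ s := hzs
  have := (Measure.modularCharacterFun_pos z.base).ne'
  simp [Set.indicator_of_mem hzs', this] at hz

end MackeyMeasure

/-! ### Homogeneous functions and fibrewise `L^p` norms on the Mackey group -/

theorem eLpNorm_rpow_toReal {X E : Type*} [MeasurableSpace X] [NormedAddCommGroup E]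
    {ρ : Measure X} {p : ℝ≥0∞} (hp : p ≠ 0) (hp' : p ≠ ∞) (f : X → E) :
    eLpNorm f p ρ ^ p.toReal = ∫⁻ x, ‖f x‖ₑ ^ p.toReal ∂ρ := by
  have h : p.toReal ≠ 0 := (ENNReal.toReal_pos hp hp').ne'
  rw [eLpNorm_eq_lintegral_rpow_enorm_toReal hp hp', one_div, ENNReal.rpow_inv_rpow h]

section Homogeneous

variable {G : Type*} [Group G] [TopologicalSpace G] {c : ContinuousTwoCocycle G}

/-- The function `(x, τ) ↦ f(x) τⁿ` on the Mackey group. -/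
def embT (c : ContinuousTwoCocycle G) (n : ℤ) (f : G → ℂ) (z : MackeyGroup c) : ℂ :=
  f z.base * (z.phase : ℂ) ^ n

theorem fourierCoeffT_embT (f : G → ℂ) (n k : ℤ) :
    fourierCoeffT (embT c n f) k = if k = n then f else 0 := by
  funext x
  have h := circleCoeff_trigPoly {n} (fun _ => f x) k
  simp only [trigPoly, Finset.sum_singleton, Finset.mem_singleton, circleCoeff] at h
  refine h.trans ?_
  split_ifs <;> rfl

theorem continuous_embT {f : G → ℂ} (hf : Continuous f) (n : ℤ) : Continuous (embT c n f) :=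
  (hf.comp MackeyGroup.continuous_base).mul
    ((Circle.continuous_coe_zpow n).comp MackeyGroup.continuous_phase)

theorem hasCompactSupport_embT {f : G → ℂ} (hf : HasCompactSupport f) (n : ℤ) :
    HasCompactSupport (embT c n f) := by
  have hK : IsCompact (tsupport f ×ˢ (Set.univ : Set Circle)) := hf.prod isCompact_univ
  have hC : IsClosed (tsupport f ×ˢ (Set.univ : Set Circle)) :=
    (isClosed_tsupport f).prod isClosed_univ
  refine HasCompactSupport.intro' (K := (tsupport f ×ˢ Set.univ : Set (G × Circle))) hK hC ?_
  intro z hz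
  have : z.base ∉ tsupport f := fun h => hz ⟨h, trivial⟩
  rw [embT, image_eq_zero_of_notMem_tsupport this, zero_mul]

end Homogeneous

section Fibres

variable {G : Type*} [Group G] [TopologicalSpace G] [MeasurableSpace G]
  {c : ContinuousTwoCocycle G} {μ : Measure G} {p : ℝ≥0∞} {F : MackeyGroup c → ℂ}

theorem eLpNorm_mackeyMeasure_rpow (hp : p ≠ 0) (hp' : p ≠ ∞)
    (hF : AEStronglyMeasurable F (mackeyMeasure c μ)) :
    eLpNorm F p (mackeyMeasure c μ) ^ p.toReal
      = ∫⁻ x, eLpNorm (fun τ => F (MackeyGroup.mk c x τ)) p haarT ^ p.toReal ∂μ := by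
  rw [eLpNorm_rpow_toReal hp hp', lintegral_mackeyMeasure (hF.enorm.pow_const _)]
  simp_rw [eLpNorm_rpow_toReal hp hp']

theorem aemeasurable_eLpNorm_fibre_rpow (hp : p ≠ 0) (hp' : p ≠ ∞)
    (hF : AEStronglyMeasurable F (mackeyMeasure c μ)) :
    AEMeasurable (fun x => eLpNorm (fun τ => F (MackeyGroup.mk c x τ)) p haarT ^ p.toReal) μ := by
  simp_rw [eLpNorm_rpow_toReal hp hp']
  exact AEMeasurable.lintegral_prod_right' (μ := μ) (ν := haarT)
    (f := fun z : G × Circle => ‖F z‖ₑ ^ p.toReal) (hF.enorm.pow_const _)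

theorem ae_memLp_fibre (hp : p ≠ 0) (hp' : p ≠ ∞) (hF : MemLp F p (mackeyMeasure c μ)) :
    ∀ᵐ x ∂μ, MemLp (fun τ => F (MackeyGroup.mk c x τ)) p haarT := by
  have h0 : 0 < p.toReal := ENNReal.toReal_pos hp hp'
  have h := eLpNorm_mackeyMeasure_rpow hp hp' hF.1
  have hfin := ae_lt_top' (aemeasurable_eLpNorm_fibre_rpow hp hp' hF.1)
    (h ▸ (ENNReal.rpow_lt_top_of_nonneg h0.le hF.2.ne).ne)
  filter_upwards [aestronglyMeasurable_fibre hF.1, hfin] with x hx hx'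
  exact ⟨hx, (ENNReal.rpow_lt_top_iff_of_pos h0).1 hx'⟩

theorem fourierCoeffT_congr_ae {F' : MackeyGroup c → ℂ} (h : F =ᵐ[mackeyMeasure c μ] F') (n : ℤ) :
    fourierCoeffT F n =ᵐ[μ] fourierCoeffT F' n := by
  filter_upwards [ae_fibre_of_ae h] with x hx
  refine integral_congr_ae ?_
  filter_upwards [hx] with τ hτ
  rw [hτ]

theorem measurable_mackey_phase_zpow (n : ℤ) :
    Measurable fun z : MackeyGroup c => (z.phase : ℂ) ^ n :=
  (Circle.continuous_coe_zpow n).measurable.comp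
    (measurable_snd : Measurable (Prod.snd : G × Circle → Circle))

theorem aestronglyMeasurable_fourierCoeffT (hF : AEStronglyMeasurable F (mackeyMeasure c μ))
    (n : ℤ) : AEStronglyMeasurable (fourierCoeffT F n) μ := by
  have h : AEStronglyMeasurable (fun z : MackeyGroup c => F z * (z.phase : ℂ) ^ (-n))
      (mackeyMeasure c μ) := hF.mul (measurable_mackey_phase_zpow (-n)).aestronglyMeasurable
  have := AEStronglyMeasurable.integral_prod_right' (μ := μ) (ν := haarT) h
  refine this.congr (Eventually.of_forall fun x => ?_)
  simp only [fourierCoeffT, Circle.conj_zpow]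
  rfl

theorem eLpNorm_fourierCoeffT_le (hp : 1 ≤ p) (hp' : p ≠ ∞)
    (hF : AEStronglyMeasurable F (mackeyMeasure c μ)) (n : ℤ) :
    eLpNorm (fourierCoeffT F n) p μ ≤ eLpNorm F p (mackeyMeasure c μ) := by
  have hp0 : p ≠ 0 := (zero_lt_one.trans_le hp).ne'
  have h0 : 0 < p.toReal := ENNReal.toReal_pos hp0 hp'
  rw [← ENNReal.rpow_le_rpow_iff h0, eLpNorm_mackeyMeasure_rpow hp0 hp' hF,
    eLpNorm_rpow_toReal hp0 hp']
  refine lintegral_mono_ae ?_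
  filter_upwards [aestronglyMeasurable_fibre hF] with x hx
  exact ENNReal.rpow_le_rpow (norm_circleCoeff_le hx hp n) h0.le

theorem memLp_fourierCoeffT (hp : 1 ≤ p) (hp' : p ≠ ∞) (hF : MemLp F p (mackeyMeasure c μ))
    (n : ℤ) : MemLp (fourierCoeffT F n) p μ :=
  ⟨aestronglyMeasurable_fourierCoeffT hF.1 n,
    (eLpNorm_fourierCoeffT_le hp hp' hF.1 n).trans_lt hF.2⟩

theorem measurePreserving_base :
    MeasurePreserving (MackeyGroup.base : MackeyGroup c → G) (mackeyMeasure c μ) μ :=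
  measurePreserving_fst (μ := μ) (ν := haarT)

theorem aestronglyMeasurable_embT {f : G → ℂ} (hf : AEStronglyMeasurable f μ) (n : ℤ) :
    AEStronglyMeasurable (embT c n f) (mackeyMeasure c μ) :=
  (hf.comp_measurePreserving measurePreserving_base).mul
    (measurable_mackey_phase_zpow n).aestronglyMeasurable

theorem eLpNorm_embT {f : G → ℂ} (hf : AEStronglyMeasurable f μ) (n : ℤ) :
    eLpNorm (embT c n f) p (mackeyMeasure c μ) = eLpNorm f p μ := by
  rw [← eLpNorm_comp_measurePreserving hf (measurePreserving_base (c := c))]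
  refine eLpNorm_congr_norm_ae (Eventually.of_forall fun z => ?_)
  rw [embT, norm_mul, Circle.norm_coe_zpow, mul_one, Function.comp_apply]

theorem memLp_embT {f : G → ℂ} (hf : MemLp f p μ) (n : ℤ) :
    MemLp (embT c n f) p (mackeyMeasure c μ) :=
  ⟨aestronglyMeasurable_embT hf.1 n, (eLpNorm_embT hf.1 n).trans_lt hf.2⟩

theorem embT_congr_ae {f g : G → ℂ} (h : f =ᵐ[μ] g) (n : ℤ) :
    embT c n f =ᵐ[mackeyMeasure c μ] embT c n g := by
  filter_upwards [quasiMeasurePreserving_base.ae_eq_comp h] with z hz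
  simp only [Function.comp_apply] at hz
  rw [embT, embT, hz]

/-! ### Convergence of Fourier series in the circle variable -/

/-- Dominated convergence for the $p$-th powers of the fibre norms, with majorant
$(C+1)^p\|F(x,\cdot)\|_p^p$. Applied to Cesàro means and to partial sums. -/
theorem convergesInLp_of_fibre (hp : 1 ≤ p) (hp' : p ≠ ∞) {T : ℕ → (Circle → ℂ) → Circle → ℂ}
    {C : ℝ≥0∞} (hC : C ≠ ∞)
    (hm : ∀ N f, AEStronglyMeasurable (T N f) haarT)
    (hb : ∀ N f, MemLp f p haarT → eLpNorm (T N f) p haarT ≤ C * eLpNorm f p haarT)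
    (ht : ∀ f, MemLp f p haarT → Tendsto (fun N => eLpNorm (T N f - f) p haarT) atTop (𝓝 0))
    {S : ℕ → MackeyGroup c → ℂ} (hS : ∀ N, AEStronglyMeasurable (S N) (mackeyMeasure c μ))
    (hF : MemLp F p (mackeyMeasure c μ))
    (hST : ∀ᵐ x ∂μ, ∀ N, (fun τ => S N (MackeyGroup.mk c x τ))
      = T N fun τ => F (MackeyGroup.mk c x τ)) :
    ConvergesInLp μ p S F := by
  have hp0 : p ≠ 0 := (zero_lt_one.trans_le hp).ne'
  have h0 : 0 < p.toReal := ENNReal.toReal_pos hp0 hp'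
  have hfib : ∀ᵐ x ∂μ, Tendsto (fun N => eLpNorm
      (fun τ => S N (MackeyGroup.mk c x τ) - F (MackeyGroup.mk c x τ)) p haarT) atTop (𝓝 0) := by
    filter_upwards [hST, ae_memLp_fibre hp0 hp' hF] with x hx hxF
    refine (ht _ hxF).congr fun N => ?_
    rw [← hx N]
    rfl
  refine ⟨?_, hfib⟩
  have hmS : ∀ N, AEStronglyMeasurable (fun z => S N z - F z) (mackeyMeasure c μ) :=
    fun N => (hS N).sub hF.1
  have hlim : Tendsto (fun N => eLpNorm (fun z => S N z - F z) p (mackeyMeasure c μ) ^ p.toReal)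
      atTop (𝓝 0) := by
    have hz : ∫⁻ _ : G, (0 : ℝ≥0∞) ∂μ = 0 := lintegral_zero
    rw [tendsto_congr fun N => eLpNorm_mackeyMeasure_rpow hp0 hp' (hmS N), ← hz]
    refine tendsto_lintegral_of_dominated_convergence'
      (fun x => (C + 1) ^ p.toReal *
        eLpNorm (fun τ => F (MackeyGroup.mk c x τ)) p haarT ^ p.toReal)
      (fun N => aemeasurable_eLpNorm_fibre_rpow (F := fun z => S N z - F z) hp0 hp' (hmS N))
      ?_ ?_ ?_
    · intro N
      filter_upwards [hST, ae_memLp_fibre hp0 hp' hF] with x hx hxF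
      rw [← ENNReal.mul_rpow_of_nonneg _ _ h0.le]
      refine ENNReal.rpow_le_rpow ?_ h0.le
      have hx' := hx N
      rw [show (fun τ => S N (MackeyGroup.mk c x τ) - F (MackeyGroup.mk c x τ))
        = (fun τ => S N (MackeyGroup.mk c x τ)) - fun τ => F (MackeyGroup.mk c x τ) from rfl, hx',
        add_mul, one_mul]
      exact (eLpNorm_sub_le (hm N _) hxF.1 hp).trans (add_le_add (hb N _ hxF) le_rfl)
    · rw [lintegral_const_mul' _ _ (ENNReal.rpow_ne_top_of_nonneg h0.le (by finiteness)),
        ← eLpNorm_mackeyMeasure_rpow hp0 hp' hF.1]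
      exact ENNReal.mul_ne_top (ENNReal.rpow_ne_top_of_nonneg h0.le (by finiteness))
        (ENNReal.rpow_ne_top_of_nonneg h0.le hF.2.ne)
    · filter_upwards [hfib] with x hx
      have := (ENNReal.continuous_rpow_const (y := p.toReal)).tendsto 0 |>.comp hx
      rwa [ENNReal.zero_rpow_of_pos h0] at this
  have h := (ENNReal.continuous_rpow_const (y := p.toReal⁻¹)).tendsto 0 |>.comp hlim
  rw [ENNReal.zero_rpow_of_pos (inv_pos.2 h0)] at h
  refine h.congr fun N => ?_
  rw [Function.comp_apply, ENNReal.rpow_rpow_inv h0.ne']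

theorem aestronglyMeasurable_trigPartialSum {a : ℤ → G → ℂ}
    (ha : ∀ n, AEStronglyMeasurable (a n) μ) (N : ℕ) :
    AEStronglyMeasurable (trigPartialSum c a N) (mackeyMeasure c μ) := by
  have h : trigPartialSum c a N = fun z => ∑ n ∈ Finset.Icc (-(N : ℤ)) N, embT c n (a n) z := rfl
  rw [h]
  exact Finset.aestronglyMeasurable_fun_sum _ fun n _ => aestronglyMeasurable_embT (ha n) n

theorem aestronglyMeasurable_trigCesaroMean {a : ℤ → G → ℂ}
    (ha : ∀ n, AEStronglyMeasurable (a n) μ) (N : ℕ) :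
    AEStronglyMeasurable (trigCesaroMean c a N) (mackeyMeasure c μ) :=
  (Finset.aestronglyMeasurable_fun_sum _ fun k _ =>
    aestronglyMeasurable_trigPartialSum ha k).const_mul _

theorem convergesInLp_trigCesaroMean (hp : 1 ≤ p) (hp' : p ≠ ∞)
    (hF : MemLp F p (mackeyMeasure c μ)) {a : ℤ → G → ℂ} (ha : ∀ n, fourierCoeffT F n =ᵐ[μ] a n) :
    ConvergesInLp μ p (trigCesaroMean c a) F := by
  have hm : ∀ n, AEStronglyMeasurable (a n) μ := fun n =>
    (aestronglyMeasurable_fourierCoeffT hF.1 n).congr (ha n)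
  refine convergesInLp_of_fibre hp hp' (T := fun N f => circleCesaro f N) (C := 1)
    ENNReal.one_ne_top ?_ ?_ (fun f hf => tendsto_circleCesaro hp hp' hf)
    (aestronglyMeasurable_trigCesaroMean hm) hF ?_
  · intro N f
    rw [circleCesaro_eq]
    exact (continuous_trigPoly _ _).aestronglyMeasurable
  · intro N f hf
    rw [one_mul]
    exact eLpNorm_circleCesaro_le hp hp' hf N
  · filter_upwards [ae_all_iff.2 ha] with x hx N
    funext τ
    simp only [trigCesaroMean, trigPartialSum, circleCesaro, circlePartial, trigPoly,
      MackeyGroup.base_mk, MackeyGroup.phase_mk, ← hx]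
    rfl

theorem convergesInLp_trigPartialSum (hp : 1 < p) (hp' : p ≠ ∞)
    (hF : MemLp F p (mackeyMeasure c μ)) {a : ℤ → G → ℂ} (ha : ∀ n, fourierCoeffT F n =ᵐ[μ] a n) :
    ConvergesInLp μ p (trigPartialSum c a) F := by
  have hm : ∀ n, AEStronglyMeasurable (a n) μ := fun n =>
    (aestronglyMeasurable_fourierCoeffT hF.1 n).congr (ha n)
  obtain ⟨C, hC, hb⟩ := exists_eLpNorm_circlePartial_le hp hp'
  refine convergesInLp_of_fibre hp.le hp' (T := fun N f => circlePartial f N) hC ?_ hb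
    (fun f hf => tendsto_circlePartial hp hp' hf) (aestronglyMeasurable_trigPartialSum hm) hF ?_
  · intro N f
    exact (continuous_trigPoly _ _).aestronglyMeasurable
  · filter_upwards [ae_all_iff.2 ha] with x hx N
    funext τ
    simp only [trigPartialSum, circlePartial, trigPoly,
      MackeyGroup.base_mk, MackeyGroup.phase_mk, ← hx]
    rfl

/-- All Cesàro means vanish, and they converge to $F$. -/
theorem ae_eq_zero_of_fourierCoeffT (hp : 1 ≤ p) (hp' : p ≠ ∞)
    (hF : MemLp F p (mackeyMeasure c μ)) (h : ∀ n, fourierCoeffT F n =ᵐ[μ] 0) :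
    F =ᵐ[mackeyMeasure c μ] 0 := by
  have ht := (convergesInLp_trigCesaroMean hp hp' hF (a := fun _ => 0) h).1
  have h1 : ∀ N, (fun z => trigCesaroMean c (fun _ => 0) N z - F z) = -F := by
    intro N
    funext z
    simp [trigCesaroMean, trigPartialSum]
  simp_rw [h1, eLpNorm_neg] at ht
  have h0 := tendsto_nhds_unique tendsto_const_nhds ht
  exact (eLpNorm_eq_zero_iff hF.1 (zero_lt_one.trans_le hp).ne').1 h0

/-- Regularity of the product measure is avoided. A Cesàro mean of $F$ is a finite sum $\sum
a_n(x)\tau^n$ with $a_n\in L^p(G)$; each $a_n$ is approximated on $G$, within $\varepsilon/2$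
divided by the number of terms. -/
theorem ccDense_mackeyMeasure [IsTopologicalGroup G] [BorelSpace G] (hp : 1 ≤ p) (hp' : p ≠ ∞)
    (hd : CcDense μ p) : CcDense (mackeyMeasure c μ) p := by
  intro F hF ε hε
  have hε2 : ε / 2 ≠ 0 := by simpa using hε
  obtain ⟨N, hN⟩ := ((tendsto_order.1
    (convergesInLp_trigCesaroMean hp hp' hF fun n => ae_eq_refl (fourierCoeffT F n)).1).2 (ε / 2)
      (pos_iff_ne_zero.2 hε2)).exists
  set s := Finset.Icc (-(N : ℤ)) N with hs
  have hδ : ε / 2 / s.card ≠ 0 := ENNReal.div_ne_zero.2 ⟨hε2, ENNReal.natCast_ne_top _⟩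
  let a : ℤ → G → ℂ := fun n => (fejerWeight N n : ℂ) • fourierCoeffT F n
  have ha : ∀ n, MemLp (a n) p μ := fun n => (memLp_fourierCoeffT hp hp' hF n).const_smul _
  choose g hgc hgs hg using fun n => hd (a n) (ha n) _ hδ
  have hgm : ∀ n, AEStronglyMeasurable (g n) μ := fun n =>
    (hgc n).aestronglyMeasurable
  have hC : trigCesaroMean c (fourierCoeffT F) N = ∑ n ∈ s, embT c n (a n) := by
    funext z
    rw [Finset.sum_apply]
    exact cesaro_trigPoly (fun n => fourierCoeffT F n z.base) N z.phase
  have hsub : trigCesaroMean c (fourierCoeffT F) N - ∑ n ∈ s, embT c n (g n)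
      = ∑ n ∈ s, embT c n (a n - g n) := by
    rw [hC, ← Finset.sum_sub_distrib]
    refine Finset.sum_congr rfl fun n _ => ?_
    funext z
    simp [embT, sub_mul]
  have hmS : AEStronglyMeasurable (trigCesaroMean c (fourierCoeffT F) N) (mackeyMeasure c μ) :=
    aestronglyMeasurable_trigCesaroMean (aestronglyMeasurable_fourierCoeffT hF.1) N
  have hmg : ∀ n, AEStronglyMeasurable (embT c n (a n - g n)) (mackeyMeasure c μ) := fun n =>
    aestronglyMeasurable_embT ((ha n).1.sub (hgm n)) n
  refine ⟨∑ n ∈ s, embT c n (g n), ?_, ?_, ?_⟩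
  · rw [Finset.sum_fn]
    exact continuous_finsetSum _ fun n _ => continuous_embT (hgc n) n
  · exact Finset.sum_induction _ (fun f => HasCompactSupport f) (fun _ _ h h' => h.add h')
      HasCompactSupport.zero fun n _ => hasCompactSupport_embT (hgs n) n
  · have e : F - ∑ n ∈ s, embT c n (g n)
        = (F - trigCesaroMean c (fourierCoeffT F) N) + ∑ n ∈ s, embT c n (a n - g n) := by
      rw [← hsub]; abel
    rw [e, ← ENNReal.add_halves ε]
    refine (eLpNorm_add_le (hF.1.sub hmS) (Finset.aestronglyMeasurable_sum _ fun n _ => hmg n)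
      hp).trans (add_le_add ?_ ?_)
    · rw [eLpNorm_sub_comm]
      exact hN.le
    · refine (eLpNorm_sum_le (fun n _ => hmg n) hp).trans ?_
      refine (Finset.sum_le_card_nsmul s _ (ε / 2 / s.card) fun n _ => ?_).trans ?_
      · rw [eLpNorm_embT ((ha n).1.sub (hgm n))]
        exact hg n
      · rw [nsmul_eq_mul]
        exact ENNReal.mul_div_le

end Fibres

/-! ### Convolution of homogeneous functions -/

section Homogeneous

variable {G : Type*} [Group G] [TopologicalSpace G] {c : ContinuousTwoCocycle G}

/-- The cocycle identity at $(y,y^{-1},x)$. -/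
theorem ContinuousTwoCocycle.apply_inv_mul (c : ContinuousTwoCocycle G) (x y : G) :
    c y (y⁻¹ * x) = c y⁻¹ y * (c y⁻¹ x)⁻¹ := by
  have h := c.cocycle y y⁻¹ x
  rw [mul_inv_cancel, c.map_one_left, mul_one, c.map_inv_self] at h
  rw [h, mul_inv_cancel_right]

/-- The source of the twist $c^n$: the phase of $w^{-1}z$ is $\bar\sigma\tau\,c(y,y^{-1}x)$ for
$w=(y,\sigma)$ and $z=(x,\tau)$, and $\sigma^n$ cancels. -/
theorem embT_mul_embT (f g : G → ℂ) (n : ℤ) (z w : MackeyGroup c) :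
    embT c n f w * embT c n g (w⁻¹ * z)
      = twistedIntegrand (c ^ n) f g z.base w.base * (z.phase : ℂ) ^ n := by
  have hph : (w⁻¹ * z).phase = w.phase⁻¹ * z.phase * c w.base (w.base⁻¹ * z.base) := by
    rw [ContinuousTwoCocycle.apply_inv_mul]
    change w.phase⁻¹ * c w.base⁻¹ w.base * z.phase * (c w.base⁻¹ z.base)⁻¹ = _
    ac_rfl
  have hw := Circle.coe_ne_zero w.phase
  rw [embT, embT, hph, MackeyGroup.base_mul, MackeyGroup.base_inv, twistedIntegrand,
    ContinuousTwoCocycle.zpow_apply]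
  push_cast
  rw [mul_zpow, mul_zpow, inv_zpow]
  field_simp

variable [IsTopologicalGroup G] [LocallyCompactSpace G] [MeasurableSpace G] [BorelSpace G]
  {μ : Measure G} [μ.IsHaarMeasure] [μ.Regular] {p : ℝ≥0∞}

theorem isConvMeasure_mackeyMeasure : IsConvMeasure (mackeyMeasure c μ) where
  finite := inferInstance
  leftInvariant := inferInstance
  inv := quasiMeasurePreserving_mackey_inv
  dense := fun _ hp hp' => ccDense_mackeyMeasure hp hp' (ccDense_of_regular μ hp')

theorem aestronglyMeasurable_twistedIntegrand (c : ContinuousTwoCocycle G) {f g : G → ℂ}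
    (hf : AEStronglyMeasurable f μ) (hg : AEStronglyMeasurable g μ) (x : G) :
    AEStronglyMeasurable (twistedIntegrand c f g x) μ := by
  have h1 : AEStronglyMeasurable (fun y => g (y⁻¹ * x)) μ :=
    hg.comp_quasiMeasurePreserving
      (quasiMeasurePreserving_inv_mul (quasiMeasurePreserving_inv_of_regular μ) x)
  have h2 : Continuous fun y => (c y (y⁻¹ * x) : ℂ) :=
    continuous_subtype_val.comp (c.continuous_toFun.comp
      (continuous_id.prodMk (continuous_inv.mul continuous_const)))
  exact (hf.mul h1).mul h2.aestronglyMeasurable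

/-- The integrand does not depend on the phase of $w$, so the integral descends to $G$ along the
measure preserving projection. -/
theorem groupConv_embT {f g : G → ℂ} (hf : AEStronglyMeasurable f μ)
    (hg : AEStronglyMeasurable g μ) (n : ℤ) :
    groupConv (mackeyMeasure c μ) (embT c n f) (embT c n g)
      = embT c n (twistedConv (c ^ n) μ f g) := by
  funext z
  simp only [groupConv, embT_mul_embT]
  rw [integral_mul_const, embT, twistedConv]
  congr 1
  have h := integral_map (μ := mackeyMeasure c μ) MackeyGroup.measurable_base.aemeasurable
    (f := twistedIntegrand (c ^ n) f g z.base)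
    (by
      rw [measurePreserving_base.map_eq]
      exact aestronglyMeasurable_twistedIntegrand _ hf hg _)
  rw [measurePreserving_base.map_eq] at h
  exact h.symm

/-- Read off from the convolution of the homogeneous extensions on $G_c$, at a single phase of
almost every fibre. -/
theorem ae_integrable_twistedIntegrand (hp : 1 ≤ p) (hp' : p ≠ ∞) {f g : G → ℂ}
    (hf : MemLp f 1 μ) (hg : MemLp g p μ) (n : ℤ) :
    ∀ᵐ x ∂μ, Integrable (twistedIntegrand (c ^ n) f g x) μ := by
  have h := isConvMeasure_mackeyMeasure.ae_integrable hp hp' (memLp_embT (c := c) hf n)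
    (memLp_embT (c := c) hg n)
  filter_upwards [ae_fibre_of_ae h] with x hx
  obtain ⟨τ, hτ⟩ := hx.exists
  simp only [embT_mul_embT] at hτ
  have h0 : (((MackeyGroup.mk c x τ).phase : ℂ)) ^ n ≠ 0 := zpow_ne_zero _ (Circle.coe_ne_zero _)
  rw [integrable_mul_const_iff (IsUnit.mk0 _ h0)] at hτ
  exact (measurePreserving_base.integrable_comp
    (aestronglyMeasurable_twistedIntegrand _ hf.1 hg.1 _)).1 hτ

theorem memLp_twistedConv (hp : 1 ≤ p) (hp' : p ≠ ∞) {f g : G → ℂ}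
    (hf : MemLp f 1 μ) (hg : MemLp g p μ) (n : ℤ) :
    MemLp (twistedConv (c ^ n) μ f g) p μ := by
  have h := isConvMeasure_mackeyMeasure.memLp_groupConv hp hp' (memLp_embT (c := c) hf n)
    (memLp_embT (c := c) hg n)
  rw [groupConv_embT hf.1 hg.1] at h
  have h' := memLp_fourierCoeffT hp hp' h n
  rwa [fourierCoeffT_embT, if_pos rfl] at h'

end Homogeneous

/-! ### Projection to the homogeneous functions -/

section Projection

variable {G : Type*} [Group G] [TopologicalSpace G] {c : ContinuousTwoCocycle G}

theorem MackeyGroup.mk_one_mul (ρ : Circle) (z : MackeyGroup c) :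
    mk c 1 ρ * z = mk c z.base (ρ * z.phase) := by
  change mk c (1 * z.base) (ρ * z.phase * (c 1 z.base)⁻¹) = _
  rw [one_mul, c.map_one_left, inv_one, mul_one]

theorem MackeyGroup.mul_mk_one (ρ : Circle) (z : MackeyGroup c) :
    z * mk c 1 ρ = mk c 1 ρ * z := by
  rw [mk_one_mul]
  change mk c (z.base * 1) (z.phase * ρ * (c z.base 1)⁻¹) = _
  rw [mul_one, c.map_one_right, inv_one, mul_one, mul_comm]

theorem fourierCoeffT_smul (r : ℂ) (F : MackeyGroup c → ℂ) (n : ℤ) :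
    fourierCoeffT (r • F) n = r • fourierCoeffT F n := by
  funext x
  exact circleCoeff_const_mul r _ n

theorem embT_add (n : ℤ) (f g : G → ℂ) : embT c n (f + g) = embT c n f + embT c n g := by
  funext z
  simp [embT, add_mul]

theorem embT_smul (n : ℤ) (r : ℂ) (f : G → ℂ) : embT c n (r • f) = r • embT c n f := by
  funext z
  simp [embT, mul_assoc]

/-- The `n`-th homogeneous component of a function on the Mackey group. -/
def projT (n : ℤ) (F : MackeyGroup c → ℂ) : MackeyGroup c → ℂ := embT c n (fourierCoeffT F n)

/-- The homogeneous component as an average over central translations, the form in which it visibly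
commutes with convolution. -/
theorem projT_apply (n : ℤ) (F : MackeyGroup c → ℂ) (z : MackeyGroup c) :
    projT n F z
      = ∫ ρ : Circle, F (MackeyGroup.mk c 1 ρ * z) * (starRingEnd ℂ (ρ : ℂ)) ^ n ∂haarT := by
  simp only [MackeyGroup.mk_one_mul, Circle.conj_zpow]
  have h := integral_mul_right_eq_self (μ := haarT) (fun ρ : Circle =>
    F (MackeyGroup.mk c z.base ρ) * ((ρ * z.phase⁻¹ : Circle) : ℂ) ^ (-n)) z.phase
  simp only [mul_inv_cancel_right] at h
  rw [h, projT, embT, fourierCoeffT, ← integral_mul_const]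
  refine integral_congr_ae (Eventually.of_forall fun ρ => ?_)
  simp only [Circle.conj_zpow, Circle.coe_mul, Circle.coe_inv, mul_zpow, inv_zpow, zpow_neg,
    mul_inv, inv_inv, mul_assoc]

theorem projT_projT (n : ℤ) (F : MackeyGroup c → ℂ) : projT n (projT n F) = projT n F := by
  rw [projT, projT, fourierCoeffT_embT, if_pos rfl]

variable [IsTopologicalGroup G] [MeasurableSpace G] [BorelSpace G] {μ : Measure G}
  [IsFiniteMeasureOnCompacts μ]

/-- Since $(1,\rho)$ is central, $w^{-1}(1,\rho)z=(1,\rho)w^{-1}z$. Compactness of the circle and of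
supp $F$ justifies Fubini. -/
theorem projT_groupConv_right {F H : MackeyGroup c → ℂ} (hF : Continuous F)
    (hFs : HasCompactSupport F) (hH : Continuous H) (n : ℤ) :
    projT n (groupConv (mackeyMeasure c μ) F H) = groupConv (mackeyMeasure c μ) F (projT n H) := by
  funext z
  have hmk : Continuous fun q : Circle × MackeyGroup c => MackeyGroup.mk c 1 q.1 :=
    MackeyGroup.continuous_mk continuous_const continuous_fst
  have hcont : Continuous (Function.uncurry fun (ρ : Circle) (w : MackeyGroup c) =>
      F w * H (MackeyGroup.mk c 1 ρ * (w⁻¹ * z)) * (starRingEnd ℂ (ρ : ℂ)) ^ n) := by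
    simp only [Circle.conj_zpow]
    exact ((hF.comp continuous_snd).mul (hH.comp (hmk.mul
      (continuous_snd.inv.mul continuous_const)))).mul
      ((Circle.continuous_coe_zpow (-n)).comp continuous_fst)
  have hsupp : HasCompactSupport (Function.uncurry fun (ρ : Circle) (w : MackeyGroup c) =>
      F w * H (MackeyGroup.mk c 1 ρ * (w⁻¹ * z)) * (starRingEnd ℂ (ρ : ℂ)) ^ n) := by
    refine HasCompactSupport.intro' (K := (Set.univ : Set Circle) ×ˢ tsupport F)
      (isCompact_univ.prod hFs) (isClosed_univ.prod (isClosed_tsupport F)) ?_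
    rintro ⟨ρ, w⟩ hw
    have : w ∉ tsupport F := fun h => hw ⟨trivial, h⟩
    simp [image_eq_zero_of_notMem_tsupport this]
  have hswap := integral_integral_swap_of_hasCompactSupport hcont hsupp (μ := haarT)
    (ν := mackeyMeasure c μ)
  rw [projT_apply]
  simp only [groupConv, projT_apply, ← integral_const_mul, ← integral_mul_const]
  simp only [← mul_assoc] at hswap ⊢
  simp only [← MackeyGroup.mul_mk_one, mul_assoc] at hswap ⊢
  exact hswap

/-- Left invariance, with $w$ replaced by $(1,\rho)w$, moves the translation onto $F$; the support
in $w$ is compact because $w^{-1}z$ must lie in supp $H$. -/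
theorem projT_groupConv_left [μ.IsMulLeftInvariant] {F H : MackeyGroup c → ℂ} (hF : Continuous F)
    (hH : Continuous H) (hHs : HasCompactSupport H) (n : ℤ) :
    projT n (groupConv (mackeyMeasure c μ) F H) = groupConv (mackeyMeasure c μ) (projT n F) H := by
  funext z
  have hmk : Continuous fun q : Circle × MackeyGroup c => MackeyGroup.mk c 1 q.1 :=
    MackeyGroup.continuous_mk continuous_const continuous_fst
  have hcont : Continuous (Function.uncurry fun (ρ : Circle) (w : MackeyGroup c) =>
      F (MackeyGroup.mk c 1 ρ * w) * H (w⁻¹ * z) * (starRingEnd ℂ (ρ : ℂ)) ^ n) := by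
    simp only [Circle.conj_zpow]
    exact ((hF.comp (hmk.mul continuous_snd)).mul (hH.comp
      (continuous_snd.inv.mul continuous_const))).mul
      ((Circle.continuous_coe_zpow (-n)).comp continuous_fst)
  have hsupp : HasCompactSupport (Function.uncurry fun (ρ : Circle) (w : MackeyGroup c) =>
      F (MackeyGroup.mk c 1 ρ * w) * H (w⁻¹ * z) * (starRingEnd ℂ (ρ : ℂ)) ^ n) := by
    have hK : IsCompact ((fun v : MackeyGroup c => z * v⁻¹) '' tsupport H) :=
      IsCompact.image hHs (by fun_prop)
    refine HasCompactSupport.intro' (isCompact_univ.prod hK.closure)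
      (isClosed_univ.prod isClosed_closure) ?_
    rintro ⟨ρ, w⟩ hw
    have : w⁻¹ * z ∉ tsupport H := fun h =>
      hw ⟨trivial, subset_closure ⟨w⁻¹ * z, h, by simp⟩⟩
    simp [image_eq_zero_of_notMem_tsupport this]
  have hswap := integral_integral_swap_of_hasCompactSupport hcont hsupp (μ := haarT)
    (ν := mackeyMeasure c μ)
  have htrans : ∀ ρ : Circle, groupConv (mackeyMeasure c μ) F H (MackeyGroup.mk c 1 ρ * z)
      = ∫ w, F (MackeyGroup.mk c 1 ρ * w) * H (w⁻¹ * z) ∂mackeyMeasure c μ := by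
    intro ρ
    have h := integral_mul_left_eq_self (μ := mackeyMeasure c μ)
      (fun w => F w * H (w⁻¹ * (MackeyGroup.mk c 1 ρ * z))) (MackeyGroup.mk c 1 ρ)
    rw [groupConv, ← h]
    simp [mul_assoc]
  rw [projT_apply]
  simp only [htrans]
  simp only [groupConv, projT_apply, ← integral_mul_const]
  rw [hswap]
  refine integral_congr_ae (Eventually.of_forall fun w => ?_)
  refine integral_congr_ae (Eventually.of_forall fun ρ => ?_)
  ring

end Projection

/-! ### The projections on $L^p$ and the Fourier coefficients of a convolution -/

section ProjectionLp

variable {G : Type*} [Group G] [TopologicalSpace G] [MeasurableSpace G]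
  {c : ContinuousTwoCocycle G} {μ : Measure G} {p : ℝ≥0∞} {F H : MackeyGroup c → ℂ}

theorem fourierCoeffT_add_ae (hp : 1 ≤ p) (hp' : p ≠ ∞) (hF : MemLp F p (mackeyMeasure c μ))
    (hH : MemLp H p (mackeyMeasure c μ)) (n : ℤ) :
    fourierCoeffT (F + H) n =ᵐ[μ] fourierCoeffT F n + fourierCoeffT H n := by
  have hp0 : p ≠ 0 := (zero_lt_one.trans_le hp).ne'
  filter_upwards [ae_memLp_fibre hp0 hp' hF, ae_memLp_fibre hp0 hp' hH] with x h1 h2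
  exact circleCoeff_add (h1.integrable hp) (h2.integrable hp) n

theorem projT_congr_ae (h : F =ᵐ[mackeyMeasure c μ] H) (n : ℤ) :
    projT n F =ᵐ[mackeyMeasure c μ] projT n H :=
  embT_congr_ae (fourierCoeffT_congr_ae h n) n

theorem memLp_projT (hp : 1 ≤ p) (hp' : p ≠ ∞) (hF : MemLp F p (mackeyMeasure c μ)) (n : ℤ) :
    MemLp (projT n F) p (mackeyMeasure c μ) :=
  memLp_embT (memLp_fourierCoeffT hp hp' hF n) n

variable (c μ p) in
/-- The `n`-th Fourier coefficient as a continuous linear map `L^p(G_c) → L^p(G)`. -/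
def coeffL [hp : Fact (1 ≤ p)] (hp' : p ≠ ∞) (n : ℤ) :
    Lp ℂ p (mackeyMeasure c μ) →L[ℂ] Lp ℂ p μ :=
  LinearMap.mkContinuous
    { toFun := fun F => (memLp_fourierCoeffT hp.out hp' (Lp.memLp F) n).toLp _
      map_add' := fun F H => by
        rw [← MemLp.toLp_add, MemLp.toLp_eq_toLp_iff]
        exact (fourierCoeffT_congr_ae (Lp.coeFn_add F H) n).trans
          (fourierCoeffT_add_ae hp.out hp' (Lp.memLp F) (Lp.memLp H) n)
      map_smul' := fun r F => by
        rw [RingHom.id_apply, ← MemLp.toLp_const_smul, MemLp.toLp_eq_toLp_iff]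
        rw [← fourierCoeffT_smul]
        exact fourierCoeffT_congr_ae (Lp.coeFn_smul r F) n } 1 fun F => by
    rw [one_mul]
    simp only [LinearMap.coe_mk, AddHom.coe_mk]
    rw [Lp.norm_toLp, Lp.norm_def]
    exact ENNReal.toReal_mono (Lp.eLpNorm_ne_top F)
      (eLpNorm_fourierCoeffT_le hp.out hp' (Lp.aestronglyMeasurable F) n)

theorem coeFn_coeffL [hp : Fact (1 ≤ p)] (hp' : p ≠ ∞) (n : ℤ) (F : Lp ℂ p (mackeyMeasure c μ)) :
    coeffL c μ p hp' n F =ᵐ[μ] fourierCoeffT F n :=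
  (memLp_fourierCoeffT hp.out hp' (Lp.memLp F) n).coeFn_toLp

variable (c μ p) in
/-- The isometry `f ↦ f(x) τⁿ` of `L^p(G)` into `L^p(G_c)`. -/
def embL [Fact (1 ≤ p)] (n : ℤ) : Lp ℂ p μ →ₗᵢ[ℂ] Lp ℂ p (mackeyMeasure c μ) where
  toFun f := (memLp_embT (Lp.memLp f) n).toLp _
  map_add' f g := by
    rw [← MemLp.toLp_add, MemLp.toLp_eq_toLp_iff, ← embT_add]
    exact embT_congr_ae (Lp.coeFn_add f g) n
  map_smul' r f := by
    rw [RingHom.id_apply, ← MemLp.toLp_const_smul, MemLp.toLp_eq_toLp_iff, ← embT_smul]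
    exact embT_congr_ae (Lp.coeFn_smul r f) n
  norm_map' f := by
    simp only [LinearMap.coe_mk, AddHom.coe_mk]
    rw [Lp.norm_toLp, Lp.norm_def, eLpNorm_embT (Lp.aestronglyMeasurable f)]

theorem coeFn_embL [Fact (1 ≤ p)] (n : ℤ) (f : Lp ℂ p μ) :
    embL c μ p n f =ᵐ[mackeyMeasure c μ] embT c n f :=
  (memLp_embT (Lp.memLp f) n).coeFn_toLp

variable (c μ p) in
/-- The projection of `L^p(G_c)` to the homogeneous functions of degree `n`. -/
def projL [hp : Fact (1 ≤ p)] (hp' : p ≠ ∞) (n : ℤ) :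
    Lp ℂ p (mackeyMeasure c μ) →L[ℂ] Lp ℂ p (mackeyMeasure c μ) :=
  (embL c μ p n).toContinuousLinearMap.comp (coeffL c μ p hp' n)

theorem coeFn_projL [hp : Fact (1 ≤ p)] (hp' : p ≠ ∞) (n : ℤ) (F : Lp ℂ p (mackeyMeasure c μ)) :
    projL c μ p hp' n F =ᵐ[mackeyMeasure c μ] projT n F :=
  (coeFn_embL n _).trans (embT_congr_ae (coeFn_coeffL hp' n F) n)

theorem projL_projL [hp : Fact (1 ≤ p)] (hp' : p ≠ ∞) (n : ℤ) (F : Lp ℂ p (mackeyMeasure c μ)) :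
    projL c μ p hp' n (projL c μ p hp' n F) = projL c μ p hp' n F := by
  refine Lp.ext (((coeFn_projL hp' n _).trans (projT_congr_ae (coeFn_projL hp' n F) n)).trans ?_)
  rw [projT_projT]
  exact (coeFn_projL hp' n F).symm

variable [IsTopologicalGroup G] [LocallyCompactSpace G] [BorelSpace G] [μ.IsHaarMeasure]
  [μ.Regular]

/-- All maps are continuous, so density in $F$ and then in $H$ reduces both identities to continuous
functions with compact support. -/
theorem projL_convL_and [hp : Fact (1 ≤ p)] (hp' : p ≠ ∞) (n : ℤ)
    (F : Lp ℂ 1 (mackeyMeasure c μ)) (H : Lp ℂ p (mackeyMeasure c μ)) :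
    projL c μ p hp' n (isConvMeasure_mackeyMeasure.convL p hp' F H)
        = isConvMeasure_mackeyMeasure.convL p hp' (projL c μ 1 ENNReal.one_ne_top n F) H ∧
      projL c μ p hp' n (isConvMeasure_mackeyMeasure.convL p hp' F H)
        = isConvMeasure_mackeyMeasure.convL p hp' F (projL c μ p hp' n H) := by
  have hν : IsConvMeasure (mackeyMeasure c μ) := isConvMeasure_mackeyMeasure
  have hd1 := (hν.dense 1 le_rfl ENNReal.one_ne_top).denseRange_ccToLp
  have hdp := (hν.dense p hp.out hp').denseRange_ccToLp
  let P : Lp ℂ 1 (mackeyMeasure c μ) → Lp ℂ p (mackeyMeasure c μ) → Prop := fun F H =>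
    projL c μ p hp' n (hν.convL p hp' F H)
        = hν.convL p hp' (projL c μ 1 ENNReal.one_ne_top n F) H ∧
      projL c μ p hp' n (hν.convL p hp' F H) = hν.convL p hp' F (projL c μ p hp' n H)
  refine hd1.induction_on (p := fun F => P F H) F ?_ fun f => ?_
  · exact (isClosed_eq (by fun_prop) (by fun_prop)).inter (isClosed_eq (by fun_prop) (by fun_prop))
  refine hdp.induction_on (p := fun H => P _ H) H ?_ fun h => ?_
  · exact (isClosed_eq (by fun_prop) (by fun_prop)).inter (isClosed_eq (by fun_prop) (by fun_prop))
  obtain ⟨f, hf⟩ := f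
  obtain ⟨h, hh⟩ := h
  have hf' : ccToLp (mackeyMeasure c μ) 1 ⟨f, hf⟩ =ᵐ[mackeyMeasure c μ] f := MemLp.coeFn_toLp _
  have hh' : ccToLp (mackeyMeasure c μ) p ⟨h, hh⟩ =ᵐ[mackeyMeasure c μ] h := MemLp.coeFn_toLp _
  have e := (coeFn_projL hp' n (hν.convL p hp' (ccToLp (mackeyMeasure c μ) 1 ⟨f, hf⟩)
    (ccToLp (mackeyMeasure c μ) p ⟨h, hh⟩))).trans (projT_congr_ae (hν.coeFn_convL hp' _ _) n)
  rw [groupConv_congr_ae hν.inv hf' hh'] at e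
  constructor
  · refine Lp.ext (e.trans (EventuallyEq.trans (EventuallyEq.of_eq ?_)
      (hν.coeFn_convL hp' _ _).symm))
    rw [groupConv_congr_ae hν.inv ((coeFn_projL _ n _).trans (projT_congr_ae hf' n)) hh']
    exact projT_groupConv_left hf.1 hh.1 hh.2 n
  · refine Lp.ext (e.trans (EventuallyEq.trans (EventuallyEq.of_eq ?_)
      (hν.coeFn_convL hp' _ _).symm))
    rw [groupConv_congr_ae hν.inv hf' ((coeFn_projL _ n _).trans (projT_congr_ae hh' n))]
    exact projT_groupConv_right hf.1 hf.2 hh.1 n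

/-- The idempotent is written twice, and one copy is moved into each factor. -/
theorem projL_convL [hp : Fact (1 ≤ p)] (hp' : p ≠ ∞) (n : ℤ)
    (F : Lp ℂ 1 (mackeyMeasure c μ)) (H : Lp ℂ p (mackeyMeasure c μ)) :
    projL c μ p hp' n (isConvMeasure_mackeyMeasure.convL p hp' F H)
      = isConvMeasure_mackeyMeasure.convL p hp' (projL c μ 1 ENNReal.one_ne_top n F)
        (projL c μ p hp' n H) := by
  rw [← projL_projL, (projL_convL_and hp' n F H).1, (projL_convL_and hp' n _ H).2]

/-- The $n$-th component of $F*H$ is the convolution of the $n$-th components, which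
`groupConv_embT` expresses by the twisted convolution; the coefficient of degree $n$ is then
compared. -/
theorem fourierCoeffT_groupConv (hp : 1 ≤ p) (hp' : p ≠ ∞) (hF : MemLp F 1 (mackeyMeasure c μ))
    (hH : MemLp H p (mackeyMeasure c μ)) (n : ℤ) :
    fourierCoeffT (groupConv (mackeyMeasure c μ) F H) n =ᵐ[μ]
      twistedConv (c ^ n) μ (fourierCoeffT F n) (fourierCoeffT H n) := by
  have : Fact (1 ≤ p) := ⟨hp⟩
  have hν : IsConvMeasure (mackeyMeasure c μ) := isConvMeasure_mackeyMeasure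
  have hF' : hF.toLp F =ᵐ[mackeyMeasure c μ] F := hF.coeFn_toLp
  have hH' : hH.toLp H =ᵐ[mackeyMeasure c μ] H := hH.coeFn_toLp
  have e1 := (coeFn_projL hp' n (hν.convL p hp' (hF.toLp F) (hH.toLp H))).trans
    (projT_congr_ae (hν.coeFn_convL hp' _ _) n)
  rw [groupConv_congr_ae hν.inv hF' hH', projL_convL] at e1
  have e2 := (hν.coeFn_convL hp' (projL c μ 1 ENNReal.one_ne_top n (hF.toLp F))
    (projL c μ p hp' n (hH.toLp H))).symm.trans e1
  rw [groupConv_congr_ae hν.inv ((coeFn_projL _ n _).trans (projT_congr_ae hF' n))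
    ((coeFn_projL _ n _).trans (projT_congr_ae hH' n)), projT, projT,
    groupConv_embT (memLp_fourierCoeffT le_rfl ENNReal.one_ne_top hF n).1
      (memLp_fourierCoeffT hp hp' hH n).1] at e2
  have e3 := fourierCoeffT_congr_ae e2 n
  rw [projT, fourierCoeffT_embT, fourierCoeffT_embT, if_pos rfl, if_pos rfl] at e3
  exact e3.symm

end ProjectionLp

/-! ### The involutions -/

section Involution

variable {G : Type*} [Group G] [TopologicalSpace G] [IsTopologicalGroup G] [LocallyCompactSpace G]

theorem modularFn_inv (x : G) : modularFn x⁻¹ = (Measure.modularCharacterFun x : ℝ) := by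
  rw [modularFn, inv_inv]

theorem modularFn_mul (x y : G) : modularFn (x * y) = modularFn x * modularFn y := by
  rw [modularFn, modularFn, modularFn, mul_inv_rev, Measure.modularCharacterFun_map_mul,
    NNReal.coe_mul, mul_comm]

theorem modularFn_mul_inv (x : G) : modularFn x * modularFn x⁻¹ = 1 := by
  rw [modularFn_inv, modularFn, ← NNReal.coe_mul, modularCharacterFun_inv_mul, NNReal.coe_one]

variable {c : ContinuousTwoCocycle G}

theorem mackeyInvol_mackeyInvol (F : MackeyGroup c → ℂ) : mackeyInvol (mackeyInvol F) = F := by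
  funext z
  rw [mackeyInvol, mackeyInvol, MackeyGroup.base_inv, inv_inv, inv_inv, map_mul,
    Complex.conj_ofReal, Complex.conj_conj, ← mul_assoc, ← Complex.ofReal_mul, mul_comm (modularFn _),
    modularFn_mul_inv, Complex.ofReal_one, one_mul]

theorem mackeyInvol_add (F H : MackeyGroup c → ℂ) :
    mackeyInvol (F + H) = mackeyInvol F + mackeyInvol H := by
  funext z
  simp [mackeyInvol, mul_add]

theorem mackeyInvol_smul (r : ℂ) (F : MackeyGroup c → ℂ) :
    mackeyInvol (r • F) = starRingEnd ℂ r • mackeyInvol F := by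
  funext z
  simp only [mackeyInvol, Pi.smul_apply, smul_eq_mul, map_mul]
  ring

theorem mackeyInvol_embT (n : ℤ) (f : G → ℂ) :
    mackeyInvol (embT c n f) = embT c n (twistedInvol (c ^ n) f) := by
  funext z
  have h : z⁻¹.phase = z.phase⁻¹ * c z.base z.base⁻¹ := by
    rw [c.map_inv_self]
    rfl
  simp only [mackeyInvol, embT, twistedInvol, h, MackeyGroup.base_inv,
    ContinuousTwoCocycle.zpow_apply, map_mul, Circle.coe_mul, Circle.coe_inv, mul_zpow, map_zpow₀,
    map_inv₀, Circle.coe_zpow, inv_zpow, Circle.conj_zpow, zpow_neg, inv_inv]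
  ring

/-- Only substitutions in the circle variable occur, so the identity holds at every $x$ and for
every function. -/
theorem fourierCoeffT_mackeyInvol (F : MackeyGroup c → ℂ) (n : ℤ) (x : G) :
    fourierCoeffT (mackeyInvol F) n x = twistedInvol (c ^ n) (fourierCoeffT F n) x := by
  -- At the point $(x^{-1},c(x,x^{-1}))$ the average runs over the phases of
  -- $(x,\tau)^{-1}=(x^{-1},\tau^{-1}c(x,x^{-1}))$, after $\tau\mapsto\tau^{-1}$.
  have h := projT_apply n F (MackeyGroup.mk c x⁻¹ (c x x⁻¹))
  simp only [MackeyGroup.mk_one_mul, MackeyGroup.base_mk, MackeyGroup.phase_mk] at h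
  rw [← integral_inv_eq_self, projT, embT] at h
  have h2 : (c ^ n) x x⁻¹ * fourierCoeffT F n x⁻¹
      = ∫ τ : Circle, F (MackeyGroup.mk c x⁻¹ (τ⁻¹ * c x x⁻¹)) * (τ : ℂ) ^ n ∂haarT := by
    rw [ContinuousTwoCocycle.zpow_apply, Circle.coe_zpow, mul_comm]
    refine h.trans (integral_congr_ae (Eventually.of_forall fun τ => ?_))
    simp only [← Circle.coe_inv_eq_conj, inv_inv]
  rw [twistedInvol, h2, ← integral_conj, ← integral_const_mul]
  refine integral_congr_ae (Eventually.of_forall fun τ => ?_)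
  simp only [mackeyInvol, MackeyGroup.mk_inv, MackeyGroup.base_mk, c.map_inv_self, map_mul,
    map_zpow₀, mul_assoc]

variable [MeasurableSpace G] [BorelSpace G] {μ : Measure G} [μ.IsHaarMeasure]

/-- The left translation $w\mapsto z^{-1}w$ and $m(z^{-1})=m(w^{-1})\,m(z^{-1}w)$ suffice; no
inversion of the integration variable is needed, and the identity is pointwise. -/
theorem mackeyInvol_groupConv (F H : MackeyGroup c → ℂ) :
    mackeyInvol (groupConv (mackeyMeasure c μ) F H)
      = groupConv (mackeyMeasure c μ) (mackeyInvol H) (mackeyInvol F) := by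
  funext z
  have h := integral_mul_left_eq_self (μ := mackeyMeasure c μ)
    (fun w => F w * H (w⁻¹ * z⁻¹)) z⁻¹
  rw [mackeyInvol, groupConv, ← h, ← integral_conj, ← integral_const_mul]
  refine integral_congr_ae (Eventually.of_forall fun w => ?_)
  have hm : (modularFn z.base⁻¹ : ℂ)
      = modularFn w.base⁻¹ * modularFn (w⁻¹ * z).base⁻¹ := by
    rw [← Complex.ofReal_mul, mul_comm, ← modularFn_mul, MackeyGroup.base_mul,
      MackeyGroup.base_inv]
    simp
  simp only [mackeyInvol]
  rw [hm]
  simp only [map_mul, mul_inv_rev, inv_inv, mul_inv_cancel_right]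
  ring

variable [μ.Regular]

theorem mackeyInvol_congr_ae {F H : MackeyGroup c → ℂ} (h : F =ᵐ[mackeyMeasure c μ] H) :
    mackeyInvol F =ᵐ[mackeyMeasure c μ] mackeyInvol H := by
  filter_upwards [quasiMeasurePreserving_mackey_inv.ae_eq_comp h] with z hz
  simp only [Function.comp_apply] at hz
  rw [mackeyInvol, mackeyInvol, hz]

theorem twistedInvol_congr_ae (d : ContinuousTwoCocycle G) {f g : G → ℂ} (h : f =ᵐ[μ] g) :
    twistedInvol d f =ᵐ[μ] twistedInvol d g := by
  filter_upwards [(quasiMeasurePreserving_inv_of_regular μ).ae_eq_comp h] with z hz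
  simp only [Function.comp_apply] at hz
  rw [twistedInvol, twistedInvol, hz]

theorem aestronglyMeasurable_mackeyInvol {F : MackeyGroup c → ℂ}
    (hF : AEStronglyMeasurable F (mackeyMeasure c μ)) :
    AEStronglyMeasurable (mackeyInvol F) (mackeyMeasure c μ) := by
  have h1 : Continuous fun z : MackeyGroup c => (modularFn z.base⁻¹ : ℂ) :=
    Complex.continuous_ofReal.comp
      (continuous_modularFn.comp MackeyGroup.continuous_base.inv)
  exact h1.aestronglyMeasurable.mul (Complex.continuous_conj.comp_aestronglyMeasurable
    (hF.comp_quasiMeasurePreserving quasiMeasurePreserving_mackey_inv))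

theorem eLpNorm_mackeyInvol {F : MackeyGroup c → ℂ}
    (hF : AEStronglyMeasurable F (mackeyMeasure c μ)) :
    eLpNorm (mackeyInvol F) 1 (mackeyMeasure c μ) = eLpNorm F 1 (mackeyMeasure c μ) := by
  rw [eLpNorm_congr_ae hF.ae_eq_mk, eLpNorm_congr_ae (mackeyInvol_congr_ae hF.ae_eq_mk),
    eLpNorm_one_eq_lintegral_enorm, eLpNorm_one_eq_lintegral_enorm,
    ← lintegral_modularCharacterFun_mul_mackey_inv hF.stronglyMeasurable_mk.measurable.enorm]
  refine lintegral_congr fun z => ?_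
  rw [mackeyInvol, enorm_mul, modularFn_inv]
  congr 1
  · simp [enorm_eq_nnnorm]
  · simp [enorm_eq_nnnorm]

theorem memLp_mackeyInvol {F : MackeyGroup c → ℂ} (hF : MemLp F 1 (mackeyMeasure c μ)) :
    MemLp (mackeyInvol F) 1 (mackeyMeasure c μ) :=
  ⟨aestronglyMeasurable_mackeyInvol hF.1, (eLpNorm_mackeyInvol hF.1).trans_lt hF.2⟩

variable (c) in
theorem memLp_twistedInvol (n : ℤ) {f : G → ℂ} (hf : MemLp f 1 μ) :
    MemLp (twistedInvol (c ^ n) f) 1 μ := by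
  have h := memLp_mackeyInvol (memLp_embT (c := c) hf n)
  rw [mackeyInvol_embT] at h
  have h' := memLp_fourierCoeffT le_rfl ENNReal.one_ne_top h n
  rwa [fourierCoeffT_embT, if_pos rfl] at h'

end Involution

/-! ### The Banach `*`-algebras -/

theorem coeFn_toL1 {X : Type*} [MeasurableSpace X] {ν : Measure X} {f : X → ℂ}
    (hf : MemLp f 1 ν) : toL1 ν f =ᵐ[ν] f := by
  rw [toL1, dif_pos hf]
  exact hf.coeFn_toLp

section Algebras

variable {G : Type*} [Group G] [TopologicalSpace G] [MeasurableSpace G]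
  {c : ContinuousTwoCocycle G} {μ : Measure G}

theorem MackeyL1.ext {F H : MackeyL1 c μ} (h : F.rep =ᵐ[mackeyMeasure c μ] H.rep) : F = H :=
  Lp.ext h

theorem MackeyL1.memLp_rep (F : MackeyL1 c μ) : MemLp F.rep 1 (mackeyMeasure c μ) :=
  Lp.memLp (show Lp ℂ 1 (mackeyMeasure c μ) from F)

theorem TwistedL1.memLp_rep (f : TwistedL1 c μ) : MemLp f.rep 1 μ :=
  Lp.memLp (show Lp ℂ 1 μ from f)

theorem MackeyL1.rep_add (F H : MackeyL1 c μ) :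
    (F + H).rep =ᵐ[mackeyMeasure c μ] F.rep + H.rep :=
  Lp.coeFn_add (show Lp ℂ 1 (mackeyMeasure c μ) from F) (show Lp ℂ 1 (mackeyMeasure c μ) from H)

theorem MackeyL1.rep_smul (r : ℂ) (F : MackeyL1 c μ) :
    (r • F).rep =ᵐ[mackeyMeasure c μ] r • F.rep :=
  Lp.coeFn_smul r (show Lp ℂ 1 (mackeyMeasure c μ) from F)

theorem MackeyL1.norm_eq (F : MackeyL1 c μ) :
    ‖F‖ = (eLpNorm F.rep 1 (mackeyMeasure c μ)).toReal :=
  Lp.norm_def (show Lp ℂ 1 (mackeyMeasure c μ) from F)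

/-- A normed space with a product and an involution that embeds isometrically into a Banach
`*`-algebra is one, if it is complete. -/
theorem IsBanachStarAlgebra.of_isometry {A B : Type*} [NormedAddCommGroup A] [NormedSpace ℂ A]
    [Mul A] [Star A] [NormedAddCommGroup B] [NormedSpace ℂ B] [Mul B] [Star B]
    (hB : IsBanachStarAlgebra B) (hA : CompleteSpace A) (Ψ : A →ₗᵢ[ℂ] B)
    (hmul : ∀ a b, Ψ (a * b) = Ψ a * Ψ b) (hstar : ∀ a, Ψ (star a) = star (Ψ a)) :
    IsBanachStarAlgebra A where
  complete := hA
  mul_assoc a b d := Ψ.injective (by simp only [hmul, hB.mul_assoc])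
  add_mul a b d := Ψ.injective (by simp only [hmul, map_add, hB.add_mul])
  mul_add a b d := Ψ.injective (by simp only [hmul, map_add, hB.mul_add])
  smul_mul r a b := Ψ.injective (by simp only [hmul, map_smul, hB.smul_mul])
  mul_smul r a b := Ψ.injective (by simp only [hmul, map_smul, hB.mul_smul])
  norm_mul_le a b := by
    rw [← Ψ.norm_map, hmul, ← Ψ.norm_map a, ← Ψ.norm_map b]
    exact hB.norm_mul_le _ _
  star_star a := Ψ.injective (by simp only [hstar, hB.star_star])
  star_mul a b := Ψ.injective (by simp only [hstar, hmul, hB.star_mul])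
  star_add a b := Ψ.injective (by simp only [hstar, map_add, hB.star_add])
  star_smul r a := Ψ.injective (by simp only [hstar, map_smul, hB.star_smul])
  norm_star a := by rw [← Ψ.norm_map, hstar, hB.norm_star, Ψ.norm_map]

variable [IsTopologicalGroup G] [LocallyCompactSpace G] [BorelSpace G] [μ.IsHaarMeasure]
  [μ.Regular]

theorem MackeyL1.rep_mul (F H : MackeyL1 c μ) :
    (F * H).rep =ᵐ[mackeyMeasure c μ] groupConv (mackeyMeasure c μ) F.rep H.rep :=
  coeFn_toL1 (isConvMeasure_mackeyMeasure.memLp_groupConv le_rfl ENNReal.one_ne_top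
    F.memLp_rep H.memLp_rep)

theorem MackeyL1.rep_star (F : MackeyL1 c μ) :
    (star F).rep =ᵐ[mackeyMeasure c μ] mackeyInvol F.rep :=
  coeFn_toL1 (memLp_mackeyInvol F.memLp_rep)

theorem TwistedL1.rep_mul (n : ℤ) (f g : TwistedL1 (c ^ n) μ) :
    (f * g).rep =ᵐ[μ] twistedConv (c ^ n) μ f.rep g.rep :=
  coeFn_toL1 (memLp_twistedConv le_rfl ENNReal.one_ne_top f.memLp_rep g.memLp_rep n)

theorem TwistedL1.rep_star (n : ℤ) (f : TwistedL1 (c ^ n) μ) :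
    (star f).rep =ᵐ[μ] twistedInvol (c ^ n) f.rep :=
  coeFn_toL1 (memLp_twistedInvol c n f.memLp_rep)

theorem isBanachStarAlgebra_mackeyL1 : IsBanachStarAlgebra (MackeyL1 c μ) := by
  have hν : IsConvMeasure (mackeyMeasure c μ) := isConvMeasure_mackeyMeasure
  have h1 : (1 : ℝ≥0∞) ≠ ∞ := ENNReal.one_ne_top
  have hcongr : ∀ {F F' H H' : MackeyGroup c → ℂ}, F =ᵐ[mackeyMeasure c μ] F' →
      H =ᵐ[mackeyMeasure c μ] H' → groupConv (mackeyMeasure c μ) F H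
        = groupConv (mackeyMeasure c μ) F' H' := fun h h' => groupConv_congr_ae hν.inv h h'
  constructor
  · exact inferInstanceAs (CompleteSpace (Lp ℂ 1 (mackeyMeasure c μ)))
  · intro a b d
    refine MackeyL1.ext ((MackeyL1.rep_mul _ _).trans (.trans ?_ (MackeyL1.rep_mul _ _).symm))
    rw [hcongr (MackeyL1.rep_mul a b) (ae_eq_refl d.rep),
      hcongr (ae_eq_refl a.rep) (MackeyL1.rep_mul b d)]
    exact hν.groupConv_assoc a.memLp_rep b.memLp_rep d.memLp_rep
  · intro a b d
    refine MackeyL1.ext ((MackeyL1.rep_mul _ _).trans (.trans ?_ (MackeyL1.rep_add _ _).symm))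
    rw [hcongr (MackeyL1.rep_add a b) (ae_eq_refl d.rep)]
    exact (hν.groupConv_add_left le_rfl h1 a.memLp_rep b.memLp_rep d.memLp_rep).trans
      ((MackeyL1.rep_mul a d).add (MackeyL1.rep_mul b d)).symm
  · intro a b d
    refine MackeyL1.ext ((MackeyL1.rep_mul _ _).trans (.trans ?_ (MackeyL1.rep_add _ _).symm))
    rw [hcongr (ae_eq_refl a.rep) (MackeyL1.rep_add b d)]
    exact (hν.groupConv_add_right le_rfl h1 a.memLp_rep b.memLp_rep d.memLp_rep).trans
      ((MackeyL1.rep_mul a b).add (MackeyL1.rep_mul a d)).symm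
  · intro r a b
    refine MackeyL1.ext ((MackeyL1.rep_mul _ _).trans (.trans ?_ (MackeyL1.rep_smul _ _).symm))
    rw [hcongr (MackeyL1.rep_smul r a) (ae_eq_refl b.rep), groupConv_smul_left]
    exact ((MackeyL1.rep_mul a b).const_smul r).symm
  · intro r a b
    refine MackeyL1.ext ((MackeyL1.rep_mul _ _).trans (.trans ?_ (MackeyL1.rep_smul _ _).symm))
    rw [hcongr (ae_eq_refl a.rep) (MackeyL1.rep_smul r b), groupConv_smul_right]
    exact ((MackeyL1.rep_mul a b).const_smul r).symm
  · intro a b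
    rw [MackeyL1.norm_eq, MackeyL1.norm_eq, MackeyL1.norm_eq, ← ENNReal.toReal_mul,
      eLpNorm_congr_ae (MackeyL1.rep_mul a b)]
    exact ENNReal.toReal_mono (ENNReal.mul_ne_top a.memLp_rep.2.ne b.memLp_rep.2.ne)
      (hν.eLpNorm_groupConv_le le_rfl h1 a.memLp_rep b.memLp_rep)
  · intro a
    refine MackeyL1.ext ((MackeyL1.rep_star _).trans ?_)
    refine (mackeyInvol_congr_ae (MackeyL1.rep_star a)).trans ?_
    rw [mackeyInvol_mackeyInvol]
  · intro a b
    refine MackeyL1.ext ((MackeyL1.rep_star _).trans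
      ((mackeyInvol_congr_ae (MackeyL1.rep_mul a b)).trans (.trans ?_ (MackeyL1.rep_mul _ _).symm)))
    rw [mackeyInvol_groupConv, hcongr (MackeyL1.rep_star b) (MackeyL1.rep_star a)]
  · intro a b
    refine MackeyL1.ext ((MackeyL1.rep_star _).trans
      ((mackeyInvol_congr_ae (MackeyL1.rep_add a b)).trans (.trans ?_ (MackeyL1.rep_add _ _).symm)))
    rw [mackeyInvol_add]
    exact ((MackeyL1.rep_star a).add (MackeyL1.rep_star b)).symm
  · intro r a
    refine MackeyL1.ext ((MackeyL1.rep_star _).trans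
      ((mackeyInvol_congr_ae (MackeyL1.rep_smul r a)).trans
        (.trans ?_ (MackeyL1.rep_smul _ _).symm)))
    rw [mackeyInvol_smul]
    exact ((MackeyL1.rep_star a).const_smul _).symm
  · intro a
    rw [MackeyL1.norm_eq, MackeyL1.norm_eq, eLpNorm_congr_ae (MackeyL1.rep_star a),
      eLpNorm_mackeyInvol a.memLp_rep.1]

end Algebras

/-! ### The graded subspaces -/

section Graded

variable {G : Type*} [Group G] [TopologicalSpace G] [MeasurableSpace G]
  {c : ContinuousTwoCocycle G} {μ : Measure G}

theorem coeffL_eq_zero_iff (k : ℤ) (F : MackeyL1 c μ) :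
    coeffL c μ 1 ENNReal.one_ne_top k F = 0 ↔ fourierCoeffT F.rep k =ᵐ[μ] 0 := by
  rw [Lp.eq_zero_iff_ae_eq_zero]
  have h : coeffL c μ 1 ENNReal.one_ne_top k F =ᵐ[μ] fourierCoeffT F.rep k := coeFn_coeffL _ k _
  exact ⟨fun h' => h.symm.trans h', fun h' => h.trans h'⟩

/-- An intersection of kernels of continuous coefficient maps. -/
theorem isClosed_gradedSubspace (n : ℤ) :
    IsClosed (gradedSubspace c μ n : Set (MackeyL1 c μ)) := by
  have h : (gradedSubspace c μ n : Set (MackeyL1 c μ))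
      = ⋂ k : ℤ, ⋂ _ : k ≠ n, {F : MackeyL1 c μ | coeffL c μ 1 ENNReal.one_ne_top k F = 0} := by
    ext F
    exact ⟨fun h => Set.mem_iInter₂.2 fun k hk => (coeffL_eq_zero_iff k F).2 (h k hk),
      fun h k hk => (coeffL_eq_zero_iff k F).1 (Set.mem_iInter₂.1 h k hk)⟩
  rw [h]
  exact isClosed_iInter fun k => isClosed_iInter fun _ =>
    isClosed_singleton.preimage (coeffL c μ 1 ENNReal.one_ne_top k).continuous

theorem twistedConv_of_ae_eq_zero (d : ContinuousTwoCocycle G) {f : G → ℂ} (hf : f =ᵐ[μ] 0)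
    (g : G → ℂ) : twistedConv d μ f g = 0 := by
  funext x
  refine integral_eq_zero_of_ae ?_
  filter_upwards [hf] with y hy
  simp [twistedIntegrand, hy]

variable (c μ) in
/-- The embedding `f ↦ f(x) τⁿ` of `L¹(G, cⁿ)` into `L¹(G_c)`. -/
def twistedEmb (n : ℤ) : TwistedL1 (c ^ n) μ →ₗᵢ[ℂ] MackeyL1 c μ := embL c μ 1 n

theorem rep_twistedEmb (n : ℤ) (f : TwistedL1 (c ^ n) μ) :
    (twistedEmb c μ n f).rep =ᵐ[mackeyMeasure c μ] embT c n f.rep :=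
  coeFn_embL n _

theorem twistedEmb_mem (n : ℤ) (f : TwistedL1 (c ^ n) μ) :
    twistedEmb c μ n f ∈ gradedSubspace c μ n := by
  intro k hk
  refine (fourierCoeffT_congr_ae (rep_twistedEmb n f) k).trans ?_
  rw [fourierCoeffT_embT, if_neg hk]

/-- All coefficients of $F-P_nF$ vanish, so uniqueness of Fourier coefficients applies. This is
surjectivity of the embedding onto the graded subspace. -/
theorem rep_ae_eq_projT {n : ℤ} {F : MackeyL1 c μ} (hF : F ∈ gradedSubspace c μ n) :
    F.rep =ᵐ[mackeyMeasure c μ] projT n F.rep := by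
  have h1 : (1 : ℝ≥0∞) ≠ ∞ := ENNReal.one_ne_top
  have hP := memLp_projT le_rfl h1 F.memLp_rep n
  have hN : MemLp ((-1 : ℂ) • projT n F.rep) 1 (mackeyMeasure c μ) := hP.const_smul _
  have h0 : F.rep + (-1 : ℂ) • projT n F.rep =ᵐ[mackeyMeasure c μ] 0 := by
    refine ae_eq_zero_of_fourierCoeffT le_rfl h1 (F.memLp_rep.add hN) fun k => ?_
    refine (fourierCoeffT_add_ae le_rfl h1 F.memLp_rep hN k).trans ?_
    rw [fourierCoeffT_smul, projT, fourierCoeffT_embT]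
    split_ifs with hk
    · subst hk
      exact Eventually.of_forall fun x => by simp
    · filter_upwards [hF k hk] with x hx
      simp [hx]
  filter_upwards [h0] with z hz
  simpa [add_neg_eq_zero] using hz

variable (c μ) in
/-- The isometric isomorphism of `L¹(G, cⁿ)` with `L¹(G_c)_n`. -/
def twistedEquiv (n : ℤ) : TwistedL1 (c ^ n) μ ≃ₗᵢ[ℂ] gradedSubspace c μ n where
  toFun f := ⟨twistedEmb c μ n f, twistedEmb_mem n f⟩
  invFun F := coeffL c μ 1 ENNReal.one_ne_top n (F : MackeyL1 c μ)
  left_inv f := by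
    refine Lp.ext ((coeFn_coeffL _ n _).trans ?_)
    refine (fourierCoeffT_congr_ae (rep_twistedEmb n f) n).trans ?_
    rw [fourierCoeffT_embT, if_pos rfl]
    rfl
  right_inv F := by
    refine Subtype.ext (MackeyL1.ext ((rep_twistedEmb n _).trans
      (.trans (embT_congr_ae (coeFn_coeffL _ n _) n) (rep_ae_eq_projT F.2).symm)))
  map_add' f g := Subtype.ext (map_add (twistedEmb c μ n) f g)
  map_smul' r f := Subtype.ext (map_smul (twistedEmb c μ n) r f)
  norm_map' f := (twistedEmb c μ n).norm_map f

variable [IsTopologicalGroup G] [LocallyCompactSpace G] [BorelSpace G] [μ.IsHaarMeasure]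
  [μ.Regular]

/-- The $k$-th coefficient of the product is $F_k\natural_{c^k}H_k$, which vanishes as soon as $F_k$
does. -/
theorem mul_mem_gradedSubspace {n : ℤ} {F H : MackeyL1 c μ} (hF : F ∈ gradedSubspace c μ n) :
    F * H ∈ gradedSubspace c μ n := by
  intro k hk
  refine (fourierCoeffT_congr_ae (MackeyL1.rep_mul F H) k).trans
    ((fourierCoeffT_groupConv le_rfl ENNReal.one_ne_top F.memLp_rep H.memLp_rep k).trans ?_)
  rw [twistedConv_of_ae_eq_zero _ (hF k hk)]

theorem star_mem_gradedSubspace {n : ℤ} {F : MackeyL1 c μ} (hF : F ∈ gradedSubspace c μ n) :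
    star F ∈ gradedSubspace c μ n := by
  intro k hk
  refine (fourierCoeffT_congr_ae (MackeyL1.rep_star F) k).trans ?_
  rw [funext (fourierCoeffT_mackeyInvol F.rep k)]
  refine (twistedInvol_congr_ae _ (hF k hk)).trans (Eventually.of_forall fun x => ?_)
  simp [twistedInvol]

theorem twistedEmb_mul (n : ℤ) (f g : TwistedL1 (c ^ n) μ) :
    twistedEmb c μ n (f * g) = twistedEmb c μ n f * twistedEmb c μ n g := by
  refine MackeyL1.ext ((rep_twistedEmb n _).trans
    (.trans (embT_congr_ae (TwistedL1.rep_mul n f g) n) (.trans ?_ (MackeyL1.rep_mul _ _).symm)))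
  rw [groupConv_congr_ae quasiMeasurePreserving_mackey_inv (rep_twistedEmb n f)
    (rep_twistedEmb n g), groupConv_embT f.memLp_rep.1 g.memLp_rep.1]

theorem twistedEmb_star (n : ℤ) (f : TwistedL1 (c ^ n) μ) :
    twistedEmb c μ n (star f) = star (twistedEmb c μ n f) := by
  refine MackeyL1.ext ((rep_twistedEmb n _).trans
    (.trans (embT_congr_ae (TwistedL1.rep_star n f) n) (.trans ?_ (MackeyL1.rep_star _).symm)))
  rw [← mackeyInvol_embT]
  exact (mackeyInvol_congr_ae (rep_twistedEmb n f)).symm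

theorem isBanachStarAlgebra_twistedL1 (n : ℤ) : IsBanachStarAlgebra (TwistedL1 (c ^ n) μ) :=
  isBanachStarAlgebra_mackeyL1.of_isometry (inferInstanceAs (CompleteSpace (Lp ℂ 1 μ)))
    (twistedEmb c μ n) (twistedEmb_mul n) (twistedEmb_star n)

end Graded

end

/-! ### The theorem -/

theorem proposition3p4 {G : Type*} [Group G] [TopologicalSpace G] [IsTopologicalGroup G]
    [LocallyCompactSpace G] [T2Space G] [MeasurableSpace G] [BorelSpace G]
    (μ : Measure G) [μ.IsHaarMeasure] [μ.Regular] (c : ContinuousTwoCocycle G) :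
    -- the convolution identity
    (∀ (p : ℝ≥0∞), 1 ≤ p → p ≠ ∞ → ∀ F H : MackeyGroup c → ℂ,
      MemLp F 1 (mackeyMeasure c μ) → MemLp H p (mackeyMeasure c μ) →
      -- all the functions involved exist
      (∀ᵐ z ∂(mackeyMeasure c μ),
        Integrable (fun w => F w * H (w⁻¹ * z)) (mackeyMeasure c μ)) ∧
      MemLp (mackeyConv c μ F H) p (mackeyMeasure c μ) ∧
      (∀ n : ℤ, MemLp (fourierCoeffT F n) 1 μ ∧ MemLp (fourierCoeffT H n) p μ ∧
        (∀ᵐ x ∂μ,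
          Integrable (twistedIntegrand (c ^ n) (fourierCoeffT F n) (fourierCoeffT H n) x) μ) ∧
        MemLp (twistedConv (c ^ n) μ (fourierCoeffT F n) (fourierCoeffT H n)) p μ) ∧
      -- the Fourier series of `F * H` is `∑ (F_n ♮_{cⁿ} H_n)(x) τⁿ`
      (∀ n : ℤ, fourierCoeffT (mackeyConv c μ F H) n =ᵐ[μ]
        twistedConv (c ^ n) μ (fourierCoeffT F n) (fourierCoeffT H n)) ∧
      -- it represents `F * H`
      ConvergesInLp μ p (trigCesaroMean c
        (fun n => twistedConv (c ^ n) μ (fourierCoeffT F n) (fourierCoeffT H n)))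
        (mackeyConv c μ F H) ∧
      (1 < p → ConvergesInLp μ p (trigPartialSum c
        (fun n => twistedConv (c ^ n) μ (fourierCoeffT F n) (fourierCoeffT H n)))
        (mackeyConv c μ F H))) ∧
    -- the involution identity
    (∀ F : MackeyGroup c → ℂ, MemLp F 1 (mackeyMeasure c μ) →
      MemLp (mackeyInvol F) 1 (mackeyMeasure c μ) ∧
      ∀ (n : ℤ) (x : G),
        fourierCoeffT (mackeyInvol F) n x = twistedInvol (c ^ n) (fourierCoeffT F n) x) ∧
    -- the graded subspaces
    IsBanachStarAlgebra (MackeyL1 c μ) ∧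
    ∀ n : ℤ,
      IsBanachStarAlgebra (TwistedL1 (c ^ n) μ) ∧
      IsClosed (gradedSubspace c μ n : Set (MackeyL1 c μ)) ∧
      (∀ F ∈ gradedSubspace c μ n, ∀ H ∈ gradedSubspace c μ n, F * H ∈ gradedSubspace c μ n) ∧
      (∀ F ∈ gradedSubspace c μ n, star F ∈ gradedSubspace c μ n) ∧
      ∃ Φ : TwistedL1 (c ^ n) μ ≃ₗᵢ[ℂ] gradedSubspace c μ n,
        (∀ f, (Φ f : MackeyL1 c μ).rep =ᵐ[mackeyMeasure c μ]
          fun z => f.rep z.base * (z.phase : ℂ) ^ n) ∧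
        (∀ F : gradedSubspace c μ n,
          (Φ.symm F).rep =ᵐ[μ] fourierCoeffT (F : MackeyL1 c μ).rep n) ∧
        (∀ f g, (Φ (f * g) : MackeyL1 c μ) = (Φ f : MackeyL1 c μ) * (Φ g : MackeyL1 c μ)) ∧
        (∀ f, (Φ (star f) : MackeyL1 c μ) = star (Φ f : MackeyL1 c μ)) := by
  refine ⟨fun p hp hp' F H hF hH => ?_, fun F hF => ⟨memLp_mackeyInvol hF,
    fourierCoeffT_mackeyInvol F⟩, isBanachStarAlgebra_mackeyL1, fun n => ?_⟩
  -- By definition `mackeyConv` is `groupConv` for `mackeyMeasure`, so the results on convolution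
  -- apply as they stand.
  · have hconv := isConvMeasure_mackeyMeasure.memLp_groupConv hp hp' hF hH
    have hcoeff := fourierCoeffT_groupConv hp hp' hF hH
    refine ⟨isConvMeasure_mackeyMeasure.ae_integrable hp hp' hF hH, hconv, fun n => ?_, hcoeff,
      convergesInLp_trigCesaroMean hp hp' hconv hcoeff,
      fun hp1 => convergesInLp_trigPartialSum hp1 hp' hconv hcoeff⟩
    have hFn := memLp_fourierCoeffT le_rfl ENNReal.one_ne_top hF n
    have hHn := memLp_fourierCoeffT hp hp' hH n
    exact ⟨hFn, hHn, ae_integrable_twistedIntegrand hp hp' hFn hHn n,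
      memLp_twistedConv hp hp' hFn hHn n⟩
  · exact ⟨isBanachStarAlgebra_twistedL1 n, isClosed_gradedSubspace n,
      fun F hF H _ => mul_mem_gradedSubspace hF, fun F hF => star_mem_gradedSubspace hF,
      twistedEquiv c μ n, rep_twistedEmb n, fun F => coeFn_coeffL ENNReal.one_ne_top n _,
      twistedEmb_mul n,
      twistedEmb_star n⟩
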